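/- Throughout, posets are finite. For a poset $X$ and a subset $S\subseteq X$ let $\mathcal K(S)$ be the order complex of $S$ (the simplicial complex of nonempty chains of $S$) and $|\mathcal K(S)|$ its geometric realization. For $x\in X$ let $\hat U_x=\{y\in X : y<x\}$ be the descending link of $x$ (taken in all of $X$). For a simplicial complex $L$ and a vertex $x\notin L$, $xL$ is the simplicial cone with apex $x$ and base $L$ (the point $x$ if $L=\emptyset$). We write $x\prec y$ if $y$ covers $x$. Let $A\subseteq X$ be a down-set and $A^c=X\setminus A$, as a subposet. Let $f:A^c\to\mathbb R$ be a Morse function, i.e. $f(x)<f(y)$ whenever $x\prec y$ in $A^c$. Let $M$ be an admissible Morse matching for $f$, that is, a set of pairs $(x,y)$ with $x\prec y$ in $A^c$ such that: no two different pairs share a point; the directed graph on $A^c$ with the edges $x\to y$ for $(x,y)\in M$ and $y\to x$ for $x\prec y$, $(x,y)\notin M$, has no directed cycle; and for every $(x,y)\in M$ the space $|\mathcal K(\hat U_y\setminus\{x\})|$ is contractible and there is no $z\in A^c$ with $f(x)<f(z)<f(y)$. A point of $A^c$ is critical if it belongs to no pair in $M$. Let $t_0<t_1<\dots<t_r$ be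 the values of $f$ and let $C_i$ be the set of critical points $x$ with $f(x)=t_i$. **Theorem.** There is a filtration of $X$ by subposets $$A=\tilde X_{-1}\subseteq X_0\subseteq\tilde X_0\subseteq X_1\subseteq\tilde X_1\subseteq\dots\subseteq X_r=\tilde X_r=X$$ (if $A=X$, there are no values and the filtration is just $A=\tilde X_{-1}=X$) such that for all $0\le i\le r$: 1. $\mathcal K(X_i)=\mathcal K(\tilde X_{i-1})\cup\bigcup_{x\in C_i}x\,\mathcal K(\hat U_x)$, and $\mathcal K(\tilde X_{i-1})\cap x\,\mathcal K(\hat U_x)=\mathcal K(\hat U_x)$ for every $x\in C_i$; in particular $\hat U_x\subseteq\tilde X_{i-1}$. 2. $|\mathcal K(X_i)|$ is a strong deformation retract of $|\mathcal K(\tilde X_i)|$. Moreover, $|\mathcal K(X)|$ is homotopy equivalent to a CW complex constructed from $|\mathcal K(A)|$ by inductively gluing the cones over the descending links of the critical points: there are Hausdorff spaces $Y_{-1},Y_0,\dots,Y_r$, each admitting the structure of a CW complex, and homotopy equivalences $h_i:|\mathcal K(\tilde X_i)|\to Y_i$ for $-1\le i\le r$, such that $h_{-1}:|\mathcal K(A)|\to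 Y_{-1}$ is a homeomorphism and, for $0\le i\le r$, $Y_i$ is the adjunction space (topological pushout) $$Y_i=Y_{i-1}\cup_{\varphi_i}\coprod_{x\in C_i}|x\,\mathcal K(\hat U_x)|,\qquad \varphi_i=h_{i-1}|:\coprod_{x\in C_i}|\mathcal K(\hat U_x)|\to Y_{i-1},$$ and the restriction of $h_i$ to $|\mathcal K(\tilde X_{i-1})|$ is homotopic to $h_{i-1}$ followed by the canonical map $Y_{i-1}\to Y_i$. In particular $|\mathcal K(X)|\simeq Y_r$ (and $|\mathcal K(X)|\simeq Y_{-1}$ if $A=X$). Finally, if there are no critical points, the inclusion $|\mathcal K(A)|\subseteq|\mathcal K(X)|$ is a homotopy equivalence. -/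

import Mathlib

open Set CategoryTheory

universe u

namespace PosetMorse

section Complexes

variable {X : Type u}

/-- The order complex `K(S)` of a subposet `S` of `X`: its faces are the nonempty finite chains
of elements of `S`. All these complexes have vertices in `X`, so that `K(S) ≤ K(T)` is literally
the inclusion of a subcomplex when `S ⊆ T`. -/
def orderComplex [PartialOrder X] (S : Set X) : PreAbstractSimplicialComplex X where
  faces := {s | s.Nonempty ∧ (s : Set X) ⊆ S ∧ IsChain (· ≤ ·) (s : Set X)}
  isRelLowerSet_faces := by
    rintro s ⟨hne, hS, hch⟩
    refine ⟨hne, fun t hts ht => ⟨ht, ?_, ?_⟩⟩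
    · exact (Finset.coe_subset.2 hts).trans hS
    · exact hch.mono (Finset.coe_subset.2 hts)

open Classical in
/-- The simplicial cone `xL` with apex `x` and base `L` (`x` is meant not to be a vertex of `L`):
the faces of `L`, the apex, and the faces of `L` with the apex added. If `L` is empty, the cone
is the point `x`. -/
def simplicialCone (x : X) (L : PreAbstractSimplicialComplex X) :
    PreAbstractSimplicialComplex X where
  faces := {s | s ∈ L ∨ s = {x} ∨ ∃ t ∈ L, s = insert x t}
  isRelLowerSet_faces := by
    intro s hs
    refine ⟨?_, fun t hts ht => ?_⟩
    · rcases hs with hs | rfl | ⟨t, -, rfl⟩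
      · exact (L.isRelLowerSet_faces hs).1
      · exact Finset.singleton_nonempty x
      · exact Finset.insert_nonempty x t
    · have key : ∀ s' ∈ L, t ⊆ insert x s' → t ∈ L ∨ t = {x} ∨ ∃ t' ∈ L, t = insert x t' := by
        intro s' hs' h
        by_cases hx : x ∈ t
        · by_cases he : (t.erase x).Nonempty
          · exact Or.inr (Or.inr ⟨t.erase x, (L.isRelLowerSet_faces hs').2
              (Finset.subset_insert_iff.1 h) he, (Finset.insert_erase hx).symm⟩)
          · refine Or.inr (Or.inl ?_)
            rw [← Finset.insert_erase hx, Finset.not_nonempty_iff_eq_empty.1 he]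
            rfl
        · exact Or.inl ((L.isRelLowerSet_faces hs').2
            ((Finset.subset_insert_iff_of_notMem hx).1 h) ht)
      rcases hs with hs | rfl | ⟨s', hs', rfl⟩
      · exact Or.inl ((L.isRelLowerSet_faces hs).2 hts ht)
      · exact Or.inr (Or.inl ((Finset.subset_singleton_iff.1 hts).resolve_left ht.ne_empty))
      · exact key s' hs' hts

/-- The geometric realization `|K|` of a simplicial complex with finite vertex set `X`, in
barycentric coordinates: the points of the standard simplex on `X` whose support is contained in a
face of `K`, with the topology of a subspace of `X → ℝ`. -/
def realization [Fintype X] (K : PreAbstractSimplicialComplex X) : Set (X → ℝ) :=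
  {p | p ∈ stdSimplex ℝ X ∧ ∃ s ∈ K, ∀ v, p v ≠ 0 → v ∈ s}

lemma orderComplex_mono [PartialOrder X] {S T : Set X} (h : S ⊆ T) :
    orderComplex S ≤ orderComplex T :=
  fun _ hs => ⟨hs.1, hs.2.1.trans h, hs.2.2⟩

lemma le_simplicialCone (x : X) (L : PreAbstractSimplicialComplex X) :
    L ≤ simplicialCone x L :=
  fun _ hs => Or.inl hs

lemma realization_mono [Fintype X] {K L : PreAbstractSimplicialComplex X} (h : K ≤ L) :
    realization K ⊆ realization L :=
  fun _ ⟨hp, s, hs, hps⟩ => ⟨hp, s, h hs, hps⟩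

/-- The inclusion `|K| → |L|` of the realization of a subcomplex `K` of `L`. -/
def realizationIncl [Fintype X] {K L : PreAbstractSimplicialComplex X} (h : K ≤ L) :
    C(realization K, realization L) :=
  ⟨Set.inclusion (realization_mono h), continuous_inclusion (realization_mono h)⟩

end Complexes

section Homotopy

/-- `S` is a strong deformation retract of `T` (both are subspaces of `E`): `S ⊆ T` and there is a
homotopy from the identity of `T` to a map with values in `S` which is stationary on `S`. -/
def IsStrongDeformationRetract {E : Type*} [TopologicalSpace E] (S T : Set E) : Prop :=
  S ⊆ T ∧ ∃ H : C(unitInterval × T, T),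
    (∀ p : T, H (0, p) = p) ∧ (∀ p : T, (H (1, p) : E) ∈ S) ∧
      ∀ (τ : unitInterval) (p : T), (p : E) ∈ S → H (τ, p) = p

/-- The continuous map `g` is a homotopy equivalence. -/
def IsHomotopyEquivalence {Y Z : Type*} [TopologicalSpace Y] [TopologicalSpace Z]
    (g : C(Y, Z)) : Prop :=
  ∃ e : ContinuousMap.HomotopyEquiv Y Z, e.toFun = g

/-- `Y` is a (Hausdorff) space which admits the structure of a CW complex. -/
def IsCWComplex (Y : Type*) [TopologicalSpace Y] : Prop :=
  T2Space Y ∧ Nonempty (Topology.CWComplex (univ : Set Y))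

/-- `Y'`, with the maps `j : Y → Y'` and `k : D → Y'`, is the adjunction space `Y ∪_φ D` obtained
by gluing `D` to `Y` along `φ : B → Y`, where `ι : B → D` is the inclusion of the base: the square
formed by `φ`, `ι`, `j`, `k` is a pushout of topological spaces. -/
def IsAdjunctionSpace {B D Y Y' : Type u} [TopologicalSpace B] [TopologicalSpace D]
    [TopologicalSpace Y] [TopologicalSpace Y'] (φ : C(B, Y)) (ι : C(B, D))
    (j : C(Y, Y')) (k : C(D, Y')) : Prop :=
  IsPushout (TopCat.ofHom φ) (TopCat.ofHom ι) (TopCat.ofHom j) (TopCat.ofHom k)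

end Homotopy

section Links

variable {X : Type u} [Fintype X] [PartialOrder X]

/-- The disjoint union over `x ∈ C` of the realizations of the order complexes of the
descending links `{y | y < x}`, taken in the whole poset. -/
abbrev Links (C : Set X) : Type u :=
  Σ x : C, realization (orderComplex (Iio (x : X)))

/-- The disjoint union over `x ∈ C` of the realizations of the cones `x K({y | y < x})`. -/
abbrev LinkCones (C : Set X) : Type u :=
  Σ x : C, realization (simplicialCone (x : X) (orderComplex (Iio (x : X))))

/-- The inclusion of the bases into the cones. -/
def linksToCones (C : Set X) : C(Links C, LinkCones C) :=
  ⟨Sigma.map id fun x => realizationIncl (le_simplicialCone (x : X) _),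
    Continuous.sigma_map fun x => (realizationIncl (le_simplicialCone (x : X) _)).continuous⟩

/-- The map into `|K(S)|` given on each descending link by the inclusion, if `S` contains the
descending links of all `x ∈ C`. -/
def linksTo (C S : Set X) (h : ∀ x ∈ C, Iio x ⊆ S) :
    C(Links C, realization (orderComplex S)) :=
  ⟨fun p => realizationIncl (orderComplex_mono (h p.1 p.1.2)) p.2,
    continuous_sigma fun x => (realizationIncl (orderComplex_mono (h x x.2))).continuous⟩

end Links

section Matchings

variable {P : Type*} [PartialOrder P]

/-- A Morse function on a finite poset: it increases along the edges of the Hasse diagram. -/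
def IsMorseFunction (f : P → ℝ) : Prop :=
  ∀ x y : P, x ⋖ y → f x < f y

/-- `M` is a matching on the Hasse diagram of `P`: a set of edges `(x, y)`, `x ⋖ y`, such that
no two different ones have a common endpoint. -/
def IsHasseMatching (M : Set (P × P)) : Prop :=
  (∀ e ∈ M, e.1 ⋖ e.2) ∧
    ∀ e ∈ M, ∀ e' ∈ M, (e.1 = e'.1 ∨ e.1 = e'.2 ∨ e.2 = e'.1 ∨ e.2 = e'.2) → e = e'

/-- The edges of the directed graph obtained from the Hasse diagram (with the edges `x → y` for
`x ⋖ y`) by reversing the edges which are not in `M`. -/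
def MatchingStep (M : Set (P × P)) (x y : P) : Prop :=
  (x ⋖ y ∧ (x, y) ∈ M) ∨ (y ⋖ x ∧ (y, x) ∉ M)

/-- A Morse matching: a matching on the Hasse diagram whose modified directed graph has no
directed cycles. -/
def IsMorseMatching (M : Set (P × P)) : Prop :=
  IsHasseMatching M ∧ ∀ x : P, ¬ Relation.TransGen (MatchingStep M) x x

/-- The points not incident to any edge of `M`. -/
def IsCritical (M : Set (P × P)) (c : P) : Prop :=
  ∀ e ∈ M, e.1 ≠ c ∧ e.2 ≠ c

end Matchings

section Relative

variable {X : Type u} [Fintype X] [PartialOrder X]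

/-- The edge `(x, y)` of the Hasse diagram of the complement of `A` is admissible for `f`: the
order complex of `{z ∈ X | z < y} \ {x}` (taken in the whole of `X`) is contractible, and no value
of `f` lies strictly between `f x` and `f y`. -/
def IsAdmissibleEdge (A : Set X) (f : (Aᶜ : Set X) → ℝ) (x y : (Aᶜ : Set X)) : Prop :=
  ContractibleSpace (realization (orderComplex (Iio (y : X) \ {(x : X)}))) ∧
    ¬ ∃ z : (Aᶜ : Set X), f x < f z ∧ f z < f y

/-- A Morse matching on the complement of `A` all of whose edges are admissible for `f`. -/
def IsAdmissibleMorseMatching (A : Set X) (f : (Aᶜ : Set X) → ℝ)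
    (M : Set ((Aᶜ : Set X) × (Aᶜ : Set X))) : Prop :=
  IsMorseMatching M ∧ ∀ e ∈ M, IsAdmissibleEdge A f e.1 e.2

/-- The set of critical points of value `a`, as a subset of `X`. -/
def criticalSet (A : Set X) (f : (Aᶜ : Set X) → ℝ) (M : Set ((Aᶜ : Set X) × (Aᶜ : Set X)))
    (a : ℝ) : Set X :=
  Subtype.val '' {c : (Aᶜ : Set X) | IsCritical M c ∧ f c = a}

end Relative

end PosetMorse

open PosetMorse

/-!
The points outside of `A` are ordered by their entry value: the upper point `y` of an edge `(x, y)`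
of the matching enters together with `x`, at the value `f x`, and all other points enter at their
value. Adding the points of entry value `a` means adding the critical points of value `a`, whose
cones are attached along their descending links, and then the edges `(x, y)` with `f x = a`. Since
the matching is acyclic, the edges can be added one by one in an order in which `x` is maximal and
the descending link of `y` without `x` is present when `(x, y)` is added; admissibility excludes
that earlier points lie above `x` or `y`. Adding such an edge enlarges the order complex by a cone,
which meets it in the contractible complex of the descending link of `y` without `x`; as inclusions
of subcomplexes are cofibrations, this is inverse to a strong deformation retraction. This is the
content of `isStrongDeformationRetract_insert_pair` and `isStrongDeformationRetract_stage`.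

The spaces `Y i` are built along the filtration, together with homotopy equivalences from the
realizations of the stages. If `h : |K(S)| → Y` is one of them and critical points with descending
links in `S` are added to get `S ∪ C`, the adjunction space `Y'` is also the pushout of `h` along
the inclusion `|K(S)| → |K(S ∪ C)|`, and the gluing lemma
(`NeighborhoodDeformation.isHomotopyEquivalence_pushout`) says that `|K(S ∪ C)| → Y'` is a homotopy
equivalence. It rests on the homotopy extension property and on the equivalence of the fundamental
groupoids of the mapping spaces out of homotopy equivalent spaces
(`IsHomotopyEquivalence.exists_homotopy_lift`). Composition with the retraction of the next stage
onto `S ∪ C` gives the next homotopy equivalence.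

For `Y'` to be a CW complex, whose cells are those of `Y` and the new simplices
(`IsGluing.exists_CWComplex`), the map `h` has to be cellular. This is achieved by replacing `h` by
a homotopic map at every stage (`exists_cellular_approximation`), which is allowed as the theorem
asks for compatibility with the previous map only up to homotopy. The essential point of cellular
approximation is that a map from a complex of dimension less than `m` can be moved off the centre
of an `m`-cell: on a closed part of the cell it is close to the restriction of a smooth map, and the
image of a smooth map from a space of smaller dimension has dense complement.
-/

namespace PosetMorse

open unitInterval

/-! ### Gluing continuous maps and extending homotopies -/

/-- Two continuous maps on closed subspaces covering `X` which agree on the intersection glue. -/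
lemma exists_continuousMap_of_isClosed_cover {X T : Type*} [TopologicalSpace X]
    [TopologicalSpace T] {S₁ S₂ : Set X} (h₁ : IsClosed S₁) (h₂ : IsClosed S₂)
    (hcov : ∀ x, x ∈ S₁ ∨ x ∈ S₂) (f : C(S₁, T)) (g : C(S₂, T))
    (hfg : ∀ x (hx₁ : x ∈ S₁) (hx₂ : x ∈ S₂), f ⟨x, hx₁⟩ = g ⟨x, hx₂⟩) :
    ∃ H : C(X, T), (∀ x (hx : x ∈ S₁), H x = f ⟨x, hx⟩) ∧ ∀ x (hx : x ∈ S₂), H x = g ⟨x, hx⟩ := by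
  classical
  set H : X → T := fun x => if hx : x ∈ S₁ then f ⟨x, hx⟩ else g ⟨x, (hcov x).resolve_left hx⟩
  have H1 : ∀ x (hx : x ∈ S₁), H x = f ⟨x, hx⟩ := fun x hx => dif_pos hx
  have H2 : ∀ x (hx : x ∈ S₂), H x = g ⟨x, hx⟩ := fun x hx => by
    by_cases hx' : x ∈ S₁
    · rw [H1 x hx', hfg x hx' hx]
    · exact dif_neg hx'
  have c1 : ContinuousOn H S₁ := by
    rw [continuousOn_iff_continuous_domRestrict]
    convert f.continuous using 1
    ext x
    exact H1 x x.2
  have c2 : ContinuousOn H S₂ := by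
    rw [continuousOn_iff_continuous_domRestrict]
    convert g.continuous using 1
    ext x
    exact H2 x x.2
  refine ⟨⟨H, ?_⟩, H1, H2⟩
  rw [← continuousOn_univ, ← eq_univ_of_forall (s := S₁ ∪ S₂) hcov]
  exact c1.union_of_isClosed c2 h₁ h₂

/-- A neighbourhood deformation of `X` into `A`: the function `u` vanishes on `A`, the homotopy
`D` starts at the identity, fixes `A`, and has moved `x` into `A` at all times `≥ u x`. Points with
`u x > 1` need not reach `A`. -/
structure NeighborhoodDeformation {X : Type*} [TopologicalSpace X] (A : Set X) where
  /-- the time needed to move a point into `A` -/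
  u : C(X, ℝ)
  /-- the deformation -/
  D : C(I × X, X)
  u_eq_zero : ∀ x ∈ A, u x = 0
  D_zero : ∀ x, D (0, x) = x
  D_fix : ∀ t, ∀ x ∈ A, D (t, x) = x
  D_mem : ∀ (t : I) (x : X), u x ≤ t → D (t, x) ∈ A

namespace NeighborhoodDeformation

variable {A X T : Type*} [TopologicalSpace A] [TopologicalSpace X] [TopologicalSpace T]

/-- A real number, truncated to the unit interval. -/
noncomputable def trunc : C(ℝ, I) := ⟨Set.projIcc 0 1 zero_le_one, continuous_projIcc⟩

lemma trunc_coe (t : I) : trunc (t : ℝ) = t := Set.projIcc_val zero_le_one t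

lemma trunc_zero : trunc 0 = 0 := trunc_coe 0

lemma trunc_one : trunc 1 = 1 := trunc_coe 1

lemma trunc_of_nonpos {x : ℝ} (h : x ≤ 0) : trunc x = 0 := Set.projIcc_of_le_left zero_le_one h

lemma trunc_of_one_le {x : ℝ} (h : 1 ≤ x) : trunc x = 1 := Set.projIcc_of_right_le zero_le_one h

/-- The homotopy extension property of a neighbourhood deformation retract. -/
lemma exists_extension {ι : C(A, X)} (hι : Topology.IsEmbedding ι)
    (N : NeighborhoodDeformation (range ι)) (g : C(X, T)) (G : C(I × A, T))
    (h0 : ∀ a, G (0, a) = g (ι a)) :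
    ∃ H : C(I × X, T), (∀ x, H (0, x) = g x) ∧ ∀ t a, H (t, ι a) = G (t, a) := by
  let e : A ≃ₜ range ι := hι.toHomeomorph
  have he : ∀ x : range ι, ι (e.symm x) = x := fun x =>
    congrArg Subtype.val (e.apply_symm_apply x)
  let S₁ : Set (I × X) := {p | N.u p.2 ≤ (p.1 : ℝ)}
  let S₂ : Set (I × X) := {p | (p.1 : ℝ) ≤ N.u p.2}
  obtain ⟨H, H1, H2⟩ := exists_continuousMap_of_isClosed_cover (T := T) (S₁ := S₁) (S₂ := S₂)
    (isClosed_le (by fun_prop) (by fun_prop)) (isClosed_le (by fun_prop) (by fun_prop))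
    (fun p => le_total (N.u p.2) (p.1 : ℝ))
    ⟨fun p => G (trunc (p.1.1 - N.u p.1.2), e.symm ⟨N.D p.1, N.D_mem _ _ p.2⟩), by
      refine G.continuous.comp (Continuous.prodMk (by fun_prop) ?_)
      exact e.symm.continuous.comp (Continuous.subtype_mk (by fun_prop) _)⟩
    ⟨fun p => g (N.D p.1), by fun_prop⟩ (by
      rintro ⟨t, x⟩ h1 h2
      have ht : (t : ℝ) = N.u x := le_antisymm h2 h1
      simp only [ContinuousMap.coe_mk]
      rw [← ht, sub_self, trunc_zero, h0, he])
  refine ⟨H, fun x => ?_, fun t a => ?_⟩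
  · by_cases hx : (0 : ℝ) ≤ N.u x
    · rw [H2 (0, x) hx]
      simp [N.D_zero]
    · have hx' : N.u x ≤ ((0 : I) : ℝ) := (not_le.1 hx).le
      obtain ⟨a, ha⟩ := N.D_mem 0 x hx'
      rw [N.D_zero] at ha
      exact absurd (N.u_eq_zero x ⟨a, ha⟩).ge hx
  · have hu : N.u (ι a) = 0 := N.u_eq_zero _ ⟨a, rfl⟩
    rw [H1 (t, ι a) (by simpa [S₁, hu] using t.2.1)]
    simp only [ContinuousMap.coe_mk]
    congr 2
    · rw [hu, sub_zero, trunc_coe]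
    · rw [Homeomorph.symm_apply_eq]
      exact Subtype.ext (N.D_fix t _ ⟨a, rfl⟩)

/-- The homotopy stretching the middle third of the unit interval over the whole interval. -/
noncomputable def endPush : C(I × I, I) :=
  ⟨fun p => trunc (((p.2 : ℝ) - p.1 / 3) / (1 - 2 * p.1 / 3)), by
    refine trunc.continuous.comp (Continuous.div (by fun_prop) (by fun_prop) fun p => ?_)
    have := p.1.2.2
    intro h
    linarith⟩

lemma endPush_zero (s : I) : endPush (0, s) = s := by
  simp [endPush, trunc_coe]

lemma endPush_mem {t s : I} (h : min (3 * (s : ℝ)) (3 - 3 * s) ≤ t) :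
    endPush (t, s) = 0 ∨ endPush (t, s) = 1 := by
  have ht1 := t.2.2
  have hd : 0 < 1 - 2 * (t : ℝ) / 3 := by linarith
  rcases min_le_iff.1 h with h | h
  · left
    exact trunc_of_nonpos (div_nonpos_of_nonpos_of_nonneg (by linarith) hd.le)
  · right
    refine trunc_of_one_le ?_
    rw [le_div_iff₀ hd]
    linarith

lemma endPush_end (t : I) {s : I} (hs : s = 0 ∨ s = 1) : endPush (t, s) = s := by
  have ht0 := t.2.1
  have ht1 := t.2.2
  have hd : 0 < 1 - 2 * (t : ℝ) / 3 := by linarith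
  rcases hs with rfl | rfl
  · exact trunc_of_nonpos (div_nonpos_of_nonpos_of_nonneg (by simp; linarith) hd.le)
  · refine trunc_of_one_le ?_
    rw [le_div_iff₀ hd]
    simp only [Icc.coe_one]
    linarith

/-- If the restriction to `A` of a homotopy `F` on `X` is deformed, relative to its ends, then the
whole homotopy can be changed, without changing its ends, to one with the deformed restriction.
This is the homotopy extension property of `(I × X, {0, 1} × X ∪ I × A)`, for the product of the
neighbourhood deformations of `A` in `X` and of the ends in `I`. -/
lemma exists_homotopy_of_restrict {ι : C(A, X)} (hι : Topology.IsEmbedding ι)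
    (N : NeighborhoodDeformation (range ι)) (F : C(I × X, T)) (Q : C(I × I × A, T))
    (hQ : ∀ s a, Q (0, s, a) = F (s, ι a))
    (hQ0 : ∀ τ a, Q (τ, 0, a) = F (0, ι a)) (hQ1 : ∀ τ a, Q (τ, 1, a) = F (1, ι a)) :
    ∃ F' : C(I × X, T), (∀ x, F' (0, x) = F (0, x)) ∧ (∀ x, F' (1, x) = F (1, x)) ∧
      ∀ s a, F' (s, ι a) = Q (1, s, a) := by
  let e : A ≃ₜ range ι := hι.toHomeomorph
  have he : ∀ x : range ι, ι (e.symm x) = x := fun x =>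
    congrArg Subtype.val (e.apply_symm_apply x)
  -- the time needed to push `s` to an end, capped at `1`
  let v : C(I, ℝ) := ⟨fun s => min 1 (min (3 * (s : ℝ)) (3 - 3 * s)), by fun_prop⟩
  have hv0 : ∀ s, 0 ≤ v s := fun s =>
    le_min zero_le_one (le_min (by linarith [s.2.1]) (by linarith [s.2.2]))
  have hv1 : ∀ s, v s ≤ 1 := fun s => min_le_left _ _
  have hvt : ∀ s, (trunc (v s) : ℝ) = v s := fun s =>
    congrArg Subtype.val (trunc_coe ⟨v s, hv0 s, hv1 s⟩)
  have hend : ∀ s (y : ℝ), v s ≤ y → y < 1 →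
      endPush (trunc y, s) = 0 ∨ endPush (trunc y, s) = 1 := by
    intro s y h1 h2
    have h3 : (trunc y : ℝ) = y := congrArg Subtype.val (trunc_coe ⟨y, (hv0 s).trans h1, h2.le⟩)
    refine endPush_mem ?_
    rw [h3]
    rcases min_le_iff.1 h1 with h | h
    · exact absurd h (not_le.2 h2)
    · exact h
  have hvend : ∀ s, s = 0 ∨ s = 1 → v s = 0 := by
    rintro s (rfl | rfl) <;> simp [v]
  have hu0 : ∀ x, 0 ≤ N.u x := by
    intro x
    by_contra! hx
    have hm := N.D_mem 0 x (by simpa using hx.le)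
    rw [N.D_zero] at hm
    exact hx.ne (N.u_eq_zero x hm)
  let S₁ : Set (I × X) := {p | N.u p.2 ≤ v p.1}
  let S₂ : Set (I × X) := {p | v p.1 ≤ N.u p.2}
  obtain ⟨H, H1, H2⟩ := exists_continuousMap_of_isClosed_cover (T := T) (S₁ := S₁) (S₂ := S₂)
    (isClosed_le (by fun_prop) (by fun_prop)) (isClosed_le (by fun_prop) (by fun_prop))
    (fun p => le_total (N.u p.2) (v p.1))
    ⟨fun p => Q (trunc (1 - N.u p.1.2), endPush (trunc (N.u p.1.2), p.1.1),
        e.symm ⟨N.D (trunc (v p.1.1), p.1.2), N.D_mem _ _ (by rw [hvt]; exact p.2)⟩), by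
      refine Q.continuous.comp (Continuous.prodMk (by fun_prop) (Continuous.prodMk (by fun_prop) ?_))
      exact e.symm.continuous.comp (Continuous.subtype_mk (by fun_prop) _)⟩
    ⟨fun p => F (endPush (trunc (N.u p.1.2), p.1.1), N.D (trunc (v p.1.1), p.1.2)),
      by fun_prop⟩ (by
      rintro ⟨s, x⟩ h1 h2
      have hsx : v s = N.u x := le_antisymm h2 h1
      simp only [ContinuousMap.coe_mk]
      rcases lt_or_eq_of_le (hv1 s) with hlt | heq
      · rcases hend s (N.u x) hsx.le (hsx ▸ hlt) with h | h
        · rw [h, hQ0, he]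
        · rw [h, hQ1, he]
      · have h0 : trunc (1 - N.u x) = 0 := by rw [← hsx, heq, sub_self, trunc_zero]
        rw [h0, hQ, he])
  have hends : ∀ s x, s = 0 ∨ s = 1 → H (s, x) = F (s, x) := by
    intro s x hs
    rw [H2 (s, x) (by simp only [S₂, mem_ofPred_eq]; rw [hvend s hs]; exact hu0 x)]
    simp only [ContinuousMap.coe_mk]
    rw [endPush_end _ hs, hvend s hs, trunc_zero, N.D_zero]
  refine ⟨H, fun x => hends 0 x (Or.inl rfl), fun x => hends 1 x (Or.inr rfl), fun s a => ?_⟩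
  have hu : N.u (ι a) = 0 := N.u_eq_zero _ ⟨a, rfl⟩
  rw [H1 (s, ι a) (by simp only [S₁, mem_ofPred_eq]; rw [hu]; exact hv0 s)]
  simp only [ContinuousMap.coe_mk]
  congr 2
  · rw [hu, sub_zero, trunc_one]
  · congr 1
    · rw [hu, trunc_zero, endPush_zero]
    · rw [Homeomorph.symm_apply_eq]
      exact Subtype.ext (N.D_fix _ _ ⟨a, rfl⟩)

end NeighborhoodDeformation

/-! ### Homotopy equivalences -/

/-- Precomposition with a homotopy equivalence is a homotopy equivalence of mapping spaces. -/
def precompHomotopyEquiv {Y Z : Type*} (T : Type*) [TopologicalSpace Y] [TopologicalSpace Z]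
    [TopologicalSpace T] [LocallyCompactSpace Y] [LocallyCompactSpace Z]
    (e : ContinuousMap.HomotopyEquiv Z Y) :
    ContinuousMap.HomotopyEquiv C(Y, T) C(Z, T) where
  toFun := ⟨fun f => f.comp e.toFun, ContinuousMap.continuous_precomp _⟩
  invFun := ⟨fun f => f.comp e.invFun, ContinuousMap.continuous_precomp _⟩
  left_inv := by
    obtain ⟨H⟩ := e.right_inv
    refine ⟨⟨⟨fun p => p.2.comp (H.curry p.1), ?_⟩, fun f => ?_, fun f => ?_⟩⟩
    · exact Continuous.compCM continuous_snd (H.curry.continuous.comp continuous_fst)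
    · ext x
      exact congrArg f (H.apply_zero x)
    · ext x
      exact congrArg f (H.apply_one x)
  right_inv := by
    obtain ⟨H⟩ := e.left_inv
    refine ⟨⟨⟨fun p => p.2.comp (H.curry p.1), ?_⟩, fun f => ?_, fun f => ?_⟩⟩
    · exact Continuous.compCM continuous_snd (H.curry.continuous.comp continuous_fst)
    · ext x
      exact congrArg f (H.apply_zero x)
    · ext x
      exact congrArg f (H.apply_one x)

/-- A homotopy equivalence `h : Z → Y` lifts homotopies: a homotopy between `c₀ ∘ h` and `c₁ ∘ h`
can be deformed, relative to its ends, to one which is induced by a homotopy between `c₀` and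
`c₁`. Indeed the fundamental groupoids of the mapping spaces `C(Y, T)` and `C(Z, T)` are
equivalent. -/
lemma IsHomotopyEquivalence.exists_homotopy_lift {Y Z T : Type*} [TopologicalSpace Y]
    [TopologicalSpace Z] [TopologicalSpace T] [LocallyCompactSpace Y] [LocallyCompactSpace Z]
    {h : C(Z, Y)} (hh : IsHomotopyEquivalence h) (c₀ c₁ : C(Y, T)) (F : C(I × Z, T))
    (hF0 : ∀ z, F (0, z) = c₀ (h z)) (hF1 : ∀ z, F (1, z) = c₁ (h z)) :
    ∃ (G : C(I × Y, T)) (Q : C(I × I × Z, T)), (∀ y, G (0, y) = c₀ y) ∧ (∀ y, G (1, y) = c₁ y) ∧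
      (∀ s z, Q (0, s, z) = F (s, z)) ∧ (∀ s z, Q (1, s, z) = G (s, h z)) ∧
      (∀ τ z, Q (τ, 0, z) = F (0, z)) ∧ ∀ τ z, Q (τ, 1, z) = F (1, z) := by
  obtain ⟨e, rfl⟩ := hh
  let r : C(C(Y, T), C(Z, T)) := (precompHomotopyEquiv T e).toFun
  have hfull : (FundamentalGroupoid.map r).Full :=
    (FundamentalGroupoidFunctor.equivOfHomotopyEquiv (precompHomotopyEquiv T e)).full_functor
  let P : Path (r c₀) (r c₁) :=
    { toFun := F.curry
      continuous_toFun := F.curry.continuous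
      source' := by ext z; exact hF0 z
      target' := by ext z; exact hF1 z }
  let q : (FundamentalGroupoid.map r).obj ⟨c₀⟩ ⟶ (FundamentalGroupoid.map r).obj ⟨c₁⟩ :=
    Path.Homotopic.Quotient.mk P
  obtain ⟨g, hg⟩ := (FundamentalGroupoid.map r).map_surjective q
  obtain ⟨p, rfl⟩ := Path.Homotopic.Quotient.mk_surjective g
  have hp : Path.Homotopic.Quotient.mk (p.map r.continuous) = Path.Homotopic.Quotient.mk P := hg
  obtain ⟨K⟩ := Path.Homotopic.Quotient.exact hp.symm
  refine ⟨(p : C(I, C(Y, T))).uncurry,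
    ((K : C(I × I, C(Z, T))).uncurry).comp ((Homeomorph.prodAssoc I I Z).symm : C(_, _)),
    fun y => ?_, fun y => ?_, fun s z => ?_, fun s z => ?_, fun τ z => ?_, fun τ z => ?_⟩
  · exact DFunLike.congr_fun p.source y
  · exact DFunLike.congr_fun p.target y
  · exact DFunLike.congr_fun (K.apply_zero s) z
  · exact DFunLike.congr_fun (K.apply_one s) z
  · exact (DFunLike.congr_fun (K.source τ) z).trans (hF0 z).symm
  · exact (DFunLike.congr_fun (K.target τ) z).trans (hF1 z).symm

/-- A neighbourhood deformation retract whose inclusion is a homotopy equivalence is a strong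
deformation retract. -/
lemma NeighborhoodDeformation.exists_strong_deformation {A X : Type*} [TopologicalSpace A]
    [TopologicalSpace X] [LocallyCompactSpace A] [LocallyCompactSpace X] {ι : C(A, X)}
    (hι : Topology.IsEmbedding ι) (N : NeighborhoodDeformation (range ι))
    (he : IsHomotopyEquivalence ι) :
    ∃ H : C(I × X, X), (∀ x, H (0, x) = x) ∧ (∀ x, H (1, x) ∈ range ι) ∧
      ∀ t, ∀ x ∈ range ι, H (t, x) = x := by
  have hlift := he.exists_homotopy_lift (T := X)
  obtain ⟨e, rfl⟩ := he
  obtain ⟨L⟩ := e.left_inv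
  -- a homotopy inverse of `ι` is homotopic to a retraction `r`
  obtain ⟨R, -, hR⟩ := N.exists_extension hι e.invFun L.toContinuousMap (fun a => L.apply_zero a)
  have hR1 : ∀ a, R (1, e.toFun a) = a := fun a => (hR 1 a).trans (L.apply_one a)
  let r : C(X, A) := R.comp ⟨fun x => (1, x), by fun_prop⟩
  -- the constant homotopy of `ι` comes from a homotopy `G` between the identity and `ι ∘ r`, up to
  -- the deformation `Q`, which is then used to make `G` constant on `A`
  obtain ⟨G, Q, hG0, hG1, hQ0, hQ1, hQs, hQe⟩ := hlift (.id X) (e.toFun.comp r)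
    (e.toFun.comp ContinuousMap.snd) (fun a => rfl) (fun a => congrArg e.toFun (hR1 a).symm)
  obtain ⟨H, hH0, hH1, hH⟩ := N.exists_homotopy_of_restrict hι G
    (Q.comp ⟨fun p => (σ p.1, p.2), by fun_prop⟩)
    (fun s a => by simpa using hQ1 s a)
    (fun τ a => by simpa [hG0] using hQs (σ τ) a)
    (fun τ a => by
      have := hQe (σ τ) a
      simp only [ContinuousMap.comp_apply, ContinuousMap.coe_mk, hG1] at this ⊢
      rw [this]
      exact congrArg e.toFun (hR1 a).symm)
  refine ⟨H, fun x => (hH0 x).trans (hG0 x), fun x => ?_, ?_⟩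
  · rw [hH1, hG1]
    exact ⟨_, rfl⟩
  · rintro t _ ⟨a, rfl⟩
    rw [hH]
    simpa using hQ0 t a

/-- The gluing lemma: the pushout `h' : Z' → Y'` of a homotopy equivalence `h : Z → Y` along a
neighbourhood deformation retract `ι : Z → Z'` is a homotopy equivalence. -/
lemma NeighborhoodDeformation.isHomotopyEquivalence_pushout {Z Z' Y Y' : Type u}
    [TopologicalSpace Z] [TopologicalSpace Z'] [TopologicalSpace Y] [TopologicalSpace Y']
    [LocallyCompactSpace Z] [LocallyCompactSpace Y] {ι : C(Z, Z')}
    (hι : Topology.IsEmbedding ι) (N : NeighborhoodDeformation (range ι)) {h : C(Z, Y)}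
    (he : IsHomotopyEquivalence h) {j : C(Y, Y')} {h' : C(Z', Y')} (hcomm : h'.comp ι = j.comp h)
    (hdesc : ∀ (T : Type u) [TopologicalSpace T] (a : C(Y, T)) (b : C(Z', T)),
      a.comp h = b.comp ι → ∃ c : C(Y', T), c.comp j = a ∧ c.comp h' = b)
    (hsurj : ∀ y' : Y', (∃ y, j y = y') ∨ ∃ z', h' z' = y') : IsHomotopyEquivalence h' := by
  have hlift := he.exists_homotopy_lift (T := Y')
  obtain ⟨e, rfl⟩ := he
  obtain ⟨α⟩ := e.left_inv
  have hcomm' : ∀ z, h' (ι z) = j (e.toFun z) := fun z => DFunLike.congr_fun hcomm z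
  -- the homotopy inverse extends that of `h`, by a homotopy extension `B` of the identity of `Z'`
  obtain ⟨B, hB0, hB⟩ := N.exists_extension hι (.id Z')
    (ι.comp (α.toContinuousMap.comp ⟨fun p => (σ p.1, p.2), by fun_prop⟩))
    (fun z => by simp)
  have hB1 : ∀ z, B (1, ι z) = ι (e.invFun (e.toFun z)) := fun z => by
    rw [hB]
    simp
  obtain ⟨l, hlj, hlh⟩ := hdesc Z' (ι.comp e.invFun) (B.comp ⟨fun z => (1, z), by fun_prop⟩)
    (by ext z; exact (hB1 z).symm)
  replace hlj : ∀ y, l (j y) = ι (e.invFun y) := fun y => DFunLike.congr_fun hlj y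
  replace hlh : ∀ z, l (h' z) = B (1, z) := fun z => DFunLike.congr_fun hlh z
  -- `h' ∘ B` is a homotopy from `h'` to `h' ∘ l ∘ h'`, and its restriction to `Z` is deformed to
  -- one which comes from `Y`
  obtain ⟨G, Q, hG0, hG1, hQ0, hQ1, hQs, hQe⟩ := hlift j ((h'.comp l).comp j)
    ((h'.comp B).comp ⟨fun p => (p.1, ι p.2), by fun_prop⟩)
    (fun z => by simp [hB0, hcomm'])
    (fun z => by simp [hB1, hlj])
  obtain ⟨F, hF0, hF1, hF⟩ := N.exists_homotopy_of_restrict hι (h'.comp B) Q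
    (fun s z => hQ0 s z) (fun τ z => hQs τ z) (fun τ z => hQe τ z)
  let sw : ∀ W : Type u, [TopologicalSpace W] → C(W × I, I × W) := fun W _ =>
    ⟨fun p => (p.2, p.1), by fun_prop⟩
  obtain ⟨c, hcj, hch⟩ := hdesc C(I, Y') (G.comp (sw Y)).curry (F.comp (sw Z')).curry (by
    ext z s
    exact ((hF s z).trans (hQ1 s z)).symm)
  replace hcj : ∀ y s, c (j y) s = G (s, y) := fun y s =>
    DFunLike.congr_fun (DFunLike.congr_fun hcj y) s
  replace hch : ∀ z s, c (h' z) s = F (s, z) := fun z s =>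
    DFunLike.congr_fun (DFunLike.congr_fun hch z) s
  refine ⟨⟨h', l, ⟨?_⟩, ⟨?_⟩⟩, rfl⟩
  · refine ContinuousMap.Homotopy.symm ⟨B, fun z => hB0 z, fun z => ?_⟩
    exact (hlh z).symm
  · refine ContinuousMap.Homotopy.symm ⟨c.uncurry.comp ⟨fun p => (p.2, p.1), by fun_prop⟩,
      fun y' => ?_, fun y' => ?_⟩
    · rcases hsurj y' with ⟨y, rfl⟩ | ⟨z, rfl⟩
      · exact (hcj y 0).trans (hG0 y)
      · exact (hch z 0).trans ((hF0 z).trans (congrArg h' (hB0 z)))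
    · rcases hsurj y' with ⟨y, rfl⟩ | ⟨z, rfl⟩
      · exact (hcj y 1).trans (hG1 y)
      · exact (hch z 1).trans ((hF1 z).trans (congrArg h' (hlh z).symm))

/-! ### Realizations of finite simplicial complexes -/

section Realization

variable {X : Type u} [Fintype X]

omit [Fintype X] in
lemma nonempty_of_mem {K : PreAbstractSimplicialComplex X} {s : Finset X} (hs : s ∈ K) :
    s.Nonempty := (K.isRelLowerSet_faces hs).1

omit [Fintype X] in
lemma mem_of_subset {K : PreAbstractSimplicialComplex X} {s t : Finset X} (hs : s ∈ K)
    (hts : t ⊆ s) (ht : t.Nonempty) : t ∈ K := (K.isRelLowerSet_faces hs).2 hts ht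

open Classical in
/-- The set of vertices at which a barycentric coordinate does not vanish. -/
noncomputable def supp (p : X → ℝ) : Finset X := {v | p v ≠ 0}

@[simp]
lemma mem_supp {p : X → ℝ} {v : X} : v ∈ supp p ↔ p v ≠ 0 := by simp [supp]

lemma supp_nonempty {p : X → ℝ} (hp : p ∈ stdSimplex ℝ X) : (supp p).Nonempty := by
  by_contra! h
  have h0 : ∀ v, p v = 0 := fun v => by
    by_contra hv
    have := mem_supp.2 hv
    simp [h] at this
  have := hp.2
  simp [h0] at this

lemma mem_realization {K : PreAbstractSimplicialComplex X} {p : X → ℝ} :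
    p ∈ realization K ↔ p ∈ stdSimplex ℝ X ∧ supp p ∈ K := by
  refine ⟨fun ⟨hp, s, hs, h⟩ => ⟨hp, ?_⟩, fun ⟨hp, h⟩ => ⟨hp, _, h, fun v hv => mem_supp.2 hv⟩⟩
  exact mem_of_subset hs (fun v hv => h v (mem_supp.1 hv)) (supp_nonempty hp)

/-- The closed face of the standard simplex spanned by `s`. -/
def face (s : Finset X) : Set (X → ℝ) := {p | p ∈ stdSimplex ℝ X ∧ ∀ v ∉ s, p v = 0}

lemma mem_face_iff {s : Finset X} {p : X → ℝ} : p ∈ face s ↔ p ∈ stdSimplex ℝ X ∧ supp p ⊆ s := by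
  refine and_congr_right fun _ => ⟨fun h v hv => ?_, fun h v hv => ?_⟩
  · by_contra hs
    exact mem_supp.1 hv (h v hs)
  · by_contra h0
    exact hv (h (mem_supp.2 h0))

lemma mem_realization_iff_face {K : PreAbstractSimplicialComplex X} {p : X → ℝ} :
    p ∈ realization K ↔ ∃ s ∈ K, p ∈ face s := by
  refine ⟨fun h => ?_, fun ⟨s, hs, hp⟩ => ?_⟩
  · obtain ⟨hp, hs⟩ := mem_realization.1 h
    exact ⟨_, hs, mem_face_iff.2 ⟨hp, subset_rfl⟩⟩
  · obtain ⟨hp, h⟩ := mem_face_iff.1 hp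
    exact mem_realization.2 ⟨hp, mem_of_subset hs h (supp_nonempty hp)⟩

lemma isCompact_face (s : Finset X) : IsCompact (face s) := by
  have : face s = stdSimplex ℝ X ∩ ⋂ v ∈ (sᶜ : Set X), {p | p v = 0} := by
    ext p
    simp [face]
  rw [this]
  refine (isCompact_stdSimplex ℝ X).inter_right ?_
  exact isClosed_biInter fun v _ => isClosed_eq (continuous_apply v) continuous_const

lemma isCompact_realization (K : PreAbstractSimplicialComplex X) : IsCompact (realization K) := by
  have : realization K = ⋃ s ∈ K.faces, face s := by
    ext p
    simp only [mem_realization_iff_face, mem_iUnion, exists_prop]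
    rfl
  rw [this]
  exact (Set.toFinite K.faces).isCompact_biUnion fun s _ => isCompact_face s

instance (K : PreAbstractSimplicialComplex X) : CompactSpace (realization K) :=
  isCompact_iff_compactSpace.1 (isCompact_realization K)

lemma isEmbedding_realizationIncl {K L : PreAbstractSimplicialComplex X} (h : K ≤ L) :
    Topology.IsEmbedding (realizationIncl h) :=
  Topology.IsEmbedding.inclusion (realization_mono h)

lemma mem_range_realizationIncl {K L : PreAbstractSimplicialComplex X} (h : K ≤ L)
    (p : realization L) : p ∈ range (realizationIncl h) ↔ (p : X → ℝ) ∈ realization K := by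
  refine ⟨?_, fun hp => ⟨⟨p, hp⟩, rfl⟩⟩
  rintro ⟨q, rfl⟩
  exact q.2

/-- Subtract `θ` from all barycentric coordinates, truncate at `0` and normalise. -/
noncomputable def shrink (θ : ℝ) (p : X → ℝ) : X → ℝ :=
  fun v => max (p v - θ) 0 / ∑ w, max (p w - θ) 0

lemma one_half_le_sum_shrink {θ : ℝ} {p : X → ℝ} (hp : p ∈ stdSimplex ℝ X)
    (hθ : θ * Fintype.card X ≤ 1 / 2) : 1 / 2 ≤ ∑ w, max (p w - θ) 0 := by
  have h1 : ∑ w, (p w - θ) ≤ ∑ w, max (p w - θ) 0 :=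
    Finset.sum_le_sum fun w _ => le_max_left _ _
  rw [Finset.sum_sub_distrib, hp.2, Finset.sum_const, Finset.card_univ, nsmul_eq_mul] at h1
  linarith [mul_comm θ (Fintype.card X : ℝ)]

lemma shrink_mem_stdSimplex {θ : ℝ} {p : X → ℝ} (hp : p ∈ stdSimplex ℝ X)
    (hθ : θ * Fintype.card X ≤ 1 / 2) : shrink θ p ∈ stdSimplex ℝ X := by
  have h := one_half_le_sum_shrink hp hθ
  refine ⟨fun v => div_nonneg (le_max_right _ _) (by linarith), ?_⟩
  simp only [shrink]
  rw [← Finset.sum_div]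
  exact div_self (by linarith)

lemma shrink_eq_zero {θ : ℝ} {p : X → ℝ} {v : X} (h : p v ≤ θ) : shrink θ p v = 0 := by
  simp [shrink, max_eq_right (sub_nonpos.2 h)]

lemma shrink_zero {p : X → ℝ} (hp : p ∈ stdSimplex ℝ X) : shrink 0 p = p := by
  ext v
  have : ∀ w, max (p w - 0) 0 = p w := fun w => by
    rw [sub_zero]
    exact max_eq_left (hp.1 w)
  simp only [shrink, this, hp.2, div_one]

/-- A subcomplex `L` of a finite simplicial complex `K` is a neighbourhood deformation retract: a
point `p` near to a face `s` of `L` has small coordinates outside of `s`, and subtracting a small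
amount from all coordinates moves `p` into `s`. -/
lemma nonempty_neighborhoodDeformation {K L : PreAbstractSimplicialComplex X} (h : L ≤ K) :
    Nonempty (NeighborhoodDeformation (range (realizationIncl h))) := by
  classical
  by_cases hL : L.faces.Nonempty
  · set F : Finset (Finset X) := (Set.toFinite L.faces).toFinset with hFdef
    have hF : F.Nonempty := by simpa [hFdef] using hL
    have hmemF : ∀ s, s ∈ F ↔ s ∈ L := fun s => by
      rw [hFdef, Set.Finite.mem_toFinset]
      rfl
    -- the distance from `L`
    let μ : (X → ℝ) → ℝ := fun p => F.inf' hF fun s => ∑ v ∈ sᶜ, p v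
    have hμc : Continuous μ := Continuous.finset_inf'_apply hF fun s _ => by fun_prop
    have hμ0 : ∀ p ∈ stdSimplex ℝ X, 0 ≤ μ p := fun p hp =>
      (Finset.le_inf'_iff _ _).2 fun s _ => Finset.sum_nonneg fun v _ => hp.1 v
    have hμL : ∀ p ∈ realization L, μ p = 0 := fun p hp => by
      refine le_antisymm ?_ (hμ0 p hp.1)
      obtain ⟨s, hs, hps⟩ := mem_realization_iff_face.1 hp
      refine (Finset.inf'_le _ ((hmemF s).2 hs)).trans ?_
      exact (Finset.sum_eq_zero fun v hv => hps.2 v (Finset.mem_compl.1 hv)).le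
    set c : ℝ := 1 / (2 * (Fintype.card X + 1)) with hc
    have hc0 : 0 < c := by positivity
    let θ : I × (X → ℝ) → ℝ := fun q => min (μ q.2) (q.1 * c)
    have hθc : Continuous θ := by fun_prop
    have hθ : ∀ q, θ q * Fintype.card X ≤ 1 / 2 := fun q => by
      have h1 : θ q ≤ c := (min_le_right _ _).trans (mul_le_of_le_one_left hc0.le q.1.2.2)
      refine (mul_le_mul_of_nonneg_right h1 (Nat.cast_nonneg _)).trans ?_
      rw [hc, one_div_mul_eq_div, div_le_div_iff₀ (by positivity) (by positivity)]
      linarith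
    have hθ0 : ∀ q : I × (X → ℝ), q.2 ∈ stdSimplex ℝ X → 0 ≤ θ q := fun q hq =>
      le_min (hμ0 _ hq) (mul_nonneg q.1.2.1 hc0.le)
    have hDK : ∀ q : I × realization K, shrink (θ (q.1, q.2.1)) q.2.1 ∈ realization K := by
      rintro ⟨t, p, hp⟩
      obtain ⟨s, hs, hps⟩ := mem_realization_iff_face.1 hp
      refine mem_realization_iff_face.2 ⟨s, hs, shrink_mem_stdSimplex hp.1 (hθ _), fun v hv => ?_⟩
      refine shrink_eq_zero (le_of_eq_of_le (hps.2 v hv) ?_)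
      exact hθ0 (t, p) hp.1
    refine ⟨⟨⟨fun p => μ p.1 / c, by fun_prop⟩,
      ⟨fun q => ⟨shrink (θ (q.1, q.2.1)) q.2.1, hDK q⟩, ?_⟩, ?_, ?_, ?_, ?_⟩⟩
    · refine Continuous.subtype_mk (continuous_pi fun v => ?_) _
      have hθq : Continuous fun q : I × realization K => θ (q.1, q.2.1) :=
        hθc.comp (by fun_prop)
      have hpv : ∀ v, Continuous fun q : I × realization K => q.2.1 v := fun v =>
        (continuous_apply v).comp (continuous_subtype_val.comp continuous_snd)
      refine Continuous.div ?_ ?_ fun q => ?_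
      · exact ((hpv _).sub hθq).max continuous_const
      · exact continuous_finsetSum _ fun w _ =>
          ((hpv _).sub hθq).max continuous_const
      have := one_half_le_sum_shrink q.2.2.1 (hθ (q.1, q.2.1))
      linarith
    · intro p hp
      simp [hμL p ((mem_range_realizationIncl h p).1 hp)]
    · rintro ⟨p, hp⟩
      refine Subtype.ext ?_
      have : θ (0, p) = 0 := by simpa [θ] using hμ0 p hp.1
      simp only [ContinuousMap.coe_mk, this]
      exact shrink_zero hp.1
    · rintro t ⟨p, hp⟩ hpL
      refine Subtype.ext ?_
      have hp0 : μ p = 0 := hμL p ((mem_range_realizationIncl h _).1 hpL)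
      have : θ (t, p) = 0 := by simpa [θ, hp0] using mul_nonneg t.2.1 hc0.le
      simp only [ContinuousMap.coe_mk, this]
      exact shrink_zero hp.1
    · rintro t ⟨p, hp⟩ hut
      rw [mem_range_realizationIncl]
      have hut' : μ p ≤ t * c := (div_le_iff₀ hc0).1 hut
      obtain ⟨s, hs, hs'⟩ := Finset.exists_mem_eq_inf' hF fun s => ∑ v ∈ sᶜ, p v
      refine mem_realization_iff_face.2 ⟨s, (hmemF s).1 hs,
        shrink_mem_stdSimplex hp.1 (hθ _), fun v hv => shrink_eq_zero ?_⟩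
      have hθμ : θ (t, p) = μ p := min_eq_left hut'
      rw [hθμ, show μ p = _ from hs']
      exact Finset.single_le_sum (f := fun v => p v) (fun v _ => hp.1.1 v)
        (Finset.mem_compl.2 hv)
  · have hemp : range (realizationIncl h) = ∅ := by
      ext p
      rw [mem_range_realizationIncl, mem_realization]
      simp only [mem_empty_iff_false, iff_false, not_and]
      exact fun _ hs => hL ⟨_, hs⟩
    rw [hemp]
    exact ⟨⟨.const _ 2, .snd, by simp, fun _ => rfl, by simp, fun t x h => by
      have := t.2.2
      simp only [ContinuousMap.const_apply] at h
      linarith⟩⟩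

end Realization

/-! ### Strong deformation retracts -/

section StrongDeformationRetract

variable {E : Type*} [TopologicalSpace E]

lemma IsStrongDeformationRetract.refl (S : Set E) : IsStrongDeformationRetract S S :=
  ⟨subset_rfl, .snd, fun _ => rfl, fun p => p.2, fun _ _ _ => rfl⟩

lemma IsStrongDeformationRetract.trans {S T U : Set E} (h₁ : IsStrongDeformationRetract S T)
    (h₂ : IsStrongDeformationRetract T U) : IsStrongDeformationRetract S U := by
  obtain ⟨hST, H, H0, H1, Hf⟩ := h₁
  obtain ⟨hTU, G, G0, G1, Gf⟩ := h₂
  let r : C(U, T) := ⟨fun p => ⟨G (1, p), G1 p⟩, by fun_prop⟩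
  let G' : ContinuousMap.Homotopy (.id U) (⟨fun p => G (1, p), by fun_prop⟩) :=
    ⟨G, fun p => G0 p, fun p => rfl⟩
  let i : C(T, U) := ⟨inclusion hTU, continuous_inclusion hTU⟩
  let H' : ContinuousMap.Homotopy (⟨fun p => G (1, p), by fun_prop⟩ : C(U, U))
      ⟨fun p => i (H (1, r p)), by fun_prop⟩ :=
    ⟨⟨fun q => i (H (q.1, r q.2)), by fun_prop⟩, fun p => by
      simp only [ContinuousMap.coe_mk, H0]
      rfl, fun p => rfl⟩
  refine ⟨hST.trans hTU, (G'.trans H').toContinuousMap, fun p => (G'.trans H').apply_zero p,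
    fun p => ?_, fun τ p hp => ?_⟩
  · have := (G'.trans H').apply_one p
    erw [this]
    exact H1 _
  · have hG : ∀ τ, G (τ, p) = p := fun τ => Gf τ p (hST hp)
    have hH : ∀ τ, i (H (τ, r p)) = p := fun τ => by
      have hr : r p = ⟨p, hST hp⟩ := Subtype.ext (congrArg Subtype.val (hG 1) :)
      rw [hr, Hf τ ⟨p, hST hp⟩ hp]
      rfl
    have := ContinuousMap.Homotopy.trans_apply G' H' (τ, p)
    erw [this]
    split_ifs
    · exact hG _
    · exact hH _

/-- A strong deformation retraction of `T` onto `U ∩ T` extends by the identity to one of `U ∪ T`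
onto `U`. -/
lemma IsStrongDeformationRetract.union {S T U : Set E} (h : IsStrongDeformationRetract S T)
    (hU : IsClosed U) (hT : IsClosed T) (hS : S = U ∩ T) :
    IsStrongDeformationRetract U (U ∪ T) := by
  obtain ⟨hST, H, H0, H1, Hf⟩ := h
  let S₁ : Set (I × (U ∪ T : Set E)) := {p | (p.2 : E) ∈ U}
  let S₂ : Set (I × (U ∪ T : Set E)) := {p | (p.2 : E) ∈ T}
  obtain ⟨G, G1, G2⟩ := exists_continuousMap_of_isClosed_cover (S₁ := S₁) (S₂ := S₂)
    (hU.preimage (by fun_prop)) (hT.preimage (by fun_prop)) (fun p => p.2.2)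
    ⟨fun p => p.1.2, by fun_prop⟩
    ⟨fun p => inclusion (subset_union_right (s := U)) (H (p.1.1, ⟨p.1.2, p.2⟩)), by
      refine (continuous_inclusion subset_union_right).comp (H.continuous.comp ?_)
      exact Continuous.prodMk (by fun_prop) (Continuous.subtype_mk (by fun_prop) _)⟩ (by
      rintro ⟨t, p⟩ h1 h2
      have := Hf t ⟨p, h2⟩ (by rw [hS]; exact ⟨h1, h2⟩)
      simp only [ContinuousMap.coe_mk, this])
  refine ⟨subset_union_left, G, fun p => ?_, fun p => ?_, fun τ p hp => G1 (τ, p) hp⟩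
  · rcases p.2 with hp | hp
    · exact G1 (0, p) hp
    · rw [G2 (0, p) hp]
      simp only [ContinuousMap.coe_mk, H0]
  · by_cases hp : (p : E) ∈ U
    · rw [G1 (1, p) hp]
      exact hp
    · have hp' : (p : E) ∈ T := p.2.resolve_left hp
      rw [G2 (1, p) hp']
      exact (hS.subset (H1 ⟨p, hp'⟩)).1

/-- The retraction onto a strong deformation retract is a homotopy inverse of the inclusion. -/
lemma IsStrongDeformationRetract.exists_retraction {S T : Set E}
    (h : IsStrongDeformationRetract S T) (i : C(S, T)) (hi : ∀ p, (i p : E) = p) :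
    ∃ r : C(T, S), (∀ p, r (i p) = p) ∧ (i.comp r).Homotopic (.id T) := by
  obtain ⟨hST, H, H0, H1, Hf⟩ := h
  have hi' : ∀ p, H (1, i p) = i p := fun p => Hf 1 (i p) (by rw [hi]; exact p.2)
  refine ⟨⟨fun p => ⟨H (1, p), H1 p⟩, by fun_prop⟩, fun p => Subtype.ext ?_, ?_⟩
  · simp only [ContinuousMap.coe_mk, hi']
    exact hi p
  · refine ContinuousMap.Homotopic.symm ⟨⟨H, fun p => H0 p, fun p => Subtype.ext ?_⟩⟩
    rw [ContinuousMap.comp_apply, hi]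
    rfl

end StrongDeformationRetract

section Contractible

variable {X : Type u} [Fintype X]

/-- A subcomplex whose inclusion is a homotopy equivalence is a strong deformation retract. -/
lemma isStrongDeformationRetract_realization {K L : PreAbstractSimplicialComplex X} (h : L ≤ K)
    (he : IsHomotopyEquivalence (realizationIncl h)) :
    IsStrongDeformationRetract (realization L) (realization K) := by
  obtain ⟨N⟩ := nonempty_neighborhoodDeformation h
  obtain ⟨H, H0, H1, Hf⟩ := N.exists_strong_deformation (isEmbedding_realizationIncl h) he
  exact ⟨realization_mono h, H, H0, fun p => (mem_range_realizationIncl h _).1 (H1 p),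
    fun τ p hp => Hf τ p ((mem_range_realizationIncl h p).2 hp)⟩

lemma homotopic_of_contractible {W : Type*} [TopologicalSpace W] [ContractibleSpace W]
    (a b : C(W, W)) : a.Homotopic b := by
  obtain ⟨w, hw⟩ := id_nullhomotopic W
  have key : ∀ a : C(W, W), a.Homotopic (.const W (a w)) := fun a =>
    ContinuousMap.Homotopic.comp (ContinuousMap.Homotopic.refl a) hw
  refine (key a).trans (ContinuousMap.Homotopic.trans ?_ (key b).symm)
  have : Nonempty W := ⟨w⟩
  exact ContinuousMap.homotopic_const_iff.2 (PathConnectedSpace.joined _ _)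

lemma isHomotopyEquivalence_of_contractible {Y Z : Type*} [TopologicalSpace Y]
    [TopologicalSpace Z] [ContractibleSpace Y] [ContractibleSpace Z] (g : C(Y, Z)) :
    IsHomotopyEquivalence g := by
  obtain ⟨y⟩ : Nonempty Y := inferInstance
  exact ⟨⟨g, .const Z y, homotopic_of_contractible _ _, homotopic_of_contractible _ _⟩, rfl⟩

variable [PartialOrder X]

omit [Fintype X] in
lemma mem_orderComplex {S : Set X} {s : Finset X} :
    s ∈ orderComplex S ↔ s.Nonempty ∧ (s : Set X) ⊆ S ∧ IsChain (· ≤ ·) (s : Set X) := Iff.rfl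

lemma mem_realization_orderComplex {S : Set X} {p : X → ℝ} :
    p ∈ realization (orderComplex S) ↔ p ∈ stdSimplex ℝ X ∧ (∀ v, p v ≠ 0 → v ∈ S) ∧
      IsChain (· ≤ ·) {v | p v ≠ 0} := by
  have hs : ((supp p : Finset X) : Set X) = {v | p v ≠ 0} := by ext; simp
  rw [mem_realization, mem_orderComplex, hs]
  exact and_congr_right fun hp => ⟨fun h => h.2, fun h => ⟨supp_nonempty hp, h⟩⟩

omit [Fintype X] in
/-- The cone over the descending link of `x` is the order complex of the principal ideal. -/
lemma simplicialCone_Iio (x : X) :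
    simplicialCone x (orderComplex (Iio x)) = orderComplex (Iic x) := by
  classical
  refine SetLike.ext fun s => ?_
  constructor
  · rintro (hs | rfl | ⟨t, ⟨-, ht, hch⟩, rfl⟩)
    · exact orderComplex_mono Iio_subset_Iic_self hs
    · exact ⟨Finset.singleton_nonempty x, by simp, by simp⟩
    · refine ⟨Finset.insert_nonempty _ _, ?_, ?_⟩
      · rw [Finset.coe_insert]
        exact insert_subset (mem_Iic.2 le_rfl) (ht.trans Iio_subset_Iic_self)
      · rw [Finset.coe_insert]
        exact hch.insert fun b hb _ => Or.inr (le_of_lt (ht hb))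
  · rintro ⟨hne, hs, hch⟩
    have herase : ((s.erase x : Finset X) : Set X) ⊆ Iio x := fun v hv => by
      have hv' := Finset.mem_erase.1 (Finset.mem_coe.1 hv)
      exact lt_of_le_of_ne (hs hv'.2) hv'.1
    have hch' : IsChain (· ≤ ·) ((s.erase x : Finset X) : Set X) :=
      hch.mono (Finset.coe_subset.2 (Finset.erase_subset x s))
    by_cases hx : x ∈ s
    · by_cases he : (s.erase x).Nonempty
      · exact Or.inr (Or.inr ⟨s.erase x, ⟨he, herase, hch'⟩, (Finset.insert_erase hx).symm⟩)
      · refine Or.inr (Or.inl ?_)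
        rw [← Finset.insert_erase hx, Finset.not_nonempty_iff_eq_empty.1 he]
        rfl
    · rw [Finset.erase_eq_of_notMem hx] at herase
      exact Or.inl ⟨hne, herase, hch⟩

/-- The realization of the order complex of a principal ideal is star-shaped. -/
lemma contractibleSpace_Iic (x : X) :
    ContractibleSpace (realization (orderComplex (Iic x))) := by
  classical
  have hx : (Pi.single x 1 : X → ℝ) ∈ realization (orderComplex (Iic x)) := by
    refine mem_realization_orderComplex.2 ⟨single_mem_stdSimplex ℝ x, fun v hv => ?_, ?_⟩
    · obtain rfl : v = x := by
        by_contra h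
        exact hv (by simp [h])
      exact le_rfl
    · refine IsChain.mono (t := {x}) (fun v hv => ?_) (by simp)
      by_contra h
      exact hv (by simp [mem_singleton_iff.not.1 h])
  refine StarConvex.contractibleSpace (x := (Pi.single x 1 : X → ℝ)) ?_ ⟨_, hx⟩
  rintro p hp a b ha hb hab
  obtain ⟨hp1, hp2, hp3⟩ := mem_realization_orderComplex.1 hp
  have hsub : ∀ v, (a • (Pi.single x 1 : X → ℝ) + b • p) v ≠ 0 → v = x ∨ p v ≠ 0 := by
    intro v hv
    by_contra! h
    exact hv (by simp [h.1, h.2])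
  refine mem_realization_orderComplex.2
    ⟨convex_stdSimplex ℝ X (single_mem_stdSimplex ℝ x) hp1 ha hb hab, fun v hv => ?_, ?_⟩
  · rcases hsub v hv with rfl | h
    · exact le_rfl
    · exact hp2 v h
  · refine IsChain.mono (t := insert x {v | p v ≠ 0}) (fun v hv => hsub v hv) ?_
    exact hp3.insert fun v hv _ => Or.inr (hp2 v hv)

end Contractible

/-! ### Adjunction spaces -/

open Metric

section Adjunction

variable {B D Y Y' : Type u} [TopologicalSpace B] [TopologicalSpace D] [TopologicalSpace Y]
  [TopologicalSpace Y']

/-- The maps `j : Y → Y'` and `k : D → Y'` exhibit `Y'` as the space glued from `Y` and `D` along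
`φ : B → Y` and the injective map `ι : B → D`, expressed through the points of these spaces. -/
structure IsGluing (φ : C(B, Y)) (ι : C(B, D)) (j : C(Y, Y')) (k : C(D, Y')) : Prop where
  comm : ∀ b, k (ι b) = j (φ b)
  injective : Function.Injective j
  mem_range : ∀ y d, j y = k d → d ∈ range ι
  eq_of_notMem : ∀ d d', d ∉ range ι → k d = k d' → d = d'
  isQuotientMap : Topology.IsQuotientMap (Sum.elim j k)

namespace IsGluing

variable {φ : C(B, Y)} {ι : C(B, D)} {j : C(Y, Y')} {k : C(D, Y')}

lemma exists_eq (G : IsGluing φ ι j k) (y' : Y') : (∃ y, j y = y') ∨ ∃ d, k d = y' := by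
  obtain ⟨y | d, h⟩ := G.isQuotientMap.surjective y'
  · exact Or.inl ⟨y, h⟩
  · exact Or.inr ⟨d, h⟩

/-- Continuous maps on `Y` and `D` which agree on `B` induce a continuous map on `Y'`. -/
lemma exists_desc (G : IsGluing φ ι j k) {T : Type*} [TopologicalSpace T] (a : C(Y, T))
    (b : C(D, T)) (hab : ∀ x, a (φ x) = b (ι x)) :
    ∃ c : C(Y', T), (∀ y, c (j y) = a y) ∧ ∀ d, c (k d) = b d := by
  let p : C(Y ⊕ D, Y') := ⟨Sum.elim j k, G.isQuotientMap.continuous⟩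
  let g : C(Y ⊕ D, T) := ⟨Sum.elim a b, by fun_prop⟩
  have hjk : ∀ y d, j y = k d → a y = b d := by
    intro y d h
    obtain ⟨x, rfl⟩ := G.mem_range y d h
    rw [G.comm] at h
    rw [G.injective h, hab]
  have hfac : Function.FactorsThrough g p := by
    rintro (y | d) (y' | d') h
    · exact congrArg a (G.injective h)
    · exact hjk y d' h
    · exact (hjk y' d h.symm).symm
    · by_cases hd : d ∈ range ι
      · obtain ⟨x, rfl⟩ := hd
        have h' : j (φ x) = k d' := (G.comm x).symm.trans h
        exact (hab x).symm.trans (hjk _ _ h')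
      · exact congrArg b (G.eq_of_notMem d d' hd h)
  have hp : Topology.IsQuotientMap p := G.isQuotientMap
  refine ⟨hp.lift g hfac, fun y => ?_, fun d => ?_⟩
  · exact DFunLike.congr_fun (hp.lift_comp g hfac) (Sum.inl y)
  · exact DFunLike.congr_fun (hp.lift_comp g hfac) (Sum.inr d)

lemma isAdjunctionSpace (G : IsGluing φ ι j k) : IsAdjunctionSpace φ ι j k := by
  have w : TopCat.ofHom φ ≫ TopCat.ofHom j = TopCat.ofHom ι ≫ TopCat.ofHom k := by
    ext b
    exact (G.comm b).symm
  refine ⟨⟨w⟩, ⟨Limits.PushoutCocone.IsColimit.mk _ (fun s => TopCat.ofHom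
    (G.exists_desc s.inl.hom s.inr.hom fun x => ?_).choose) ?_ ?_ ?_⟩⟩
  · exact ConcreteCategory.congr_hom s.condition x
  · intro s
    ext y
    exact (G.exists_desc s.inl.hom s.inr.hom
      fun x => ConcreteCategory.congr_hom s.condition x).choose_spec.1 y
  · intro s
    ext d
    exact (G.exists_desc s.inl.hom s.inr.hom
      fun x => ConcreteCategory.congr_hom s.condition x).choose_spec.2 d
  · intro s m h1 h2
    ext y'
    obtain ⟨H1, H2⟩ := (G.exists_desc s.inl.hom s.inr.hom
      (fun x => ConcreteCategory.congr_hom s.condition x)).choose_spec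
    rcases G.exists_eq y' with ⟨y, rfl⟩ | ⟨d, rfl⟩
    · exact (ConcreteCategory.congr_hom h1 y).trans (H1 y).symm
    · exact (ConcreteCategory.congr_hom h2 d).trans (H2 d).symm

end IsGluing

/-- The points of the adjunction space `Y ∪_φ D`: those of `Y`, and those of `D` outside of the
image of `ι`. -/
def Adjunction (_ : C(B, Y)) (ι : C(B, D)) : Type u := Y ⊕ {d : D // d ∉ range ι}

namespace Adjunction

variable (φ : C(B, Y)) (ι : C(B, D))

open Classical in
/-- The quotient map from the disjoint union of `Y` and `D` to the adjunction space. -/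
noncomputable def proj : Y ⊕ D → Adjunction φ ι :=
  Sum.elim Sum.inl fun d => if h : d ∈ range ι then Sum.inl (φ h.choose) else Sum.inr ⟨d, h⟩

noncomputable instance : TopologicalSpace (Adjunction φ ι) :=
  TopologicalSpace.coinduced (proj φ ι) inferInstance

lemma surjective_proj : Function.Surjective (proj φ ι) := by
  rintro (y | ⟨d, hd⟩)
  · exact ⟨Sum.inl y, rfl⟩
  · exact ⟨Sum.inr d, dif_neg hd⟩

lemma isQuotientMap_proj : Topology.IsQuotientMap (proj φ ι) :=
  ⟨⟨rfl⟩, surjective_proj φ ι⟩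

/-- The canonical map from `Y` to the adjunction space. -/
noncomputable def inl : C(Y, Adjunction φ ι) :=
  ⟨fun y => proj φ ι (Sum.inl y), (isQuotientMap_proj φ ι).continuous.comp continuous_inl⟩

/-- The canonical map from `D` to the adjunction space. -/
noncomputable def inr : C(D, Adjunction φ ι) :=
  ⟨fun d => proj φ ι (Sum.inr d), (isQuotientMap_proj φ ι).continuous.comp continuous_inr⟩

lemma inr_of_notMem {d : D} (hd : d ∉ range ι) : inr φ ι d = Sum.inr ⟨d, hd⟩ := dif_neg hd

variable {ι}

lemma inr_apply (hι : Function.Injective ι) (b : B) : inr φ ι (ι b) = inl φ ι (φ b) := by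
  have h : ι b ∈ range ι := ⟨b, rfl⟩
  have : inr φ ι (ι b) = Sum.inl (φ h.choose) := dif_pos h
  rw [this, hι h.choose_spec]
  rfl

lemma isGluing (hι : Function.Injective ι) : IsGluing φ ι (inl φ ι) (inr φ ι) where
  comm := inr_apply φ hι
  injective := fun y y' h => Sum.inl_injective h
  mem_range := fun y d h => by
    by_contra hd
    rw [inr_of_notMem φ ι hd] at h
    exact Sum.inl_ne_inr h
  eq_of_notMem := fun d d' hd h => by
    rw [inr_of_notMem φ ι hd] at h
    by_cases hd' : d' ∈ range ι
    · obtain ⟨b, rfl⟩ := hd'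
      rw [inr_apply φ hι] at h
      exact absurd h.symm Sum.inl_ne_inr
    · rw [inr_of_notMem φ ι hd'] at h
      exact congrArg Subtype.val (Sum.inr_injective h)
  isQuotientMap := by
    convert isQuotientMap_proj φ ι using 1
    ext (y | d) <;> rfl

end Adjunction

lemma IsGluing.compactSpace {φ : C(B, Y)} {ι : C(B, D)} {j : C(Y, Y')} {k : C(D, Y')}
    (G : IsGluing φ ι j k) [CompactSpace Y] [CompactSpace D] : CompactSpace Y' := by
  constructor
  rw [← G.isQuotientMap.surjective.range_eq]
  exact isCompact_range G.isQuotientMap.continuous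

/-- An adjunction space of compact Hausdorff spaces is Hausdorff: continuous functions separate its
points, by the theorems of Urysohn and Tietze. -/
lemma IsGluing.t2Space {φ : C(B, Y)} {ι : C(B, D)} {j : C(Y, Y')} {k : C(D, Y')}
    (G : IsGluing φ ι j k) (hι : Topology.IsClosedEmbedding ι) [CompactSpace Y] [T2Space Y]
    [CompactSpace D] [T2Space D] : T2Space Y' := by
  -- a function which separates a point of `D` outside of `B` from `Y` and another point of `D`
  have key : ∀ d d', d ∉ range ι → d ≠ d' →
      ∃ c : C(Y', ℝ), c (k d) = 1 ∧ (∀ y, c (j y) = 0) ∧ c (k d') = 0 := by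
    intro d d' hd hdd
    obtain ⟨f, hf0, hf1, -⟩ := exists_continuous_zero_one_of_isClosed
      (hι.isClosed_range.union (isClosed_singleton (x := d'))) (isClosed_singleton (x := d))
      (by
        rw [disjoint_singleton_right]
        rintro (h | h)
        exacts [hd h, hdd h])
    obtain ⟨c, hc1, hc2⟩ := G.exists_desc (.const Y 0) f
      (fun x => (hf0 (Or.inl ⟨x, rfl⟩)).symm)
    exact ⟨c, (hc2 d).trans (hf1 rfl), fun y => hc1 y, (hc2 d').trans (hf0 (Or.inr rfl))⟩
  have sep : ∀ a b : Y', a ≠ b → ∃ c : C(Y', ℝ), c a ≠ c b := by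
    have hjk : ∀ a : Y', (∃ y, j y = a) ∨ ∃ d ∉ range ι, k d = a := by
      intro a
      rcases G.exists_eq a with h | ⟨d, rfl⟩
      · exact Or.inl h
      · by_cases hd : d ∈ range ι
        · obtain ⟨b, rfl⟩ := hd
          exact Or.inl ⟨φ b, (G.comm b).symm⟩
        · exact Or.inr ⟨d, hd, rfl⟩
    intro a b hab
    rcases hjk a with ⟨y, rfl⟩ | ⟨d, hd, rfl⟩
    · rcases hjk b with ⟨y', rfl⟩ | ⟨d', hd', rfl⟩
      · obtain ⟨f, hf0, hf1, -⟩ := exists_continuous_zero_one_of_isClosed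
          (isClosed_singleton (x := y)) (isClosed_singleton (x := y'))
          (by simpa using fun h => hab (congrArg j h))
        obtain ⟨g, hg⟩ := (f.comp φ).exists_extension hι
        obtain ⟨c, hc1, -⟩ := G.exists_desc f g (fun x => (DFunLike.congr_fun hg x).symm)
        refine ⟨c, ?_⟩
        rw [hc1, hc1, hf0 rfl, hf1 rfl]
        simp
      · by_cases hex : ∃ d, d ≠ d'
        · obtain ⟨d, hd⟩ := hex
          obtain ⟨c, hc1, hc2, -⟩ := key d' d hd' hd.symm
          exact ⟨c, by rw [hc1, hc2]; simp⟩
        · push Not at hex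
          obtain ⟨c, hc1, hc2⟩ := G.exists_desc (.const Y (0 : ℝ)) (.const D 1) (fun x => by
            exact absurd ⟨x, hex _⟩ hd')
          exact ⟨c, by rw [hc1, hc2]; simp⟩
    · by_cases hex : ∃ d', k d' = b
      · obtain ⟨d', rfl⟩ := hex
        obtain ⟨c, hc1, -, hc2⟩ := key d d' hd (fun h => hab (congrArg k h))
        exact ⟨c, by rw [hc1, hc2]; simp⟩
      · obtain ⟨y, rfl⟩ := (G.exists_eq b).resolve_right hex
        by_cases hex : ∃ d', d' ≠ d
        · obtain ⟨d', hd'⟩ := hex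
          obtain ⟨c, hc1, hc2, -⟩ := key d d' hd hd'.symm
          exact ⟨c, by rw [hc1, hc2]; simp⟩
        · push Not at hex
          obtain ⟨c, hc1, hc2⟩ := G.exists_desc (.const Y (0 : ℝ)) (.const D 1) (fun x => by
            exact absurd ⟨x, hex _⟩ hd)
          exact ⟨c, by rw [hc1, hc2]; simp⟩
  refine ⟨fun a b hab => ?_⟩
  obtain ⟨c, hc⟩ := sep a b hab
  exact separated_by_continuous c.continuous hc

end Adjunction

/-! ### Attaching cells -/

/-- The inverse of a characteristic map is continuous on the open cell. -/
lemma continuousOn_leftInverse {E Y : Type*} [TopologicalSpace E] [TopologicalSpace Y] [T2Space Y]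
    {f : E → Y} {g : Y → E} {C U : Set E} (hC : IsCompact C) (hf : ContinuousOn f C)
    (hUC : U ⊆ C) (hinj : ∀ z ∈ C, ∀ z' ∈ U, f z = f z' → z = z') (hg : ∀ z ∈ U, g (f z) = z) :
    ContinuousOn g (f '' U) := by
  rw [continuousOn_iff_isClosed]
  intro t ht
  refine ⟨f '' (C ∩ t), ((hC.inter_right ht).image_of_continuousOn
    (hf.mono inter_subset_left)).isClosed, ?_⟩
  ext y
  constructor
  · rintro ⟨hy, z, hz, rfl⟩
    exact ⟨⟨z, ⟨hUC hz, by simpa [hg z hz] using hy⟩, rfl⟩, z, hz, rfl⟩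
  · rintro ⟨⟨z, ⟨hzC, hzt⟩, h⟩, z', hz', rfl⟩
    refine ⟨?_, z', hz', rfl⟩
    rw [mem_preimage, hg z' hz', ← hinj z hzC z' hz' h]
    exact hzt

open Topology in
/-- A Hausdorff space obtained from a finite CW complex `Y` by attaching finitely many cells
with characteristic maps `Ψ` is a finite CW complex. -/
lemma exists_CWComplex_of_cells {Y Y' : Type u} [TopologicalSpace Y] [TopologicalSpace Y']
    [T2Space Y] [T2Space Y'] [CWComplex (univ : Set Y)] [RelCWComplex.Finite (univ : Set Y)]
    (j : C(Y, Y')) (hj : Function.Injective j) (α : ℕ → Type u) [∀ n, Finite (α n)]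
    (hα : ∀ᶠ n in Filter.atTop, IsEmpty (α n)) (Ψ : ∀ n, α n → (Fin n → ℝ) → Y')
    (hΨ : ∀ n a, ContinuousOn (Ψ n a) (closedBall 0 1))
    (hinj : ∀ n a, ∀ z ∈ closedBall 0 1, ∀ z' ∈ ball 0 1, Ψ n a z = Ψ n a z' → z = z')
    (hdisj : ∀ n a, ∀ z ∈ ball 0 1, Ψ n a z ∉ range j)
    (hpair : ∀ n a m b, ∀ z ∈ ball 0 1, ∀ z' ∈ ball 0 1, Ψ n a z = Ψ m b z' →
      (⟨n, a⟩ : Σ n, α n) = ⟨m, b⟩)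
    (hsph : ∀ (n : ℕ) (a : α n), ∀ z ∈ sphere 0 1,
      (∃ y ∈ CWComplex.skeletonLT (univ : Set Y) (n : ℕ∞), j y = Ψ n a z) ∨
        ∃ m < n, ∃ b, Ψ n a z ∈ Ψ m b '' closedBall 0 1)
    (hcover : ∀ y', y' ∈ range j ∨ ∃ n a, y' ∈ Ψ n a '' closedBall 0 1) :
    ∃ _ : CWComplex (univ : Set Y'), RelCWComplex.Finite (univ : Set Y') ∧
      (∀ n : ℕ, ∀ y ∈ CWComplex.skeletonLT (univ : Set Y) (n : ℕ∞),
        j y ∈ CWComplex.skeletonLT (univ : Set Y') (n : ℕ∞)) ∧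
      ∀ n a, ∀ z ∈ closedBall 0 1,
        Ψ n a z ∈ CWComplex.skeletonLT (univ : Set Y') ((n + 1 : ℕ) : ℕ∞) := by
  let cell : ℕ → Type u := fun n => RelCWComplex.cell (univ : Set Y) n ⊕ α n
  let F : ∀ n, cell n → (Fin n → ℝ) → Y' := fun n =>
    Sum.elim (fun e z => j (RelCWComplex.map n e z)) (Ψ n)
  have hFc : ∀ n e, ContinuousOn (F n e) (closedBall 0 1) := by
    rintro n (e | a)
    · exact j.continuous.comp_continuousOn (RelCWComplex.continuousOn n e)
    · exact hΨ n a
  have hFinj : ∀ n e, ∀ z ∈ closedBall 0 1, ∀ z' ∈ ball 0 1, F n e z = F n e z' → z = z' := by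
    rintro n (e | a) z hz z' hz' h
    · have h' : RelCWComplex.map n e z = RelCWComplex.map n e z' := hj h
      rcases (mem_closedBall.1 hz).lt_or_eq with hlt | heq
      · refine (RelCWComplex.map n e).injOn ?_ ?_ h' <;> rw [RelCWComplex.source_eq]
        exacts [mem_ball.2 hlt, hz']
      · have h1 : RelCWComplex.map n e z ∈ RelCWComplex.cellFrontier n e :=
          ⟨z, mem_sphere.2 heq, rfl⟩
        have h2 : RelCWComplex.map n e z ∈ RelCWComplex.openCell n e := ⟨z', hz', h'.symm⟩
        exact absurd h2 (disjoint_left.1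
          (CWComplex.disjoint_skeletonLT_openCell (C := (univ : Set Y)) le_rfl)
          (CWComplex.cellFrontier_subset_skeletonLT n e h1))
    · exact hinj n a z hz z' hz' h
  have hFinj' : ∀ n e, InjOn (F n e) (ball 0 1) := fun n e z hz z' hz' h =>
    hFinj n e z (ball_subset_closedBall hz) z' hz' h
  let map : ∀ n, cell n → PartialEquiv (Fin n → ℝ) Y' := fun n e =>
    (hFinj' n e).toPartialEquiv (F n e) (ball 0 1)
  have hpd : (univ : Set (Σ n, cell n)).PairwiseDisjoint (fun ni ↦ map ni.1 ni.2 '' ball 0 1) := by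
    rintro ⟨n, e⟩ - ⟨m, e'⟩ - hne
    refine disjoint_left.2 ?_
    rintro _ ⟨z, hz, rfl⟩ ⟨z', hz', h⟩
    rcases e with e | a <;> rcases e' with e' | a'
    · have h' : RelCWComplex.map m e' z' = RelCWComplex.map n e z := hj h
      have := RelCWComplex.eq_of_not_disjoint_openCell (C := (univ : Set Y)) (j := e) (i := e')
        (not_disjoint_iff.2 ⟨_, ⟨z, hz, rfl⟩, ⟨z', hz', h'⟩⟩)
      obtain ⟨rfl, h2⟩ := Sigma.mk.inj this
      obtain rfl := eq_of_heq h2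
      exact hne rfl
    · exact hdisj m a' z' hz' ⟨_, h.symm⟩
    · exact hdisj n a z hz ⟨_, h⟩
    · obtain ⟨rfl, h2⟩ := Sigma.mk.inj (hpair _ _ _ _ z hz z' hz' h.symm)
      obtain rfl := eq_of_heq h2
      exact hne rfl
  have hskel : ∀ n : ℕ, ∀ y ∈ CWComplex.skeletonLT (univ : Set Y) (n : ℕ∞),
      ∃ m < n, ∃ e : cell m, j y ∈ F m e '' closedBall 0 1 := by
    intro n y hy
    obtain ⟨m, hm, e, z, hz, rfl⟩ := CWComplex.mem_skeletonLT_iff.1 hy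
    exact ⟨m, by exact_mod_cast hm, Sum.inl e, z, ball_subset_closedBall hz, rfl⟩
  have hmaps : ∀ n (e : cell n), MapsTo (map n e) (sphere 0 1)
      (⋃ (m < n) (e' : cell m), map m e' '' closedBall 0 1) := by
    intro n e z hz
    suffices h : ∃ m < n, ∃ e' : cell m, F n e z ∈ F m e' '' closedBall 0 1 by
      simp only [mem_iUnion]
      obtain ⟨m, hm, e', h⟩ := h
      exact ⟨m, hm, e', h⟩
    rcases e with e | a
    · exact hskel n _ (CWComplex.cellFrontier_subset_skeletonLT n e ⟨z, hz, rfl⟩)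
    · rcases hsph n a z hz with ⟨y, hy, h⟩ | ⟨m, hm, b, h⟩
      · change ∃ m < n, ∃ e' : cell m, Ψ n a z ∈ _
        rw [← h]
        exact hskel n y hy
      · exact ⟨m, hm, Sum.inr b, h⟩
  have hunion : ⋃ (n : ℕ) (e : cell n), map n e '' closedBall 0 1 = univ := by
    refine eq_univ_of_forall fun y' => ?_
    simp only [mem_iUnion]
    rcases hcover y' with ⟨y, rfl⟩ | ⟨n, a, h⟩
    · have hy : y ∈ ⋃ (n : ℕ) (e : RelCWComplex.cell (univ : Set Y) n),
          RelCWComplex.closedCell n e := by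
        rw [CWComplex.union]
        trivial
      simp only [mem_iUnion] at hy
      obtain ⟨n, e, z, hz, rfl⟩ := hy
      exact ⟨n, Sum.inl e, z, hz, rfl⟩
    · exact ⟨n, Sum.inr a, h⟩
  have hev : ∀ᶠ n in Filter.atTop, IsEmpty (cell n) := by
    filter_upwards [hα, RelCWComplex.FiniteDimensional.eventually_isEmpty_cell
      (C := (univ : Set Y)) (D := ∅)] with n h1 h2
    exact isEmpty_sum.2 ⟨h2, h1⟩
  have hfin : ∀ n, Finite (cell n) := fun n => by
    have : Finite (RelCWComplex.cell (univ : Set Y) n) := RelCWComplex.FiniteType.finite_cell n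
    exact inferInstanceAs (Finite (_ ⊕ _))
  have hsymm : ∀ n (e : cell n), ContinuousOn (map n e).symm (map n e).target := fun n e =>
    continuousOn_leftInverse (isCompact_closedBall _ _) (hFc n e) ball_subset_closedBall
      (hFinj n e) fun z hz => (map n e).left_inv hz
  let C : CWComplex (univ : Set Y') := CWComplex.mkFinite univ cell map hev hfin
    (fun _ _ => rfl) hFc hsymm hpd hmaps hunion
  have hsub : ∀ n (e : cell n), F n e '' closedBall 0 1 ⊆
      CWComplex.skeletonLT (univ : Set Y') ((n + 1 : ℕ) : ℕ∞) := fun n e => by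
    push_cast
    exact CWComplex.closedCell_subset_skeletonLT (C := (univ : Set Y')) n e
  refine ⟨C, CWComplex.finite_mkFinite univ cell map hev hfin
    (fun _ _ => rfl) hFc hsymm hpd hmaps hunion, fun n y hy => ?_, fun n a z hz => ?_⟩
  · obtain ⟨m, hm, e, h⟩ := hskel n y hy
    exact CWComplex.skeletonLT_mono (by exact_mod_cast hm) (hsub m e h)
  · exact hsub n (Sum.inr a) ⟨z, hz, rfl⟩

/-! ### Simplices as cells -/

section CharacteristicMap

variable {X : Type u} [Fintype X]

open Classical in
/-- The affine parametrisation of the hyperplane spanned by the face `s` of the standard simplex,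
where `e` enumerates the vertices of `s`; the coordinate at the first vertex is the complement to
`1` of the other ones. -/
noncomputable def faceParam {s : Finset X} {n : ℕ} (e : s ≃ Fin (n + 1)) (q : Fin n → ℝ) : X → ℝ :=
  fun v => if hv : v ∈ s then Fin.cons (α := fun _ => ℝ) (1 - ∑ i, q i) q (e ⟨v, hv⟩) else 0

variable {s : Finset X} {n : ℕ} (e : s ≃ Fin (n + 1))

omit [Fintype X] in
lemma faceParam_coe (q : Fin n → ℝ) (v : s) :
    faceParam e q v = Fin.cons (α := fun _ => ℝ) (1 - ∑ i, q i) q (e v) := dif_pos v.2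

omit [Fintype X] in
lemma faceParam_of_notMem (q : Fin n → ℝ) {v : X} (hv : v ∉ s) : faceParam e q v = 0 := dif_neg hv

omit [Fintype X] in
lemma faceParam_symm_succ (q : Fin n → ℝ) (i : Fin n) :
    faceParam e q (e.symm i.succ) = q i := by
  rw [faceParam_coe, Equiv.apply_symm_apply, Fin.cons_succ]

omit [Fintype X] in
lemma faceParam_symm_zero (q : Fin n → ℝ) :
    faceParam e q (e.symm 0) = 1 - ∑ i, q i := by
  rw [faceParam_coe, Equiv.apply_symm_apply, Fin.cons_zero]

lemma sum_eq_of_supp_subset {p : X → ℝ} (hp : ∀ v ∉ s, p v = 0) :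
    ∑ v, p v = p (e.symm 0) + ∑ i : Fin n, p (e.symm i.succ) := by
  classical
  rw [← Fin.sum_univ_succ (f := fun i => p (e.symm i)),
    Equiv.sum_comp e.symm (fun v : s => p v), Finset.sum_coe_sort s p]
  exact (Finset.sum_subset (Finset.subset_univ s) fun v _ hv => hp v hv).symm

lemma sum_faceParam (q : Fin n → ℝ) : ∑ v, faceParam e q v = 1 := by
  rw [sum_eq_of_supp_subset e fun v hv => faceParam_of_notMem e q hv, faceParam_symm_zero]
  simp only [faceParam_symm_succ]
  ring

lemma faceParam_mem_face {q : Fin n → ℝ} (h0 : ∀ i, 0 ≤ q i) (h1 : ∑ i, q i ≤ 1) :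
    faceParam e q ∈ face s := by
  refine ⟨⟨fun v => ?_, sum_faceParam e q⟩, fun v hv => faceParam_of_notMem e q hv⟩
  by_cases hv : v ∈ s
  · rw [faceParam_coe e q ⟨v, hv⟩]
    refine Fin.cases ?_ (fun i => ?_) (e ⟨v, hv⟩)
    · simpa using h1
    · simpa using h0 i
  · rw [faceParam_of_notMem e q hv]

omit [Fintype X] in
lemma continuous_faceParam : Continuous (faceParam e) := by
  refine continuous_pi fun v => ?_
  by_cases hv : v ∈ s
  · simp only [faceParam, hv, dite_true]
    generalize e ⟨v, hv⟩ = i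
    refine Fin.cases ?_ (fun i => ?_) i
    · simp only [Fin.cons_zero]
      fun_prop
    · simp only [Fin.cons_succ]
      fun_prop
  · simp only [faceParam, hv, dite_false]
    exact continuous_const

omit [Fintype X] in
lemma injective_faceParam : Function.Injective (faceParam e) := fun q q' h => by
  ext i
  rw [← faceParam_symm_succ e q i, h, faceParam_symm_succ]

lemma faceParam_of_supp_subset {p : X → ℝ} (hp : ∑ v, p v = 1) (hps : ∀ v ∉ s, p v = 0) :
    faceParam e (fun i => p (e.symm i.succ)) = p := by
  have hsum := sum_eq_of_supp_subset e hps
  rw [hp] at hsum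
  ext v
  by_cases hv : v ∈ s
  · obtain ⟨i, hi⟩ := e.symm.surjective ⟨v, hv⟩
    have hv' : v = e.symm i := by rw [hi]
    rw [hv']
    refine Fin.cases ?_ (fun i => ?_) i
    · rw [faceParam_symm_zero]
      linarith
    · rw [faceParam_symm_succ]
  · rw [faceParam_of_notMem e _ hv, hps v hv]

/-- The inclusion of a face of the standard simplex, as a characteristic map on the unit cube. -/
lemma exists_characteristicMap (s : Finset X) {n : ℕ} (hs : s.card = n + 1) :
    ∃ Φ : (Fin n → ℝ) → X → ℝ, Continuous Φ ∧ Function.Injective Φ ∧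
      (∀ z ∈ ball 0 1, Φ z ∈ stdSimplex ℝ X ∧ supp (Φ z) = s) ∧
      (∀ p ∈ stdSimplex ℝ X, supp p = s → ∃ z ∈ ball 0 1, Φ z = p) ∧
      ∀ z ∈ sphere 0 1, Φ z ∈ stdSimplex ℝ X ∧ supp (Φ z) ⊂ s := by
  classical
  let e : s ≃ Fin (n + 1) := s.equivFinOfCardEq hs
  let t : Set (Fin n → ℝ) := {q | (∀ i, 0 < q i) ∧ ∑ i, q i < 1}
  have hto : IsOpen t := by
    have : t = (⋂ i, {q : Fin n → ℝ | 0 < q i}) ∩ {q | ∑ i, q i < 1} := by ext; simp [t]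
    rw [this]
    refine IsOpen.inter ?_ (isOpen_lt (by fun_prop) continuous_const)
    exact isOpen_iInter_of_finite fun i => isOpen_lt continuous_const (continuous_apply i)
  have htc : Convex ℝ t := by
    rintro q ⟨hq0, hq1⟩ q' ⟨hq0', hq1'⟩ a b ha hb hab
    refine ⟨fun i => ?_, ?_⟩
    · rcases ha.eq_or_lt with rfl | ha'
      · have : b = 1 := by linarith
        simpa [this] using hq0' i
      · have h1 := mul_pos ha' (hq0 i)
        have h2 := mul_nonneg hb (hq0' i).le
        simp only [Pi.add_apply, Pi.smul_apply, smul_eq_mul]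
        linarith
    · simp only [Pi.add_apply, Pi.smul_apply, smul_eq_mul, Finset.sum_add_distrib,
        ← Finset.mul_sum]
      rcases ha.eq_or_lt with rfl | ha'
      · have : b = 1 := by linarith
        simpa [this] using hq1'
      · have h1 := mul_lt_mul_of_pos_left hq1 ha'
        have h2 := mul_le_mul_of_nonneg_left hq1'.le hb
        linarith
  have htb : Bornology.IsBounded t := by
    refine (isBounded_Icc (0 : Fin n → ℝ) 1).subset fun q ⟨hq0, hq1⟩ => ⟨fun i => (hq0 i).le,
      fun i => ?_⟩
    exact (Finset.single_le_sum (f := q) (fun j _ => (hq0 j).le) (Finset.mem_univ i)).trans hq1.le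
  have htne : (interior t).Nonempty := by
    rw [hto.interior_eq]
    refine ⟨fun _ => 1 / (n + 1), fun i => by positivity, ?_⟩
    simp only [Finset.sum_const, Finset.card_univ, Fintype.card_fin, nsmul_eq_mul]
    rw [mul_one_div, div_lt_one (by positivity)]
    linarith
  obtain ⟨h, hint, -, hfr⟩ :=
    exists_homeomorph_image_interior_closure_frontier_eq_unitBall htc htne htb
  rw [hto.interior_eq] at hint
  have hclosure : ∀ q ∈ closure t, (∀ i, 0 ≤ q i) ∧ ∑ i, q i ≤ 1 := by
    intro q hq
    have hcl : IsClosed (Ici (0 : Fin n → ℝ) ∩ {q | ∑ i, q i ≤ 1}) :=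
      isClosed_Ici.inter (isClosed_le (by fun_prop) continuous_const)
    have hsub : t ⊆ Ici (0 : Fin n → ℝ) ∩ {q | ∑ i, q i ≤ 1} :=
      fun q hq => ⟨fun i => (hq.1 i).le, hq.2.le⟩
    exact closure_minimal hsub hcl hq
  have hsupp : ∀ q, (∀ i, 0 ≤ q i) → ∑ i, q i ≤ 1 → (q ∈ t ↔ supp (faceParam e q) = s) := by
    intro q h0 h1
    have hface := faceParam_mem_face e h0 h1
    have hsub := (mem_face_iff.1 hface).2
    constructor
    · rintro ⟨hq0, hq1⟩
      refine hsub.antisymm fun v hv => mem_supp.2 ?_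
      rw [faceParam_coe e q ⟨v, hv⟩]
      refine Fin.cases ?_ (fun i => ?_) (e ⟨v, hv⟩)
      · simpa using (sub_pos.2 hq1).ne'
      · simpa using (hq0 i).ne'
    · intro hs
      refine ⟨fun i => (h0 i).lt_of_ne' ?_, h1.lt_of_ne' ?_⟩
      · rw [← faceParam_symm_succ e q i]
        exact mem_supp.1 (hs.symm.subset (e.symm i.succ).2)
      · have := mem_supp.1 (hs.symm.subset (e.symm 0).2)
        rw [faceParam_symm_zero] at this
        exact fun h => this (sub_eq_zero.2 h)
  refine ⟨fun z => faceParam e (h.symm z), (continuous_faceParam e).comp h.symm.continuous,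
    (injective_faceParam e).comp h.symm.injective, fun z hz => ?_, fun p hp hps => ?_,
    fun z hz => ?_⟩
  · rw [← hint] at hz
    obtain ⟨q, hq, rfl⟩ := hz
    simp only [h.symm_apply_apply]
    exact ⟨(faceParam_mem_face e (fun i => (hq.1 i).le) hq.2.le).1,
      (hsupp q (fun i => (hq.1 i).le) hq.2.le).1 hq⟩
  · let q : Fin n → ℝ := fun i => p (e.symm i.succ)
    have hp0 : ∀ v ∉ s, p v = 0 := fun v hv => by
      by_contra h
      exact hv (hps ▸ mem_supp.2 h)
    have hsum := sum_eq_of_supp_subset e hp0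
    rw [hp.2] at hsum
    have hqp : faceParam e q = p := faceParam_of_supp_subset e hp.2 hp0
    have hqt : q ∈ t := by
      refine (hsupp q (fun i => hp.1 _) ?_).2 (by rw [hqp, hps])
      have := hp.1 (e.symm 0)
      linarith
    refine ⟨h q, hint ▸ mem_image_of_mem h hqt, ?_⟩
    simp only [h.symm_apply_apply, hqp]
  · rw [← hfr] at hz
    obtain ⟨q, hq, rfl⟩ := hz
    simp only [h.symm_apply_apply]
    obtain ⟨h0, h1⟩ := hclosure q hq.1
    have hface := mem_face_iff.1 (faceParam_mem_face e h0 h1)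
    refine ⟨hface.1, hface.2.ssubset_of_ne fun hs => ?_⟩
    have hqt : q ∈ t := (hsupp q h0 h1).2 hs
    rw [← hto.interior_eq] at hqt
    exact hq.2 hqt

end CharacteristicMap

/-! ### Gluing the realization of a simplicial complex to a CW complex -/

section CellularGluing

open Topology

variable {X : Type u} [Fintype X]

/-- A map from the realization of a simplicial complex to a CW complex is cellular if it maps every
point to the skeleton of the dimension of the smallest face which contains the point. -/
def IsCellular {K : PreAbstractSimplicialComplex X} {Y : Type u} [TopologicalSpace Y] [T2Space Y]
    [CWComplex (univ : Set Y)] (g : C(realization K, Y)) : Prop :=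
  ∀ p : realization K, g p ∈ CWComplex.skeletonLT (univ : Set Y) ((supp (p : X → ℝ)).card : ℕ∞)

/-- If a CW complex `Y` is glued to `|K|` along a cellular map `|L| → Y` on a subcomplex, then the
faces of `K` which are not in `L` are attached as cells. -/
lemma IsGluing.exists_CWComplex {K L : PreAbstractSimplicialComplex X} {hLK : L ≤ K}
    {Y Y' : Type u} [TopologicalSpace Y] [TopologicalSpace Y'] [T2Space Y] [T2Space Y']
    [CWComplex (univ : Set Y)] [RelCWComplex.Finite (univ : Set Y)] {h : C(realization L, Y)}
    (hh : IsCellular h) {j : C(Y, Y')} {k : C(realization K, Y')}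
    (G : IsGluing h (realizationIncl hLK) j k) :
    ∃ _ : CWComplex (univ : Set Y'), RelCWComplex.Finite (univ : Set Y') ∧ IsCellular k := by
  classical
  let α : ℕ → Type u := fun n => {s : Finset X // s ∈ K ∧ s ∉ L ∧ s.card = n + 1}
  have hα : ∀ᶠ n in Filter.atTop, IsEmpty (α n) := by
    filter_upwards [Filter.eventually_ge_atTop (Fintype.card X)] with n hn
    refine ⟨fun s => ?_⟩
    have := s.2.2.2
    have := Finset.card_le_univ s.1
    omega
  choose Φ hΦc hΦi hΦb hΦs hΦf using fun n (a : α n) => exists_characteristicMap a.1 a.2.2.2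
  have hmem : ∀ n (a : α n), ∀ z ∈ closedBall 0 1, Φ n a z ∈ realization K := by
    intro n a z hz
    rcases (mem_closedBall.1 hz).lt_or_eq with hlt | heq
    · obtain ⟨h1, h2⟩ := hΦb n a z (mem_ball.2 hlt)
      exact mem_realization.2 ⟨h1, h2 ▸ a.2.1⟩
    · obtain ⟨h1, h2⟩ := hΦf n a z (mem_sphere.2 heq)
      exact mem_realization.2 ⟨h1, mem_of_subset a.2.1 h2.subset (supp_nonempty h1)⟩
  -- outside of the closed cube the characteristic maps are irrelevant
  let Ψ : ∀ n, α n → (Fin n → ℝ) → realization K := fun n a z =>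
    if hz : z ∈ closedBall 0 1 then ⟨Φ n a z, hmem n a z hz⟩
    else ⟨Φ n a 0, hmem n a 0 (mem_closedBall_self zero_le_one)⟩
  have hΨ : ∀ n a, ∀ z ∈ closedBall 0 1, (Ψ n a z : X → ℝ) = Φ n a z := by
    intro n a z hz
    simp only [Ψ, hz, dite_true]
  have hΨc : ∀ n a, ContinuousOn (Ψ n a) (closedBall 0 1) := fun n a => by
    rw [Topology.IsInducing.subtypeVal.continuousOn_iff]
    exact (hΦc n a).continuousOn.congr fun z hz => hΨ n a z hz
  have hball : ∀ n (a : α n), ∀ z ∈ ball 0 1, supp (Ψ n a z : X → ℝ) = a.1 := by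
    intro n a z hz
    rw [hΨ n a z (ball_subset_closedBall hz)]
    exact (hΦb n a z hz).2
  have hrange : ∀ p : realization K, p ∈ range (realizationIncl hLK) ↔ supp (p : X → ℝ) ∈ L := by
    intro p
    rw [mem_range_realizationIncl, mem_realization]
    exact and_iff_right p.2.1
  have hsurj : ∀ p : realization K, supp (p : X → ℝ) ∉ L →
      ∃ n, ∃ a : α n, a.1 = supp (p : X → ℝ) ∧ ∃ z ∈ ball 0 1, Ψ n a z = p := by
    intro p hp
    obtain ⟨hp1, hp2⟩ := mem_realization.1 p.2
    obtain ⟨n, hn⟩ := Nat.exists_eq_add_one_of_ne_zero (supp_nonempty hp1).card_pos.ne'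
    let a : α n := ⟨supp (p : X → ℝ), hp2, hp, hn⟩
    obtain ⟨z, hz, hzp⟩ := hΦs n a p hp1 rfl
    exact ⟨n, a, rfl, z, hz, Subtype.ext ((hΨ n a z (ball_subset_closedBall hz)).trans hzp)⟩
  have hnot : ∀ n (a : α n), ∀ z ∈ ball 0 1, Ψ n a z ∉ range (realizationIncl hLK) := by
    intro n a z hz
    rw [hrange, hball n a z hz]
    exact a.2.2.1
  have c1 : ∀ n (a : α n), ∀ z ∈ closedBall 0 1, ∀ z' ∈ ball 0 1,
      k (Ψ n a z) = k (Ψ n a z') → z = z' := by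
    intro n a z hz z' hz' hzz
    have h := G.eq_of_notMem _ _ (hnot n a z' hz') hzz.symm
    refine hΦi n a ?_
    rw [← hΨ n a z hz, ← hΨ n a z' (ball_subset_closedBall hz'), h]
  have c2 : ∀ n (a : α n), ∀ z ∈ ball 0 1, k (Ψ n a z) ∉ range j := by
    rintro n a z hz ⟨y, hy⟩
    exact hnot n a z hz (G.mem_range y _ hy)
  have c3 : ∀ n (a : α n) m (b : α m), ∀ z ∈ ball 0 1, ∀ z' ∈ ball 0 1,
      k (Ψ n a z) = k (Ψ m b z') → (⟨n, a⟩ : Σ n, α n) = ⟨m, b⟩ := by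
    intro n a m b z hz z' hz' hzz
    have h := G.eq_of_notMem _ _ (hnot n a z hz) hzz
    have hab : a.1 = b.1 := by rw [← hball n a z hz, ← hball m b z' hz', h]
    obtain ⟨s, hs1, hs2, hs3⟩ := a
    obtain ⟨s', hs1', hs2', hs3'⟩ := b
    obtain rfl : s = s' := hab
    obtain rfl : n = m := by omega
    rfl
  have c4 : ∀ (n : ℕ) (a : α n), ∀ z ∈ sphere 0 1,
      (∃ y ∈ CWComplex.skeletonLT (univ : Set Y) (n : ℕ∞), j y = k (Ψ n a z)) ∨
        ∃ m < n, ∃ b, k (Ψ n a z) ∈ (fun z => k (Ψ m b z)) '' closedBall 0 1 := by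
    intro n a z hz
    obtain ⟨-, hlt⟩ := hΦf n a z hz
    rw [← hΨ n a z (sphere_subset_closedBall hz)] at hlt
    have hcard := Finset.card_lt_card hlt
    have ha := a.2.2.2
    by_cases hp : supp (Ψ n a z : X → ℝ) ∈ L
    · obtain ⟨q, hq⟩ := (hrange _).2 hp
      refine Or.inl ⟨h q, ?_, ?_⟩
      · refine CWComplex.skeletonLT_mono ?_ (hh q)
        have : supp (q : X → ℝ) = supp (Ψ n a z : X → ℝ) := by rw [← hq]; rfl
        rw [this]
        exact_mod_cast (by omega)
      · rw [← G.comm, hq]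
    · obtain ⟨m, b, hb, z', hz', hzz⟩ := hsurj _ hp
      have := b.2.2.2
      refine Or.inr ⟨m, by rw [← hb] at hcard; omega, b, z', ball_subset_closedBall hz', ?_⟩
      exact congrArg k hzz
  have c5 : ∀ y', y' ∈ range j ∨ ∃ n a, y' ∈ (fun z => k (Ψ n a z)) '' closedBall 0 1 := by
    intro y'
    rcases G.exists_eq y' with ⟨y, rfl⟩ | ⟨p, rfl⟩
    · exact Or.inl ⟨y, rfl⟩
    · by_cases hp : supp (p : X → ℝ) ∈ L
      · obtain ⟨q, rfl⟩ := (hrange p).2 hp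
        exact Or.inl ⟨h q, (G.comm q).symm⟩
      · obtain ⟨n, a, -, z, hz, rfl⟩ := hsurj p hp
        exact Or.inr ⟨n, a, z, ball_subset_closedBall hz, rfl⟩
  obtain ⟨C, hfin, h1, h2⟩ := exists_CWComplex_of_cells j G.injective α hα
    (fun n a z => k (Ψ n a z)) (fun n a => k.continuous.comp_continuousOn (hΨc n a)) c1 c2 c3 c4 c5
  refine ⟨C, hfin, fun p => ?_⟩
  by_cases hp : supp (p : X → ℝ) ∈ L
  · obtain ⟨q, rfl⟩ := (hrange p).2 hp
    rw [G.comm]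
    exact h1 _ _ (hh q)
  · obtain ⟨n, a, ha, z, hz, rfl⟩ := hsurj p hp
    rw [hball n a z hz, a.2.2.2]
    exact h2 n a z (ball_subset_closedBall hz)

end CellularGluing

/-! ### Cellular approximation -/

section PushOut

variable {Q Y : Type*} [TopologicalSpace Q] [TopologicalSpace Y] [T2Space Y] {m : ℕ}

/-- Radial stretching of the unit cube, fixing its boundary. -/
noncomputable def stretch (c : ℝ) (z : Fin m → ℝ) : Fin m → ℝ := (c / max 1 (c * ‖z‖)) • z

lemma continuous_stretch : Continuous fun p : ℝ × (Fin m → ℝ) => stretch p.1 p.2 := by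
  unfold stretch
  refine Continuous.smul (Continuous.div continuous_fst
    (continuous_const.max (continuous_fst.mul continuous_snd.norm)) fun p => ?_) continuous_snd
  exact (lt_of_lt_of_le one_pos (le_max_left _ _)).ne'

lemma stretch_one {z : Fin m → ℝ} (hz : ‖z‖ ≤ 1) : stretch 1 z = z := by
  simp [stretch, max_eq_left hz]

lemma norm_stretch {c : ℝ} (hc : 0 ≤ c) (z : Fin m → ℝ) :
    ‖stretch c z‖ = c * ‖z‖ / max 1 (c * ‖z‖) := by
  have h : (0 : ℝ) < max 1 (c * ‖z‖) := lt_of_lt_of_le one_pos (le_max_left _ _)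
  rw [stretch, norm_smul, Real.norm_of_nonneg (div_nonneg hc h.le), div_mul_eq_mul_div]

lemma norm_stretch_le {c : ℝ} (hc : 0 ≤ c) (z : Fin m → ℝ) : ‖stretch c z‖ ≤ 1 := by
  rw [norm_stretch hc]
  exact div_le_one_of_le₀ (le_max_right _ _) (zero_le_one.trans (le_max_left _ _))

lemma norm_stretch_of_le {c : ℝ} {z : Fin m → ℝ} (h : 1 ≤ c * ‖z‖) (hc : 0 ≤ c) :
    ‖stretch c z‖ = 1 := by
  rw [norm_stretch hc, max_eq_right h, div_self (by linarith)]

lemma stretch_of_norm_eq_one {c : ℝ} {z : Fin m → ℝ} (hc : 1 ≤ c) (hz : ‖z‖ = 1) :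
    stretch c z = z := by
  rw [stretch, hz, mul_one, max_eq_right hc, div_self (by linarith), one_smul]

/-- A map which misses a neighbourhood of the centre of a cell can be pushed out of the cell. -/
lemma exists_push_out {T : Set Y} (hT : IsClosed T) {Φ : (Fin m → ℝ) → Y}
    (hΦ : ContinuousOn Φ (closedBall 0 1))
    (hinj : ∀ z ∈ closedBall 0 1, ∀ z' ∈ ball 0 1, Φ z = Φ z' → z = z')
    (hsph : MapsTo Φ (sphere 0 1) T) (hdisj : ∀ z ∈ ball 0 1, Φ z ∉ T)
    (q : C(Q, Y)) (hq : ∀ p, q p ∈ T ∨ q p ∈ Φ '' ball 0 1) {ε : ℝ} (hε : 0 < ε)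
    (hqε : ∀ p, q p ∉ Φ '' ball 0 ε) :
    ∃ q' : C(Q, Y), q.HomotopicRel q' {p | q p ∈ T} ∧ ∀ p, q' p ∈ T := by
  let C : Set (Fin m → ℝ) := closedBall 0 1
  have hCc : CompactSpace C := isCompact_iff_compactSpace.1 (isCompact_closedBall _ _)
  have hcb : ∀ {z : Fin m → ℝ}, ‖z‖ ≤ 1 → z ∈ C := fun h => mem_closedBall_zero_iff.2 h
  -- the stretching factor at time `t`
  let c : I → ℝ := fun t => 1 + t / ε
  have hc1 : ∀ t, 1 ≤ c t := fun t => by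
    have := div_nonneg t.2.1 hε.le
    simp only [c]
    linarith
  have hc0 : ∀ t, 0 ≤ c t := fun t => zero_le_one.trans (hc1 t)
  let π : C(I × C, I × (Φ '' C)) :=
    ⟨fun p => (p.1, ⟨Φ p.2, mem_image_of_mem Φ p.2.2⟩), by
      refine Continuous.prodMk continuous_fst (Continuous.subtype_mk ?_ _)
      exact (continuousOn_iff_continuous_domRestrict.1 hΦ).comp continuous_snd⟩
  have hπs : Function.Surjective π := by
    rintro ⟨t, _, z, hz, rfl⟩
    exact ⟨(t, ⟨z, hz⟩), rfl⟩
  have hπ : Topology.IsQuotientMap π :=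
    π.continuous.isClosedMap.isQuotientMap π.continuous hπs
  let Λ : C(I × C, Y) := ⟨fun p => Φ (stretch (c p.1) p.2), by
    refine hΦ.comp_continuous ?_ fun p => hcb (norm_stretch_le (hc0 _) _)
    exact continuous_stretch.comp (Continuous.prodMk (by fun_prop) (by fun_prop))⟩
  have hfac : Function.FactorsThrough Λ π := by
    rintro ⟨t, z, hz⟩ ⟨t', z', hz'⟩ h
    obtain rfl : t = t' := congrArg Prod.fst h
    have hΦz : Φ z = Φ z' := congrArg (fun x => (x.2 : Y)) h
    simp only [Λ, ContinuousMap.coe_mk]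
    rcases (mem_closedBall_zero_iff.1 hz').lt_or_eq with hlt | heq
    · rw [hinj z hz z' (mem_ball_zero_iff.2 hlt) hΦz]
    · rcases (mem_closedBall_zero_iff.1 hz).lt_or_eq with hlt' | heq'
      · rw [hinj z' hz' z (mem_ball_zero_iff.2 hlt') hΦz.symm]
      · rw [stretch_of_norm_eq_one (hc1 t) heq, stretch_of_norm_eq_one (hc1 t) heq', hΦz]
  have hΛ : ∀ t z (hz : z ∈ C), hπ.lift Λ hfac (t, ⟨Φ z, mem_image_of_mem Φ hz⟩) =
      Φ (stretch (c t) z) := fun t z hz => by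
    have h := DFunLike.congr_fun (hπ.lift_comp Λ hfac) ((t, ⟨z, hz⟩) : I × C)
    rw [ContinuousMap.comp_apply] at h
    exact h
  have hclosed : IsClosed (Φ '' C) := ((isCompact_closedBall _ _).image_of_continuousOn hΦ).isClosed
  obtain ⟨H, H1, H2⟩ := exists_continuousMap_of_isClosed_cover (T := Y)
    (S₁ := {p : I × Q | q p.2 ∈ T}) (S₂ := {p : I × Q | q p.2 ∈ Φ '' C})
    (hT.preimage (by fun_prop)) (hclosed.preimage (by fun_prop))
    (fun p => (hq p.2).imp id fun h => image_mono ball_subset_closedBall h)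
    ⟨fun p => q p.1.2, by fun_prop⟩
    ⟨fun p => hπ.lift Λ hfac (p.1.1, ⟨q p.1.2, p.2⟩), by
      refine (hπ.lift Λ hfac).continuous.comp (Continuous.prodMk (by fun_prop) ?_)
      exact Continuous.subtype_mk (by fun_prop) _⟩ (by
      rintro ⟨t, p⟩ hp1 ⟨z, hz, hzp⟩
      simp only [ContinuousMap.coe_mk]
      have hz1 : ‖z‖ = 1 := by
        refine (mem_closedBall_zero_iff.1 hz).eq_of_not_lt fun hlt => ?_
        exact hdisj z (mem_ball_zero_iff.2 hlt) (hzp ▸ hp1)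
      have := hΛ t z hz
      simp only [hzp] at this
      rw [this, stretch_of_norm_eq_one (hc1 t) hz1, hzp])
  have hH : ∀ t p z, z ∈ C → Φ z = q p → H (t, p) = Φ (stretch (c t) z) := by
    intro t p z hz hzp
    rw [H2 (t, p) ⟨z, hz, hzp⟩, ← hΛ t z hz]
    simp only [ContinuousMap.coe_mk, hzp]
  refine ⟨H.comp ⟨fun p => (1, p), by fun_prop⟩, ⟨⟨⟨H, fun p => ?_, fun p => rfl⟩, ?_⟩⟩, fun p => ?_⟩
  · rcases hq p with hp | ⟨z, hz, hzp⟩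
    · exact H1 (0, p) hp
    · have hz' := ball_subset_closedBall hz
      refine (hH 0 p z hz' hzp).trans ?_
      have : c 0 = 1 := by simp [c]
      rw [this, stretch_one (mem_closedBall_zero_iff.1 hz'), hzp]
  · intro t p hp
    exact H1 (t, p) hp
  · rcases hq p with hp | ⟨z, hz, hzp⟩
    · exact (H1 (1, p) hp).symm ▸ hp
    · have : H (1, p) = Φ (stretch (c 1) z) := hH 1 p z (ball_subset_closedBall hz) hzp
      change H (1, p) ∈ T
      rw [this]
      refine hsph (mem_sphere_zero_iff_norm.2 (norm_stretch_of_le ?_ (hc0 1)))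
      have hzε : ε ≤ ‖z‖ := by
        by_contra! hlt
        exact hqε p ⟨z, mem_ball_zero_iff.2 hlt, hzp⟩
      calc (1 : ℝ) = 1 / ε * ε := by field_simp
        _ ≤ c 1 * ‖z‖ := by
          refine mul_le_mul ?_ hzε hε.le (hc0 1)
          simp [c]

end PushOut

section Approximation

variable {X : Type u} [Fintype X]

lemma contDiff_faceParam {s : Finset X} {n : ℕ} (e : s ≃ Fin (n + 1)) :
    ContDiff ℝ 1 (faceParam e) := by
  refine contDiff_pi.2 fun v => ?_
  by_cases hv : v ∈ s
  · simp only [faceParam, hv, dite_true]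
    generalize e ⟨v, hv⟩ = i
    refine Fin.cases ?_ (fun i => ?_) i
    · simp only [Fin.cons_zero]
      fun_prop
    · simp only [Fin.cons_succ]
      fun_prop
  · simp only [faceParam, hv, dite_false]
    exact contDiff_const

/-- The image of a simplicial complex of dimension less than `m` under a smooth map to `ℝᵐ` has
Hausdorff dimension less than `m`. -/
lemma dense_compl_image_realization {L : PreAbstractSimplicialComplex X} {m : ℕ}
    (hL : ∀ s ∈ L, s.card ≤ m) {g : (X → ℝ) → Fin m → ℝ} (hg : ContDiff ℝ 1 g) :
    Dense (g '' realization L)ᶜ := by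
  by_cases hne : L.faces.Nonempty
  · obtain ⟨s₀, hs₀⟩ := hne
    have hm : 0 < m := (nonempty_of_mem (K := L) hs₀).card_pos.trans_le (hL s₀ hs₀)
    refine dense_compl_of_dimH_lt_finrank ?_
    have himg : g '' realization L = ⋃ s ∈ L.faces, g '' face s := by
      rw [← image_iUnion₂]
      congr 1
      ext p
      simp only [mem_realization_iff_face, mem_iUnion, exists_prop]
      rfl
    rw [himg, dimH_bUnion (Set.toFinite L.faces).countable]
    have hle : ∀ s ∈ L.faces, dimH (g '' face s) ≤ ((m - 1 : ℕ) : ENNReal) := by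
      intro s hs
      obtain ⟨n, hn⟩ := Nat.exists_eq_add_one_of_ne_zero
        (nonempty_of_mem (K := L) hs).card_pos.ne'
      have hsm := hL s hs
      let e : s ≃ Fin (n + 1) := s.equivFinOfCardEq hn
      have hsub : g '' face s ⊆ range (g ∘ faceParam e) := by
        rintro _ ⟨p, hp, rfl⟩
        exact ⟨_, congrArg g (faceParam_of_supp_subset e hp.1.2 hp.2)⟩
      refine (dimH_mono hsub).trans ((hg.comp (contDiff_faceParam e)).dimH_range_le.trans ?_)
      rw [Module.finrank_fin_fun]
      exact_mod_cast (by omega)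
    refine (iSup₂_le hle).trans_lt ?_
    rw [Module.finrank_fin_fun]
    exact_mod_cast (by omega)
  · have : realization L = ∅ := by
      ext p
      rw [mem_realization]
      simp only [mem_empty_iff_false, iff_false, not_and]
      exact fun _ hs => hne ⟨_, hs⟩
    simp [this]

/-- A map to `ℝᵐ` which is continuous on a closed part `S` of the realization of a complex of
dimension less than `m` can be approximated on `S` by a map without zeros. -/
lemma exists_approx_ne_zero {L : PreAbstractSimplicialComplex X} {m : ℕ}
    (hL : ∀ s ∈ L, s.card ≤ m) {S : Set (realization L)} (hS : IsClosed S)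
    {ψ : realization L → Fin m → ℝ} (hψ : ContinuousOn ψ S) {δ : ℝ} (hδ : 0 < δ) :
    ∃ η : C(realization L, Fin m → ℝ), (∀ p ∈ S, dist (η p) (ψ p) < δ) ∧ ∀ p, η p ≠ 0 := by
  classical
  let S' : Set (X → ℝ) := Subtype.val '' S
  have hS' : IsClosed S' :=
    (isCompact_realization L).isClosed.isClosedEmbedding_subtypeVal.isClosedMap S hS
  let ψ' : (X → ℝ) → Fin m → ℝ := fun x => if hx : x ∈ realization L then ψ ⟨x, hx⟩ else 0
  have hψ' : ∀ p : realization L, ψ' p = ψ p := fun p => dif_pos p.2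
  let t : (X → ℝ) → Set (Fin m → ℝ) := fun x => if x ∈ S' then ball (ψ' x) (δ / 2) else univ
  obtain ⟨g, hg⟩ := exists_contMDiffMap_forall_mem_convex_of_local_const (n := 1)
    (modelWithCornersSelf ℝ (X → ℝ)) (t := t) (fun x => by
      simp only [t]
      split_ifs
      exacts [convex_ball _ _, convex_univ]) (fun x => by
      by_cases hx : x ∈ S'
      · obtain ⟨p, hp, rfl⟩ := hx
        refine ⟨ψ p, ?_⟩
        have hc : ∀ᶠ y in nhdsWithin p S, dist (ψ y) (ψ p) < δ / 2 :=
          hψ p hp (ball_mem_nhds _ (half_pos hδ))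
        rw [eventually_nhdsWithin_iff, Filter.Eventually, nhds_subtype_eq_comap,
          Filter.mem_comap] at hc
        obtain ⟨V, hV, hVsub⟩ := hc
        filter_upwards [hV] with y hy
        simp only [t]
        split_ifs with hyS
        · obtain ⟨y, hyS, rfl⟩ := hyS
          rw [hψ', mem_ball, dist_comm]
          exact hVsub hy hyS
        · trivial
      · refine ⟨0, ?_⟩
        filter_upwards [hS'.isOpen_compl.mem_nhds hx] with y hy
        simp only [t]
        rw [if_neg hy]
        trivial)
  have hgc : ContDiff ℝ 1 g := g.contMDiff.contDiff
  obtain ⟨a, ha, hag⟩ := (dense_compl_image_realization hL hgc).exists_dist_lt 0 (half_pos hδ)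
  refine ⟨⟨fun p => g p - a, ?_⟩, fun p hp => ?_, fun p h => ?_⟩
  · exact (hgc.continuous.comp continuous_subtype_val).sub continuous_const
  · have h1 := hg p
    have hpS : (p : X → ℝ) ∈ S' := ⟨p, hp, rfl⟩
    simp only [t] at h1
    rw [if_pos hpS, mem_ball, hψ', dist_eq_norm] at h1
    rw [dist_zero_left] at hag
    rw [dist_eq_norm]
    calc ‖g p - a - ψ p‖ = ‖(g p - ψ p) - a‖ := by congr 1; abel
      _ ≤ ‖g p - ψ p‖ + ‖a‖ := norm_sub_le _ _
      _ < δ := by linarith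
  · exact ha ⟨p, p.2, sub_eq_zero.1 h⟩

end Approximation

section CellularApproximation

variable {X : Type u} [Fintype X]

/-- A map from a complex of dimension less than `m` can be deformed inside of an `m`-cell so that
it misses a neighbourhood of the centre of the cell. -/
lemma exists_miss_center {L : PreAbstractSimplicialComplex X} {m : ℕ}
    (hL : ∀ s ∈ L, s.card ≤ m) {Y : Type*} [TopologicalSpace Y] [T2Space Y] {T : Set Y}
    (hT : IsClosed T) {Φ : (Fin m → ℝ) → Y} (hΦ : ContinuousOn Φ (closedBall 0 1))
    {g : Y → Fin m → ℝ} (hg : ContinuousOn g (Φ '' ball 0 1)) (hgΦ : ∀ z ∈ ball 0 1, g (Φ z) = z)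
    (hinj : ∀ z ∈ closedBall 0 1, ∀ z' ∈ ball 0 1, Φ z = Φ z' → z = z')
    (hdisj : ∀ z ∈ ball 0 1, Φ z ∉ T) (q : C(realization L, Y))
    (hq : ∀ p, q p ∈ T ∨ q p ∈ Φ '' ball 0 1) :
    ∃ q' : C(realization L, Y), q.HomotopicRel q' {p | q p ∈ T} ∧
      (∀ p, q' p ∈ T ∨ q' p ∈ Φ '' ball 0 1) ∧ ∃ ε > 0, ∀ p, q' p ∉ Φ '' ball 0 ε := by
  have hsub : closedBall (0 : Fin m → ℝ) (1 / 2) ⊆ ball 0 1 := closedBall_subset_ball (by norm_num)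
  let S₂ : Set (realization L) := {p | q p ∈ Φ '' closedBall 0 (1 / 2)}
  let S₁ : Set (realization L) := {p | q p ∈ T ∪ Φ '' (closedBall 0 1 \ ball 0 (1 / 2))}
  have hS₂ : IsClosed S₂ := by
    refine IsClosed.preimage q.continuous ?_
    exact ((isCompact_closedBall _ _).image_of_continuousOn
      (hΦ.mono (hsub.trans ball_subset_closedBall))).isClosed
  have hS₁ : IsClosed S₁ := by
    refine IsClosed.preimage q.continuous (hT.union ?_)
    exact (((isCompact_closedBall _ _).diff isOpen_ball).image_of_continuousOn
      (hΦ.mono sdiff_subset)).isClosed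
  have hcov : ∀ p, p ∈ S₁ ∨ p ∈ S₂ := by
    intro p
    rcases hq p with h | ⟨z, hz, h⟩
    · exact Or.inl (Or.inl h)
    · by_cases hz' : z ∈ ball (0 : Fin m → ℝ) (1 / 2)
      · exact Or.inr ⟨z, ball_subset_closedBall hz', h⟩
      · exact Or.inl (Or.inr ⟨z, ⟨ball_subset_closedBall hz, hz'⟩, h⟩)
  let ψ : realization L → Fin m → ℝ := fun p => g (q p)
  have hΦψ : ∀ p ∈ S₂, Φ (ψ p) = q p ∧ ‖ψ p‖ ≤ 1 / 2 := by
    rintro p ⟨z, hz, h⟩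
    have : ψ p = z := by
      simp only [ψ]
      rw [← h, hgΦ z (hsub hz)]
    exact ⟨by rw [this, h], by rw [this]; exact mem_closedBall_zero_iff.1 hz⟩
  have hψ : ContinuousOn ψ S₂ := by
    refine hg.comp q.continuous.continuousOn fun p hp => ?_
    exact image_mono hsub hp
  have hψ12 : ∀ p, p ∈ S₁ → p ∈ S₂ → ‖ψ p‖ = 1 / 2 := by
    intro p h1 h2
    obtain ⟨hp1, hp2⟩ := hΦψ p h2
    have hb : ψ p ∈ ball (0 : Fin m → ℝ) 1 := mem_ball_zero_iff.2 (by linarith)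
    rcases h1 with h1 | ⟨z, ⟨hz, hz'⟩, h⟩
    · exact absurd (hp1 ▸ h1) (hdisj _ hb)
    · have hzψ := hinj z hz _ hb (h.trans hp1.symm)
      rw [hzψ, mem_ball_zero_iff, not_lt] at hz'
      exact hp2.antisymm hz'
  obtain ⟨η, hη, hη0⟩ := exists_approx_ne_zero hL hS₂ hψ (δ := 1 / 8) (by norm_num)
  -- a cut-off function: `1` near to the centre of the cell, and `0` outside of the cube of radius
  -- `1 / 2`
  let χ : ℝ → ℝ := fun r => max 0 (min 1 (2 - 4 * r))
  have hχ : Continuous χ := by fun_prop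
  have hχ0 : ∀ r, 0 ≤ χ r := fun r => le_max_left _ _
  have hχ1 : ∀ r, χ r ≤ 1 := fun r => max_le zero_le_one (min_le_left _ _)
  have hχh : χ (1 / 2) = 0 := by norm_num [χ]
  have hχq : ∀ r ≤ 1 / 4, χ r = 1 := fun r hr => by
    simp only [χ]
    rw [min_eq_left (by linarith), max_eq_right zero_le_one]
  let w : I × realization L → Fin m → ℝ := fun p => ψ p.2 + (p.1 * χ ‖ψ p.2‖) • (η p.2 - ψ p.2)
  have hwd : ∀ t, ∀ p ∈ S₂, ‖w (t, p) - ψ p‖ < 1 / 8 := by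
    intro t p hp
    have h1 := hη p hp
    rw [dist_eq_norm] at h1
    have h2 : (t : ℝ) * χ ‖ψ p‖ ≤ 1 := mul_le_one₀ t.2.2 (hχ0 _) (hχ1 _)
    have h3 : 0 ≤ (t : ℝ) * χ ‖ψ p‖ := mul_nonneg t.2.1 (hχ0 _)
    simp only [w, add_sub_cancel_left]
    rw [norm_smul, Real.norm_of_nonneg h3]
    exact (mul_le_of_le_one_left (norm_nonneg _) h2).trans_lt h1
  have hwb : ∀ t, ∀ p ∈ S₂, w (t, p) ∈ ball (0 : Fin m → ℝ) 1 := by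
    intro t p hp
    rw [mem_ball_zero_iff]
    have h1 := hwd t p hp
    have h2 := (hΦψ p hp).2
    have h3 := norm_add_le (w (t, p) - ψ p) (ψ p)
    rw [sub_add_cancel] at h3
    linarith
  have hw0 : ∀ p ∈ S₂, w (1, p) ≠ 0 := by
    intro p hp h0
    rcases le_or_gt ‖ψ p‖ (1 / 4) with h | h
    · have hw1 : w (1, p) = η p := by
        simp only [w, Icc.coe_one, one_mul]
        rw [hχq _ h, one_smul, add_sub_cancel]
      exact hη0 p (hw1.symm.trans h0)
    · have h1 := hwd 1 p hp
      rw [h0, zero_sub, norm_neg] at h1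
      linarith
  have hwc : ContinuousOn w {p | p.2 ∈ S₂} := by
    have hψ' : ContinuousOn (fun p : I × realization L => ψ p.2) {p | p.2 ∈ S₂} :=
      hψ.comp continuous_snd.continuousOn fun p hp => hp
    have h1 : ContinuousOn (fun p : I × realization L => (p.1 : ℝ) * χ ‖ψ p.2‖) {p | p.2 ∈ S₂} :=
      ContinuousOn.mul (continuous_subtype_val.comp continuous_fst).continuousOn
        (hχ.comp_continuousOn hψ'.norm)
    have h2 : ContinuousOn (fun p : I × realization L => η p.2 - ψ p.2) {p | p.2 ∈ S₂} :=
      (η.continuous.comp continuous_snd).continuousOn.sub hψ'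
    exact hψ'.add (h1.smul h2)
  obtain ⟨H, H1, H2⟩ := exists_continuousMap_of_isClosed_cover (T := Y)
    (S₁ := {p : I × realization L | p.2 ∈ S₁}) (S₂ := {p : I × realization L | p.2 ∈ S₂})
    (hS₁.preimage continuous_snd) (hS₂.preimage continuous_snd) (fun p => hcov p.2)
    ⟨fun p => q p.1.2, by fun_prop⟩
    ⟨fun p => Φ (w p.1), by
      refine hΦ.comp_continuous (continuousOn_iff_continuous_domRestrict.1 hwc) fun p => ?_
      exact ball_subset_closedBall (hwb p.1.1 p.1.2 p.2)⟩ (by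
      rintro ⟨t, p⟩ h1 h2
      have hw : w (t, p) = ψ p := by
        simp only [w]
        rw [hψ12 p h1 h2, hχh, mul_zero, zero_smul, add_zero]
      simp only [ContinuousMap.coe_mk, hw]
      exact (hΦψ p h2).1.symm)
  refine ⟨H.comp ⟨fun p => (1, p), by fun_prop⟩, ⟨⟨⟨H, fun p => ?_, fun p => rfl⟩, ?_⟩⟩,
    fun p => ?_, ?_⟩
  · rcases hcov p with hp | hp
    · exact H1 (0, p) hp
    · refine (H2 (0, p) hp).trans ?_
      have hw : w (0, p) = ψ p := by simp [w]
      simp only [ContinuousMap.coe_mk, hw]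
      exact (hΦψ p hp).1
  · intro t p hp
    exact H1 (t, p) (Or.inl hp)
  · rcases hcov p with hp | hp
    · have : H (1, p) = q p := H1 (1, p) hp
      change H (1, p) ∈ T ∨ H (1, p) ∈ _
      rw [this]
      exact hq p
    · exact Or.inr ⟨w (1, p), hwb 1 p hp, (H2 (1, p) hp).symm⟩
  · have hcomp : IsCompact ((fun p => w (1, p)) '' S₂) := by
      refine hS₂.isCompact.image_of_continuousOn ?_
      exact hwc.comp (by fun_prop) fun p hp => hp
    have hnhds : ((fun p => w (1, p)) '' S₂)ᶜ ∈ nhds (0 : Fin m → ℝ) := by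
      refine hcomp.isClosed.isOpen_compl.mem_nhds ?_
      rintro ⟨p, hp, h⟩
      exact hw0 p hp h
    obtain ⟨ε, hε, hball⟩ := Metric.mem_nhds_iff.1 hnhds
    refine ⟨min ε (1 / 2), by positivity, ?_⟩
    rintro p ⟨z, hz, h⟩
    have hzε : z ∈ ball (0 : Fin m → ℝ) ε := ball_subset_ball (min_le_left _ _) hz
    have hzh : z ∈ ball (0 : Fin m → ℝ) (1 / 2) := ball_subset_ball (min_le_right _ _) hz
    have hz1 : z ∈ ball (0 : Fin m → ℝ) 1 := hsub (ball_subset_closedBall hzh)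
    change Φ z = H (1, p) at h
    rcases hcov p with hp | hp
    · rw [H1 (1, p) hp] at h
      rcases hp with hp | ⟨z', ⟨hz', hzn⟩, h'⟩
      · exact hdisj z hz1 (h ▸ hp)
      · rw [hinj z' hz' z hz1 (h'.trans h.symm)] at hzn
        exact hzn hzh
    · rw [H2 (1, p) hp] at h
      have hzw := hinj _ (ball_subset_closedBall (hwb 1 p hp)) z hz1 h.symm
      exact hball hzε ⟨p, hp, hzw⟩

open Topology

variable {Y : Type u} [TopologicalSpace Y] [T2Space Y] [CWComplex (univ : Set Y)]

/-- A map from a complex of dimension less than `m` can be pushed out of an `m`-cell. -/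
lemma exists_avoid_cell {L : PreAbstractSimplicialComplex X} {m : ℕ}
    (hL : ∀ s ∈ L, s.card ≤ m) (e : RelCWComplex.cell (univ : Set Y) m) {T : Set Y}
    (hT : IsClosed T) (hfr : RelCWComplex.cellFrontier m e ⊆ T)
    (hdisj : Disjoint T (RelCWComplex.openCell m e)) (q : C(realization L, Y))
    (hq : ∀ p, q p ∈ T ∪ RelCWComplex.openCell m e) {S : Set (realization L)}
    (hS : ∀ p ∈ S, q p ∈ T) :
    ∃ q' : C(realization L, Y), q.HomotopicRel q' S ∧ ∀ p, q' p ∈ T := by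
  have hd : ∀ z ∈ ball 0 1, RelCWComplex.map m e z ∉ T := fun z hz h =>
    disjoint_left.1 hdisj h ⟨z, hz, rfl⟩
  have hinj : ∀ z ∈ closedBall 0 1, ∀ z' ∈ ball 0 1,
      RelCWComplex.map m e z = RelCWComplex.map m e z' → z = z' := by
    intro z hz z' hz' h
    rcases (mem_closedBall.1 hz).lt_or_eq with hlt | heq
    · refine (RelCWComplex.map m e).injOn ?_ ?_ h <;> rw [RelCWComplex.source_eq]
      exacts [mem_ball.2 hlt, hz']
    · exact absurd (h ▸ hfr ⟨z, mem_sphere.2 heq, rfl⟩) (hd z' hz')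
  have htar : (RelCWComplex.map m e).target = RelCWComplex.map m e '' ball 0 1 := by
    rw [← RelCWComplex.source_eq m e, PartialEquiv.image_source_eq_target]
  have hgc : ContinuousOn (RelCWComplex.map m e).symm (RelCWComplex.map m e '' ball 0 1) :=
    htar ▸ RelCWComplex.continuousOn_symm m e
  obtain ⟨q₁, hq₁, hq₁T, ε, hε, hqε⟩ := exists_miss_center hL hT
    (RelCWComplex.continuousOn m e) hgc
    (fun z hz => (RelCWComplex.map m e).left_inv (by rwa [RelCWComplex.source_eq])) hinj hd q hq
  obtain ⟨q₂, hq₂, hq₂T⟩ := exists_push_out hT (RelCWComplex.continuousOn m e) hinj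
    (fun z hz => hfr ⟨z, hz, rfl⟩) hd q₁ hq₁T hε hqε
  have hmono : ∀ {f g : C(realization L, Y)} {S S' : Set (realization L)}, S ⊆ S' →
      f.HomotopicRel g S' → f.HomotopicRel g S := fun hSS ⟨F⟩ =>
    ⟨⟨F.toHomotopy, fun t x hx => F.prop' t x (hSS hx)⟩⟩
  refine ⟨q₂, (hmono (fun p hp => hS p hp) hq₁).trans (hmono (fun p hp => ?_) hq₂), hq₂T⟩
  obtain ⟨F⟩ := hq₁
  have : q p = q₁ p := F.fst_eq_snd (hS p hp)
  change q₁ p ∈ T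
  rw [← this]
  exact hS p hp

/-- A map from a complex of dimension less than `m` to the `m`-skeleton can be pushed into the
`(m - 1)`-skeleton. -/
lemma exists_avoid_cells {L : PreAbstractSimplicialComplex X} {m : ℕ}
    [Finite (RelCWComplex.cell (univ : Set Y) m)]
    (hL : ∀ s ∈ L, s.card ≤ m) (q : C(realization L, Y))
    (hq : ∀ p, q p ∈ CWComplex.skeletonLT (univ : Set Y) ((m + 1 : ℕ) : ℕ∞))
    {S : Set (realization L)} (hS : ∀ p ∈ S, q p ∈ CWComplex.skeletonLT (univ : Set Y) (m : ℕ∞)) :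
    ∃ q' : C(realization L, Y), q.HomotopicRel q' S ∧
      ∀ p, q' p ∈ CWComplex.skeletonLT (univ : Set Y) (m : ℕ∞) := by
  classical
  let T : Finset (RelCWComplex.cell (univ : Set Y) m) → Set Y := fun J =>
    CWComplex.skeletonLT (univ : Set Y) (m : ℕ∞) ∪ ⋃ e ∈ J, RelCWComplex.closedCell m e
  have hTc : ∀ J, IsClosed (T J) := fun J =>
    (CWComplex.skeletonLT (univ : Set Y) (m : ℕ∞)).closed.union
      (isClosed_biUnion_finset fun e _ => RelCWComplex.isClosed_closedCell)
  have key : ∀ (J : Finset (RelCWComplex.cell (univ : Set Y) m)) (q : C(realization L, Y)),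
      (∀ p, q p ∈ T J) → (∀ p ∈ S, q p ∈ CWComplex.skeletonLT (univ : Set Y) (m : ℕ∞)) →
      ∃ q' : C(realization L, Y), q.HomotopicRel q' S ∧
        ∀ p, q' p ∈ CWComplex.skeletonLT (univ : Set Y) (m : ℕ∞) := by
    intro J
    induction J using Finset.induction_on with
    | empty =>
      intro q hq _
      exact ⟨q, .refl q, fun p => by simpa [T] using hq p⟩
    | insert e J he ih =>
      intro q hq hS
      have hfr : RelCWComplex.cellFrontier m e ⊆ T J :=
        (CWComplex.cellFrontier_subset_skeletonLT m e).trans subset_union_left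
      have hdisj : Disjoint (T J) (RelCWComplex.openCell m e) := by
        have h0 := CWComplex.disjoint_skeletonLT_openCell (C := (univ : Set Y)) (j := e)
          (n := (m : ℕ∞)) le_rfl
        refine disjoint_union_left.2 ⟨h0, ?_⟩
        simp only [disjoint_iUnion_left]
        intro e' he'
        rw [← RelCWComplex.cellFrontier_union_openCell_eq_closedCell, disjoint_union_left]
        refine ⟨h0.mono_left (CWComplex.cellFrontier_subset_skeletonLT m e'), ?_⟩
        refine RelCWComplex.disjoint_openCell_of_ne fun h => he ?_
        obtain rfl := eq_of_heq (Sigma.mk.inj h).2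
        exact he'
      obtain ⟨q₁, hq₁, hq₁T⟩ := exists_avoid_cell hL e (hTc J) hfr hdisj q (fun p => by
        rcases hq p with h | h
        · exact Or.inl (Or.inl h)
        · simp only [Finset.mem_insert, iUnion_iUnion_eq_or_left] at h
          rcases h with h | h
          · rw [← RelCWComplex.cellFrontier_union_openCell_eq_closedCell] at h
            exact h.imp (fun h => hfr h) id
          · exact Or.inl (Or.inr h)) (fun p hp => Or.inl (hS p hp))
      have heq : ∀ p ∈ S, q₁ p = q p := fun p hp => by
        obtain ⟨F⟩ := hq₁
        exact (F.fst_eq_snd hp).symm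
      obtain ⟨q₂, hq₂, hq₂T⟩ := ih q₁ hq₁T (fun p hp => heq p hp ▸ hS p hp)
      exact ⟨q₂, hq₁.trans hq₂, hq₂T⟩
  have := Fintype.ofFinite (RelCWComplex.cell (univ : Set Y) m)
  refine key Finset.univ q (fun p => ?_) hS
  have h := hq p
  push_cast at h
  rw [← SetLike.mem_coe, ← CWComplex.skeletonLT_union_iUnion_closedCell_eq_skeletonLT_succ] at h
  simpa [T] using h

/-- A map from a complex of dimension less than `m` to a finite CW complex can be pushed into the
`(m - 1)`-skeleton, by removing the cells in the order of descending dimension. -/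
lemma exists_push_into_skeleton [RelCWComplex.Finite (univ : Set Y)]
    {L : PreAbstractSimplicialComplex X} {m : ℕ}
    (hL : ∀ s ∈ L, s.card ≤ m) (q : C(realization L, Y))
    {S : Set (realization L)} (hS : ∀ p ∈ S, q p ∈ CWComplex.skeletonLT (univ : Set Y) (m : ℕ∞)) :
    ∃ q' : C(realization L, Y), q.HomotopicRel q' S ∧
      ∀ p, q' p ∈ CWComplex.skeletonLT (univ : Set Y) (m : ℕ∞) := by
  have hfin : ∀ n, Finite (RelCWComplex.cell (univ : Set Y) n) := fun n =>
    RelCWComplex.FiniteType.finite_cell n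
  have key : ∀ (d : ℕ) (q : C(realization L, Y)),
      (∀ p, q p ∈ CWComplex.skeletonLT (univ : Set Y) ((m + d : ℕ) : ℕ∞)) →
      (∀ p ∈ S, q p ∈ CWComplex.skeletonLT (univ : Set Y) (m : ℕ∞)) →
      ∃ q' : C(realization L, Y), q.HomotopicRel q' S ∧
        ∀ p, q' p ∈ CWComplex.skeletonLT (univ : Set Y) (m : ℕ∞) := by
    intro d
    induction d with
    | zero => exact fun q hq _ => ⟨q, .refl q, hq⟩
    | succ d ih =>
      intro q hq hS
      obtain ⟨q₁, hq₁, hq₁T⟩ := exists_avoid_cells (m := m + d) (fun s hs => (hL s hs).trans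
        (Nat.le_add_right _ _)) q hq (S := S)
        (fun p hp => CWComplex.skeletonLT_mono (by exact_mod_cast Nat.le_add_right m d) (hS p hp))
      have heq : ∀ p ∈ S, q₁ p = q p := fun p hp => by
        obtain ⟨F⟩ := hq₁
        exact (F.fst_eq_snd hp).symm
      obtain ⟨q₂, hq₂, hq₂T⟩ := ih q₁ hq₁T (fun p hp => heq p hp ▸ hS p hp)
      exact ⟨q₂, hq₁.trans hq₂, hq₂T⟩
  obtain ⟨N, hN⟩ := Filter.eventually_atTop.1
    (RelCWComplex.FiniteDimensional.eventually_isEmpty_cell (C := (univ : Set Y)) (D := ∅))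
  refine key N q (fun p => ?_) hS
  have hp : q p ∈ ⋃ (n : ℕ) (e : RelCWComplex.cell (univ : Set Y) n),
      RelCWComplex.openCell n e := by
    rw [CWComplex.iUnion_openCell_eq_complex]
    trivial
  simp only [mem_iUnion] at hp
  obtain ⟨n, e, he⟩ := hp
  refine CWComplex.mem_skeletonLT_iff.2 ⟨n, ?_, e, he⟩
  have : n < N := by
    by_contra! hn
    exact (hN n hn).false e
  exact_mod_cast (by omega)

/-- The cellular approximation theorem: every map from the realization of a finite simplicial
complex to a finite CW complex is homotopic to a cellular map. -/
lemma exists_cellular_approximation [RelCWComplex.Finite (univ : Set Y)]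
    {K : PreAbstractSimplicialComplex X} (g : C(realization K, Y)) :
    ∃ g' : C(realization K, Y), g.Homotopic g' ∧ IsCellular g' := by
  have key : ∀ n : ℕ, ∃ g' : C(realization K, Y), g.Homotopic g' ∧
      ∀ p : realization K, (supp (p : X → ℝ)).card ≤ n →
        g' p ∈ CWComplex.skeletonLT (univ : Set Y) ((supp (p : X → ℝ)).card : ℕ∞) := by
    intro n
    induction n with
    | zero =>
      refine ⟨g, .refl g, fun p hp => ?_⟩
      have := (supp_nonempty p.2.1).card_pos
      omega
    | succ n ih =>
      obtain ⟨g₁, hg₁, hskel⟩ := ih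
      let L : PreAbstractSimplicialComplex X :=
        { faces := {s | s ∈ K ∧ s.card ≤ n + 1}
          isRelLowerSet_faces := fun s hs => ⟨nonempty_of_mem hs.1, fun t hts ht =>
            ⟨mem_of_subset hs.1 hts ht, (Finset.card_le_card hts).trans hs.2⟩⟩ }
      have hLK : L ≤ K := fun s hs => hs.1
      let q : C(realization L, Y) := g₁.comp (realizationIncl hLK)
      let S : Set (realization L) := {p | (supp (p : X → ℝ)).card ≤ n}
      obtain ⟨q', ⟨F⟩, hq'⟩ := exists_push_into_skeleton (m := n + 1) (L := L)
        (fun s hs => hs.2) q (S := S) (fun p hp => by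
          refine CWComplex.skeletonLT_mono ?_ (hskel (realizationIncl hLK p) hp)
          exact_mod_cast (le_trans hp (Nat.le_succ n)))
      obtain ⟨N⟩ := nonempty_neighborhoodDeformation hLK
      obtain ⟨H, H0, H1⟩ := N.exists_extension (isEmbedding_realizationIncl hLK) g₁
        F.toContinuousMap (fun p => F.apply_zero p)
      refine ⟨H.comp ⟨fun p => (1, p), by fun_prop⟩,
        hg₁.trans ⟨⟨H, fun p => H0 p, fun p => rfl⟩⟩, fun p hp => ?_⟩
      have hpL : (p : X → ℝ) ∈ realization L :=
        mem_realization.2 ⟨p.2.1, (mem_realization.1 p.2).2, hp⟩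
      have hval : H (1, p) = q' ⟨p, hpL⟩ := by
        have := H1 1 ⟨p, hpL⟩
        exact this.trans (F.apply_one ⟨p, hpL⟩)
      change H (1, p) ∈ _
      rw [hval]
      rcases hp.lt_or_eq with hlt | heq
      · have hS : (⟨p, hpL⟩ : realization L) ∈ S := Nat.lt_succ_iff.1 hlt
        rw [← F.fst_eq_snd hS]
        exact hskel p (Nat.lt_succ_iff.1 hlt)
      · rw [heq]
        exact hq' ⟨p, hpL⟩
  obtain ⟨g', hg', h⟩ := key (Fintype.card X)
  exact ⟨g', hg', fun p => h p (Finset.card_le_univ _)⟩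

end CellularApproximation

/-! ### Adding points to a subposet -/

section AddingPoints

variable {X : Type u} [PartialOrder X]

/-- Adding to `S` an antichain `C` of points with nothing above them and all smaller points in `S`
adds the cones over the descending links to the order complex. -/
lemma orderComplex_union_eq {S C : Set X} (hC : ∀ x ∈ C, Iio x ⊆ S)
    (hmax : ∀ x ∈ C, ∀ z ∈ S ∪ C, ¬ x < z) :
    orderComplex (S ∪ C) =
      orderComplex S ⊔ ⨆ x ∈ C, simplicialCone x (orderComplex (Iio x)) := by
  refine le_antisymm (fun s hs => ?_) (sup_le (orderComplex_mono subset_union_left) ?_)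
  · obtain ⟨hne, hsub, hch⟩ := mem_orderComplex.1 hs
    by_cases h : ∃ x ∈ s, x ∈ C
    · obtain ⟨x, hxs, hxC⟩ := h
      have hle : simplicialCone x (orderComplex (Iio x)) ≤
          orderComplex S ⊔ ⨆ x ∈ C, simplicialCone x (orderComplex (Iio x)) :=
        le_sup_of_le_right (le_iSup₂ (f := fun x (_ : x ∈ C) =>
          simplicialCone x (orderComplex (Iio x))) x hxC)
      refine hle ?_
      rw [simplicialCone_Iio]
      refine mem_orderComplex.2 ⟨hne, fun v hv => ?_, hch⟩
      rcases hch.total hv hxs with hvx | hxv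
      · exact hvx
      · exact (eq_of_le_of_not_lt hxv (hmax x hxC v (hsub hv))).symm.le
    · push Not at h
      have hle : orderComplex S ≤
        orderComplex S ⊔ ⨆ x ∈ C, simplicialCone x (orderComplex (Iio x)) := le_sup_left
      exact hle (mem_orderComplex.2 ⟨hne, fun v hv => (hsub hv).resolve_right (h v hv), hch⟩)
  · refine iSup₂_le fun x hx => ?_
    rw [simplicialCone_Iio, ← Iio_insert]
    exact orderComplex_mono (insert_subset (Or.inr hx) ((hC x hx).trans subset_union_left))

lemma orderComplex_inf_cone {S : Set X} {x : X} (hx : x ∉ S) (hS : Iio x ⊆ S) :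
    orderComplex S ⊓ simplicialCone x (orderComplex (Iio x)) = orderComplex (Iio x) := by
  refine le_antisymm ?_ (le_inf (orderComplex_mono hS) (le_simplicialCone _ _))
  rw [simplicialCone_Iio]
  rintro s ⟨⟨hne, h1, hch⟩, -, h2, -⟩
  refine mem_orderComplex.2 ⟨hne, fun v hv => lt_of_le_of_ne (h2 hv) ?_, hch⟩
  rintro rfl
  exact hx (h1 hv)

variable [Fintype X]

/-- The map to `|K(T)|` given on each cone over a descending link by the inclusion, if `T` contains
the points of `C` and their descending links. -/
noncomputable def conesTo (C T : Set X)
    (h : ∀ x ∈ C, simplicialCone x (orderComplex (Iio x)) ≤ orderComplex T) :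
    C(LinkCones C, realization (orderComplex T)) :=
  ⟨fun p => realizationIncl (h p.1 p.1.2) p.2,
    continuous_sigma fun x => (realizationIncl (h x x.2)).continuous⟩

instance (C : Set X) : CompactSpace (LinkCones C) := by
  have := Fintype.ofFinite C
  infer_instance

/-- The realization of the order complex of `S ∪ C` is glued from that of the order complex of `S`
and the cones over the descending links of the points of `C`. -/
lemma isGluing_links {S C : Set X} (hC : ∀ x ∈ C, Iio x ⊆ S)
    (hmax : ∀ x ∈ C, ∀ z ∈ S ∪ C, ¬ x < z) (hdisj : ∀ x ∈ C, x ∉ S)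
    (hcone : ∀ x ∈ C, simplicialCone x (orderComplex (Iio x)) ≤ orderComplex (S ∪ C)) :
    IsGluing (linksTo C S hC) (linksToCones C)
      (realizationIncl (orderComplex_mono (subset_union_left : S ⊆ S ∪ C)))
      (conesTo C (S ∪ C) hcone) := by
  have hcone' : ∀ (x : X) (p : realization (simplicialCone x (orderComplex (Iio x)))),
      (∀ v, p.1 v ≠ 0 → v ≤ x) ∧ IsChain (· ≤ ·) {v | p.1 v ≠ 0} := by
    rintro x ⟨p, hp⟩
    rw [simplicialCone_Iio] at hp
    exact (mem_realization_orderComplex.1 hp).2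
  -- a point of a cone whose coordinate at the apex vanishes is in the link
  have hlink : ∀ d : LinkCones C, d.2.1 d.1 = 0 → d ∈ range (linksToCones C) := by
    rintro ⟨x, p⟩ h
    obtain ⟨h1, h2⟩ := hcone' x p
    refine ⟨⟨x, ⟨p.1, mem_realization_orderComplex.2 ⟨p.2.1, fun v hv => ?_, h2⟩⟩⟩, rfl⟩
    refine lt_of_le_of_ne (h1 v hv) ?_
    rintro rfl
    exact hv h
  refine ⟨fun b => rfl, (isEmbedding_realizationIncl _).injective, fun y d h => ?_,
    fun d d' hd h => ?_, ?_⟩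
  · have hval : y.1 = d.2.1 := congrArg Subtype.val h
    refine hlink d ?_
    by_contra h0
    rw [← hval] at h0
    exact hdisj d.1 d.1.2 ((mem_realization_orderComplex.1 y.2).2.1 _ h0)
  · have hval : d.2.1 = d'.2.1 := congrArg Subtype.val h
    have hx : d.2.1 d.1 ≠ 0 := fun h0 => hd (hlink d h0)
    obtain ⟨x, p⟩ := d
    obtain ⟨x', p'⟩ := d'
    have hxx : x = x' := by
      have hle : (x : X) ≤ x' := (hcone' x' p').1 x (by rw [← hval]; exact hx)
      exact Subtype.ext (eq_of_le_of_not_lt hle (hmax x x.2 x' (Or.inr x'.2)))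
    subst hxx
    exact congrArg (Sigma.mk x) (Subtype.ext hval)
  · have hcont : Continuous (Sum.elim
        (realizationIncl (orderComplex_mono (subset_union_left : S ⊆ S ∪ C)))
        (conesTo C (S ∪ C) hcone)) := by fun_prop
    refine hcont.isClosedMap.isQuotientMap hcont fun p => ?_
    obtain ⟨h1, h2, h3⟩ := mem_realization_orderComplex.1 p.2
    by_cases h : ∃ x ∈ C, p.1 x ≠ 0
    · obtain ⟨x, hx, hpx⟩ := h
      refine ⟨Sum.inr ⟨⟨x, hx⟩, ⟨p.1, ?_⟩⟩, rfl⟩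
      rw [simplicialCone_Iio]
      refine mem_realization_orderComplex.2 ⟨h1, fun v hv => ?_, h3⟩
      rcases h3.total hv hpx with hvx | hxv
      · exact hvx
      · exact (eq_of_le_of_not_lt hxv (hmax x hx v (h2 v hv))).symm.le
    · push Not at h
      refine ⟨Sum.inl ⟨p.1, mem_realization_orderComplex.2 ⟨h1, fun v hv => ?_, h3⟩⟩, rfl⟩
      exact (h2 v hv).resolve_right fun hvC => hv (h v hvC)

/-- Adding a pair `x < y` to a subposet `Z`, where the descending link of `y` with `x` removed is
contractible and contained in `Z`, does not change the homotopy type: the order complex grows by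
the cone over the descending link of `y`, which meets `K(Z)` in that contractible complex. -/
lemma isStrongDeformationRetract_insert_pair {Z : Set X} {x y : X} (hxy : x < y)
    (hx : x ∉ Z) (hy : y ∉ Z) (hxZ : Iio x ⊆ Z) (hyZ : Iio y \ {x} ⊆ Z)
    (hxmax : ∀ z ∈ Z, ¬ x < z) (hymax : ∀ z ∈ Z, ¬ y < z)
    (hcontr : ContractibleSpace (realization (orderComplex (Iio y \ {x})))) :
    IsStrongDeformationRetract (realization (orderComplex Z))
      (realization (orderComplex (insert x (insert y Z)))) := by
  have := contractibleSpace_Iic y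
  have hle : orderComplex (Iio y \ {x}) ≤ orderComplex (Iic y) :=
    orderComplex_mono (sdiff_subset.trans Iio_subset_Iic_self)
  have h1 := isStrongDeformationRetract_realization hle (isHomotopyEquivalence_of_contractible _)
  have hinter : realization (orderComplex (Iio y \ {x})) =
      realization (orderComplex Z) ∩ realization (orderComplex (Iic y)) := by
    ext p
    refine ⟨fun hp => ⟨realization_mono (orderComplex_mono hyZ) hp, realization_mono hle hp⟩, ?_⟩
    rintro ⟨hp, hp'⟩
    obtain ⟨h1, h2, h3⟩ := mem_realization_orderComplex.1 hp
    obtain ⟨-, h2', -⟩ := mem_realization_orderComplex.1 hp'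
    refine mem_realization_orderComplex.2 ⟨h1, fun v hv => ⟨lt_of_le_of_ne (h2' v hv) ?_, ?_⟩, h3⟩
    · rintro rfl
      exact hy (h2 _ hv)
    · rintro rfl
      exact hx (h2 _ hv)
  have hunion : realization (orderComplex (insert x (insert y Z))) =
      realization (orderComplex Z) ∪ realization (orderComplex (Iic y)) := by
    refine Subset.antisymm (fun p hp => ?_) (union_subset
      (realization_mono (orderComplex_mono fun z hz => Or.inr (Or.inr hz)))
      (realization_mono (orderComplex_mono fun z hz => ?_)))
    · obtain ⟨h1, h2, h3⟩ := mem_realization_orderComplex.1 hp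
      by_cases hpy : p y = 0
      · by_cases hpx : p x = 0
        · refine Or.inl (mem_realization_orderComplex.2 ⟨h1, fun v hv => ?_, h3⟩)
          rcases h2 v hv with rfl | rfl | h
          exacts [absurd hpx hv, absurd hpy hv, h]
        · refine Or.inr (mem_realization_orderComplex.2 ⟨h1, fun v hv => ?_, h3⟩)
          rcases h2 v hv with rfl | rfl | h
          · exact hxy.le
          · exact absurd hpy hv
          · rcases h3.total hv hpx with hvx | hxv
            · exact hvx.trans hxy.le
            · exact (eq_of_le_of_not_lt hxv (hxmax v h)).symm.le.trans hxy.le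
      · refine Or.inr (mem_realization_orderComplex.2 ⟨h1, fun v hv => ?_, h3⟩)
        rcases h2 v hv with rfl | rfl | h
        · exact hxy.le
        · exact le_rfl
        · rcases h3.total hv hpy with hvy | hyv
          · exact hvy
          · exact (eq_of_le_of_not_lt hyv (hymax v h)).symm.le
    · rcases (mem_Iic.1 hz).eq_or_lt with rfl | hlt
      · exact Or.inr (Or.inl rfl)
      · by_cases hzx : z = x
        · exact Or.inl hzx
        · exact Or.inr (Or.inr (hyZ ⟨hlt, hzx⟩))
  rw [hunion]
  exact h1.union (isCompact_realization _).isClosed (isCompact_realization _).isClosed hinter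

end AddingPoints

/-! ### The filtration of a poset with a Morse matching -/

section Filtration

variable {X : Type u} {A : Set X}

open Classical in
/-- The value at which a point enters the filtration: the second point of an edge of the matching
enters together with the first one, and all other points enter at their value under `f`. -/
noncomputable def entryValue (f : (Aᶜ : Set X) → ℝ) (M : Set ((Aᶜ : Set X) × (Aᶜ : Set X)))
    (z : (Aᶜ : Set X)) : ℝ :=
  if h : ∃ x, (x, z) ∈ M then f h.choose else f z

/-- The points of `A` and the points which enter before the value `a`. -/
def stageLT (f : (Aᶜ : Set X) → ℝ) (M : Set ((Aᶜ : Set X) × (Aᶜ : Set X))) (a : ℝ) : Set X :=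
  {z | ∀ hz : z ∈ Aᶜ, entryValue f M ⟨z, hz⟩ < a}

/-- The points of `A` and the points which enter at the value `a` or before. -/
def stageLE (f : (Aᶜ : Set X) → ℝ) (M : Set ((Aᶜ : Set X) × (Aᶜ : Set X))) (a : ℝ) : Set X :=
  {z | ∀ hz : z ∈ Aᶜ, entryValue f M ⟨z, hz⟩ ≤ a}

variable {f : (Aᶜ : Set X) → ℝ} {M : Set ((Aᶜ : Set X) × (Aᶜ : Set X))}

lemma entryValue_of_notMem {z : (Aᶜ : Set X)} (h : ∀ x, (x, z) ∉ M) : entryValue f M z = f z :=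
  dif_neg fun ⟨x, hx⟩ => h x hx

lemma stageLT_subset_stageLE (a : ℝ) : stageLT f M a ⊆ stageLE f M a :=
  fun _ hz hzA => (hz hzA).le

lemma mem_criticalSet {a : ℝ} {x : X} : x ∈ criticalSet A f M a ↔
    ∃ hx : x ∈ Aᶜ, IsCritical M ⟨x, hx⟩ ∧ f ⟨x, hx⟩ = a := by
  constructor
  · rintro ⟨⟨x, hx⟩, ⟨h1, h2⟩, rfl⟩
    exact ⟨hx, h1, h2⟩
  · rintro ⟨hx, h1, h2⟩
    exact ⟨⟨x, hx⟩, ⟨h1, h2⟩, rfl⟩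

lemma entryValue_of_isCritical {c : (Aᶜ : Set X)} (h : IsCritical M c) :
    entryValue f M c = f c :=
  entryValue_of_notMem fun _ hx => (h _ hx).2 rfl

lemma notMem_of_mem_criticalSet {a : ℝ} {x : X} (hx : x ∈ criticalSet A f M a) :
    x ∉ stageLT f M a := by
  obtain ⟨hxA, hc, rfl⟩ := mem_criticalSet.1 hx
  intro h
  have := h hxA
  rw [entryValue_of_isCritical hc] at this
  exact lt_irrefl _ this

lemma criticalSet_subset_stageLE (a : ℝ) : criticalSet A f M a ⊆ stageLE f M a := by
  intro x hx hxA
  obtain ⟨hxA', hc, hfa⟩ := mem_criticalSet.1 hx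
  exact (entryValue_of_isCritical hc).trans_le hfa.le

lemma stage_subset_stageLE (a : ℝ) :
    stageLT f M a ∪ criticalSet A f M a ⊆ stageLE f M a :=
  union_subset (stageLT_subset_stageLE a) (criticalSet_subset_stageLE a)

variable [PartialOrder X]

lemma entryValue_of_mem (hM : IsHasseMatching M) {x z : (Aᶜ : Set X)} (h : (x, z) ∈ M) :
    entryValue f M z = f x := by
  have hex : ∃ x, (x, z) ∈ M := ⟨x, h⟩
  have : hex.choose = x :=
    congrArg Prod.fst (hM.2 _ hex.choose_spec _ h (Or.inr (Or.inr (Or.inr rfl))))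
  rw [entryValue, dif_pos hex, this]

lemma entryValue_fst (hM : IsHasseMatching M) {x z : (Aᶜ : Set X)} (h : (x, z) ∈ M) :
    entryValue f M x = f x := by
  refine entryValue_of_notMem fun w hw => ?_
  have heq := hM.2 _ hw _ h (Or.inr (Or.inr (Or.inl rfl)))
  have h2 : x = z := congrArg Prod.snd heq
  exact (hM.1 _ h).lt.ne h2

variable [Fintype X]

lemma IsMorseFunction.strictMono (hf : IsMorseFunction f) : StrictMono f := by
  classical
  have : Fintype (Aᶜ : Set X) := Fintype.ofFinite _
  let : LocallyFiniteOrder (Aᶜ : Set X) := Fintype.toLocallyFiniteOrder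
  exact (strictMono_iff_forall_covBy f).2 hf

lemma entryValue_le (hf : IsMorseFunction f) (hM : IsHasseMatching M) (z : (Aᶜ : Set X)) :
    entryValue f M z ≤ f z := by
  by_cases h : ∃ x, (x, z) ∈ M
  · obtain ⟨x, hx⟩ := h
    rw [entryValue_of_mem hM hx]
    exact (hf _ _ (hM.1 _ hx)).le
  · rw [entryValue_of_notMem fun x hx => h ⟨x, hx⟩]

/-- A point which enters before its value is the second point of an edge of the matching. -/
lemma exists_mem_of_entryValue_lt (hM : IsHasseMatching M) {z : (Aᶜ : Set X)}
    (h : entryValue f M z < f z) : ∃ x, (x, z) ∈ M ∧ f x = entryValue f M z := by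
  by_cases hex : ∃ x, (x, z) ∈ M
  · obtain ⟨x, hx⟩ := hex
    exact ⟨x, hx, (entryValue_of_mem hM hx).symm⟩
  · rw [entryValue_of_notMem fun x hx => hex ⟨x, hx⟩] at h
    exact absurd h (lt_irrefl _)

/-- No value of `f` lies strictly between the entry value of a point and its value. -/
lemma not_lt_of_entryValue_lt (hM : IsAdmissibleMorseMatching A f M) {z w : (Aᶜ : Set X)}
    (h : entryValue f M z < f w) : f z ≤ f w := by
  by_contra! hlt
  obtain ⟨x, hx, hfx⟩ := exists_mem_of_entryValue_lt hM.1.1 (h.trans hlt)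
  exact (hM.2 _ hx).2 ⟨w, hfx ▸ h, hlt⟩

lemma mem_stageLT_of_lt (hf : IsMorseFunction f) (hM : IsHasseMatching M) {x : (Aᶜ : Set X)}
    {w : X} (hw : w < x) : w ∈ stageLT f M (f x) := fun hwA =>
  (entryValue_le hf hM ⟨w, hwA⟩).trans_lt
    (hf.strictMono (show (⟨w, hwA⟩ : (Aᶜ : Set X)) < x from hw))

lemma Iio_subset_of_mem_criticalSet (hf : IsMorseFunction f) (hM : IsHasseMatching M) {a : ℝ}
    {x : X} (hx : x ∈ criticalSet A f M a) : Iio x ⊆ stageLT f M a := by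
  obtain ⟨hxA, -, rfl⟩ := mem_criticalSet.1 hx
  exact fun w hw => mem_stageLT_of_lt hf hM (x := ⟨x, hxA⟩) hw

lemma not_lt_of_mem_criticalSet (hA : IsLowerSet A) (hf : IsMorseFunction f)
    (hM : IsAdmissibleMorseMatching A f M) {a : ℝ} {x : X} (hx : x ∈ criticalSet A f M a) :
    ∀ z ∈ stageLT f M a ∪ criticalSet A f M a, ¬ x < z := by
  obtain ⟨hxA, -, rfl⟩ := mem_criticalSet.1 hx
  intro z hz hlt
  have hzA : z ∈ Aᶜ := fun h => hxA (hA hlt.le h)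
  have hfz : f ⟨x, hxA⟩ < f ⟨z, hzA⟩ :=
    hf.strictMono (show (⟨x, hxA⟩ : (Aᶜ : Set X)) < ⟨z, hzA⟩ from hlt)
  rcases hz with hz | hz
  · exact not_lt.2 (not_lt_of_entryValue_lt hM (hz hzA)) hfz
  · obtain ⟨hzA', hc, h⟩ := mem_criticalSet.1 hz
    exact hfz.ne' h

/-- The points of the edges of a set of edges of the matching. -/
def edgePoints (F : Set ((Aᶜ : Set X) × (Aᶜ : Set X))) : Set X :=
  {z | ∃ e ∈ F, z = e.1 ∨ z = e.2}

/-- Adding the points of the edges of the matching of a given value is a sequence of elementary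
expansions. The edges have to be added in an order in which `(x', y')` comes before `(x, y)` if
`x' < y`; this is possible because the matching is acyclic. The last hypothesis says that `F` is an
initial segment of such an order. -/
lemma isStrongDeformationRetract_edgePoints (hA : IsLowerSet A) (hf : IsMorseFunction f)
    (hM : IsAdmissibleMorseMatching A f M) (a : ℝ) (n : ℕ) :
    ∀ F : Finset ((Aᶜ : Set X) × (Aᶜ : Set X)), F.card = n → (∀ e ∈ F, e ∈ M ∧ f e.1 = a) →
      (∀ e ∈ F, ∀ e' ∈ M, f e'.1 = a → e'.1 < e.2 → e' ∈ F) →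
      IsStrongDeformationRetract
        (realization (orderComplex (stageLT f M a ∪ criticalSet A f M a)))
        (realization (orderComplex
          (stageLT f M a ∪ criticalSet A f M a ∪
            edgePoints (F : Set ((Aᶜ : Set X) × (Aᶜ : Set X)))))) := by
  classical
  induction n with
  | zero =>
    intro F hF _ _
    have : edgePoints (F : Set ((Aᶜ : Set X) × (Aᶜ : Set X))) = ∅ := by
      rw [Finset.card_eq_zero.1 hF]
      ext
      simp [edgePoints]
    rw [this, union_empty]
    exact .refl _
  | succ n ih =>
    intro F hF hFM hcl
    obtain ⟨hHM, hacyc⟩ := hM.1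
    -- `r e' e` holds if `e` can be reached from `e'` in the modified Hasse diagram
    let r : (Aᶜ : Set X) × (Aᶜ : Set X) → (Aᶜ : Set X) × (Aᶜ : Set X) → Prop :=
      fun e' e => Relation.TransGen (MatchingStep M) e'.2 e.2
    have hr : ∀ e ∈ F, ∀ e' ∈ F, e ≠ e' → e'.1 < e.2 → r e e' := by
      intro e he e' he' hne hlt
      obtain ⟨heM, hea⟩ := hFM e he
      obtain ⟨heM', hea'⟩ := hFM e' he'
      have hcov : e'.1 ⋖ e.2 := by
        refine ⟨hlt, fun w h1 h2 => ?_⟩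
        have h1' := hf.strictMono h1
        have h2' := hf.strictMono h2
        exact (hM.2 e heM).2 ⟨w, by rw [hea, ← hea']; exact h1', h2'⟩
      refine Relation.TransGen.tail (Relation.TransGen.single (Or.inr ⟨hcov, fun h => hne ?_⟩))
        (Or.inl ⟨hHM.1 e' heM', heM'⟩)
      have h1 := hHM.2 _ h _ heM (Or.inr (Or.inr (Or.inr rfl)))
      have h2 := hHM.2 _ h _ heM' (Or.inl rfl)
      exact h1.symm.trans h2
    have : IsTrans _ r := ⟨fun _ _ _ h h' => Relation.TransGen.trans h h'⟩
    have : Std.Irrefl r := ⟨fun e h => hacyc e.2 h⟩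
    have hwf : WellFounded r := Finite.wellFounded_of_trans_of_irrefl r
    have hFne : (F : Set ((Aᶜ : Set X) × (Aᶜ : Set X))).Nonempty := by
      rw [Finset.coe_nonempty, ← Finset.card_pos]
      omega
    -- the last edge `e = (x, y)`: no other edge `(x', y')` satisfies `x < y'`
    obtain ⟨e, heF, hmin⟩ := hwf.has_min _ hFne
    have hmin' : ∀ e' ∈ F, e' ≠ e → ¬ e.1 < e'.2 := fun e' he' hne hlt =>
      hmin e' he' (hr e' he' e heF hne hlt)
    obtain ⟨heM, hea⟩ := hFM e heF
    have hcard : (F.erase e).card = n := by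
      rw [Finset.card_erase_of_mem heF, hF]
      rfl
    refine (ih (F.erase e) hcard (fun e' he' => hFM e' (Finset.mem_of_mem_erase he')) ?_).trans ?_
    · intro e' he' e'' he'' hea'' hlt
      refine Finset.mem_erase.2 ⟨?_, hcl e' (Finset.mem_of_mem_erase he') e'' he'' hea'' hlt⟩
      rintro rfl
      exact hmin' e' (Finset.mem_of_mem_erase he') (Finset.ne_of_mem_erase he') hlt
    set Z : Set X := stageLT f M a ∪ criticalSet A f M a ∪
      edgePoints ((F.erase e : Finset _) : Set ((Aᶜ : Set X) × (Aᶜ : Set X))) with hZ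
    have hfy : a < f e.2 := hea ▸ hf _ _ (hHM.1 e heM)
    have hZunion : stageLT f M a ∪ criticalSet A f M a ∪
        edgePoints (F : Set ((Aᶜ : Set X) × (Aᶜ : Set X))) =
        insert (e.1 : X) (insert (e.2 : X) Z) := by
      have hFe : ∀ e', e' ∈ F ↔ e' = e ∨ e' ∈ F.erase e := fun e' => by
        rw [← Finset.mem_insert, Finset.insert_erase heF]
      ext z
      simp only [hZ, mem_union, mem_insert_iff, edgePoints, Finset.mem_coe, hFe]
      constructor
      · rintro (h | ⟨e', rfl | he', h | h⟩)
        · exact Or.inr (Or.inr (Or.inl h))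
        · exact Or.inl h
        · exact Or.inr (Or.inl h)
        · exact Or.inr (Or.inr (Or.inr ⟨e', he', Or.inl h⟩))
        · exact Or.inr (Or.inr (Or.inr ⟨e', he', Or.inr h⟩))
      · rintro (h | h | h | ⟨e', he', h⟩)
        · exact Or.inr ⟨e, Or.inl rfl, Or.inl h⟩
        · exact Or.inr ⟨e, Or.inl rfl, Or.inr h⟩
        · exact Or.inl h
        · exact Or.inr ⟨e', Or.inr he', h⟩
    have hentry : ∀ z ∈ Z, ∀ hz : z ∈ Aᶜ, entryValue f M ⟨z, hz⟩ ≤ a := by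
      rintro z (hz | ⟨e', he', h | h⟩) hzA
      · exact stage_subset_stageLE a hz hzA
      · obtain ⟨h1, h2⟩ := hFM e' (Finset.mem_of_mem_erase he')
        have : (⟨z, hzA⟩ : (Aᶜ : Set X)) = e'.1 := Subtype.ext h
        rw [this, entryValue_fst hHM h1, h2]
      · obtain ⟨h1, h2⟩ := hFM e' (Finset.mem_of_mem_erase he')
        have : (⟨z, hzA⟩ : (Aᶜ : Set X)) = e'.2 := Subtype.ext h
        rw [this, entryValue_of_mem hHM h1, h2]
    -- a point of the stage which is incident to an edge of value `a` was added with that edge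
    have hedge : ∀ z ∈ Z, ∀ e' ∈ M, f e'.1 = a → (z = e'.1 ∨ z = e'.2) → e' ∈ F.erase e := by
      rintro z (((hz | hz) | ⟨e'', he'', h⟩)) e' he' hea' h'
      · rcases h' with rfl | rfl
        · have := hz e'.1.2
          rw [Subtype.coe_eta, entryValue_fst hHM he', hea'] at this
          exact absurd this (lt_irrefl _)
        · have := hz e'.2.2
          rw [Subtype.coe_eta, entryValue_of_mem hHM he', hea'] at this
          exact absurd this (lt_irrefl _)
      · obtain ⟨hzA, hc, -⟩ := mem_criticalSet.1 hz
        rcases h' with h' | h'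
        · exact absurd (Subtype.ext h'.symm) (hc e' he').1
        · exact absurd (Subtype.ext h'.symm) (hc e' he').2
      · have he''M := (hFM e'' (Finset.mem_of_mem_erase he'')).1
        have : e'' = e' := by
          refine hHM.2 _ he''M _ he' ?_
          rcases h with h | h <;> rcases h' with h' | h'
          · exact Or.inl (Subtype.ext (h.symm.trans h'))
          · exact Or.inr (Or.inl (Subtype.ext (h.symm.trans h')))
          · exact Or.inr (Or.inr (Or.inl (Subtype.ext (h.symm.trans h'))))
          · exact Or.inr (Or.inr (Or.inr (Subtype.ext (h.symm.trans h'))))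
        exact this ▸ he''
    have hnot : e ∉ F.erase e := Finset.notMem_erase e F
    have hup : ∀ {w z : X}, w ∈ Aᶜ → w < z → z ∈ Aᶜ := fun hw hlt h => hw (hA hlt.le h)
    rw [hZunion]
    refine isStrongDeformationRetract_insert_pair (hHM.1 e heM).lt
      (fun h => hnot (hedge _ h e heM hea (Or.inl rfl)))
      (fun h => hnot (hedge _ h e heM hea (Or.inr rfl))) ?_ ?_ ?_ ?_ (hM.2 e heM).1
    · intro w hw
      exact Or.inl (Or.inl (hea ▸ mem_stageLT_of_lt hf hHM hw))
    -- a point below `y` has value at most `a` by admissibility, and if it belongs to an edge of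
    -- value `a`, that edge is in `F`
    · rintro w ⟨hwy, hwx⟩
      by_cases hwA : w ∈ Aᶜ
      · have hfw : f ⟨w, hwA⟩ < f e.2 :=
          hf.strictMono (show (⟨w, hwA⟩ : (Aᶜ : Set X)) < e.2 from hwy)
        have hle : f ⟨w, hwA⟩ ≤ a := by
          by_contra! h
          exact (hM.2 e heM).2 ⟨⟨w, hwA⟩, hea ▸ h, hfw⟩
        rcases hle.lt_or_eq with hlt | heq
        · exact Or.inl (Or.inl fun _ => (entryValue_le hf hHM _).trans_lt hlt)
        · by_cases hc : IsCritical M ⟨w, hwA⟩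
          · exact Or.inl (Or.inr (mem_criticalSet.2 ⟨hwA, hc, heq⟩))
          · simp only [IsCritical, not_forall] at hc
            obtain ⟨e', he', h⟩ := hc
            by_cases h1 : e'.1 = ⟨w, hwA⟩
            · refine Or.inr ⟨e', Finset.mem_coe.2 (Finset.mem_erase.2 ⟨?_, ?_⟩), Or.inl ?_⟩
              · rintro rfl
                exact hwx (congrArg Subtype.val h1).symm
              · refine hcl e heF e' he' (by rw [h1, heq]) ?_
                rw [h1]
                exact hwy
              · rw [h1]
            · have h2 : e'.2 = ⟨w, hwA⟩ := by
                by_contra h2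
                exact h ⟨h1, h2⟩
              refine Or.inl (Or.inl fun _ => ?_)
              have he'' : (e'.1, (⟨w, hwA⟩ : (Aᶜ : Set X))) ∈ M := h2 ▸ he'
              rw [entryValue_of_mem hHM he'', ← heq]
              exact hf _ _ (hHM.1 _ he'')
      · exact Or.inl (Or.inl fun h => absurd h hwA)
    -- a point above `x` with entry value at most `a` is the second point of an edge of value `a`
    · intro z hz hlt
      have hzA : z ∈ Aᶜ := hup e.1.2 hlt
      have hfz : a < f ⟨z, hzA⟩ :=
        hea ▸ hf.strictMono (show e.1 < (⟨z, hzA⟩ : (Aᶜ : Set X)) from hlt)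
      have hen := hentry z hz hzA
      obtain ⟨x', hx', hfx'⟩ := exists_mem_of_entryValue_lt hHM (hen.trans_lt hfz)
      have hfx'a : f x' = a := by
        refine (hfx' ▸ hen).antisymm ?_
        by_contra! h
        exact (hM.2 _ hx').2 ⟨e.1, hea.symm ▸ h, hea.symm ▸ hfz⟩
      have hmem := hedge z hz _ hx' hfx'a (Or.inr rfl)
      exact hmin' _ (Finset.mem_of_mem_erase hmem) (Finset.ne_of_mem_erase hmem) hlt
    · intro z hz hlt
      have hzA : z ∈ Aᶜ := hup e.2.2 hlt
      have hfz : f e.2 < f ⟨z, hzA⟩ :=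
        hf.strictMono (show e.2 < (⟨z, hzA⟩ : (Aᶜ : Set X)) from hlt)
      exact not_lt.2 (not_lt_of_entryValue_lt hM ((hentry z hz hzA).trans_lt hfy)) hfz

/-- The points which enter at the value `a` are critical, or come in edges of the matching which can
be removed by a strong deformation retraction. -/
lemma isStrongDeformationRetract_stage (hA : IsLowerSet A) (hf : IsMorseFunction f)
    (hM : IsAdmissibleMorseMatching A f M) (a : ℝ) :
    IsStrongDeformationRetract
      (realization (orderComplex (stageLT f M a ∪ criticalSet A f M a)))
      (realization (orderComplex (stageLE f M a))) := by
  classical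
  have hHM := hM.1.1
  have : Fintype (Aᶜ : Set X) := Fintype.ofFinite _
  let F : Finset ((Aᶜ : Set X) × (Aᶜ : Set X)) := {e | e ∈ M ∧ f e.1 = a}
  have hF : ∀ e, e ∈ F ↔ e ∈ M ∧ f e.1 = a := fun e => by simp [F]
  have h := isStrongDeformationRetract_edgePoints hA hf hM a F.card F rfl
    (fun e he => (hF e).1 he) (fun _ _ e' he' hea' _ => (hF e').2 ⟨he', hea'⟩)
  convert h using 3
  refine Subset.antisymm (fun z hz => ?_) (union_subset (stage_subset_stageLE a) ?_)
  · by_cases hzA : z ∈ Aᶜ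
    · rcases (hz hzA).lt_or_eq with hlt | heq
      · exact Or.inl (Or.inl fun _ => hlt)
      · by_cases hex : ∃ x, (x, (⟨z, hzA⟩ : (Aᶜ : Set X))) ∈ M
        · obtain ⟨x, hx⟩ := hex
          rw [entryValue_of_mem hHM hx] at heq
          exact Or.inr ⟨_, Finset.mem_coe.2 ((hF _).2 ⟨hx, heq⟩), Or.inr rfl⟩
        · rw [entryValue_of_notMem fun x hx => hex ⟨x, hx⟩] at heq
          by_cases hey : ∃ y, ((⟨z, hzA⟩ : (Aᶜ : Set X)), y) ∈ M
          · obtain ⟨y, hy⟩ := hey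
            exact Or.inr ⟨_, Finset.mem_coe.2 ((hF _).2 ⟨hy, heq⟩), Or.inl rfl⟩
          · refine Or.inl (Or.inr (mem_criticalSet.2 ⟨hzA, fun e he => ⟨?_, ?_⟩, heq⟩))
            · rintro h
              exact hey ⟨e.2, h ▸ he⟩
            · rintro h
              exact hex ⟨e.1, h ▸ he⟩
    · exact Or.inl (Or.inl fun h => absurd h hzA)
  · rintro z ⟨e, he, h⟩ hzA
    obtain ⟨heM, hea⟩ := (hF e).1 (Finset.mem_coe.1 he)
    rcases h with h | h
    · have : (⟨z, hzA⟩ : (Aᶜ : Set X)) = e.1 := Subtype.ext h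
      rw [this, entryValue_fst hHM heM, hea]
    · have : (⟨z, hzA⟩ : (Aᶜ : Set X)) = e.2 := Subtype.ext h
      rw [this, entryValue_of_mem hHM heM, hea]

end Filtration

/-! ### The CW models of the stages -/

open Topology

section HomotopyEquivalences

variable {X Y Z : Type*} [TopologicalSpace X] [TopologicalSpace Y] [TopologicalSpace Z]

lemma IsHomotopyEquivalence.comp {g : C(Y, Z)} {f : C(X, Y)} (hg : IsHomotopyEquivalence g)
    (hf : IsHomotopyEquivalence f) : IsHomotopyEquivalence (g.comp f) := by
  obtain ⟨e, rfl⟩ := hg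
  obtain ⟨e', rfl⟩ := hf
  exact ⟨e'.trans e, rfl⟩

lemma IsHomotopyEquivalence.of_homotopic {g g' : C(X, Y)} (hg : IsHomotopyEquivalence g)
    (h : g.Homotopic g') : IsHomotopyEquivalence g' := by
  obtain ⟨e, rfl⟩ := hg
  exact ⟨⟨g', e.invFun, ((ContinuousMap.Homotopic.refl e.invFun).comp h.symm).trans e.left_inv,
    (h.symm.comp (ContinuousMap.Homotopic.refl e.invFun)).trans e.right_inv⟩, rfl⟩

end HomotopyEquivalences

section CellularModel

variable {X : Type u} [Fintype X] [PartialOrder X]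

/-- A cellular homotopy equivalence from the realization of the order complex of `S` to a finite CW
complex. -/
structure CellularModel (S : Set X) where
  /-- The CW complex. -/
  space : Type u
  [topologicalSpace : TopologicalSpace space]
  [t2Space : T2Space space]
  [compactSpace : CompactSpace space]
  [cwComplex : CWComplex (univ : Set space)]
  [finite : RelCWComplex.Finite (univ : Set space)]
  /-- The homotopy equivalence. -/
  map : C(realization (orderComplex S), space)
  isCellular : IsCellular map
  isHomotopyEquivalence : IsHomotopyEquivalence map

attribute [instance] CellularModel.topologicalSpace CellularModel.t2Space
  CellularModel.compactSpace CellularModel.cwComplex CellularModel.finite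

/-- The realization of an order complex is itself a CW complex: it is glued from its simplices,
starting from the empty space. -/
lemma exists_cellularModel_isHomeomorph (S : Set X) :
    ∃ m : CellularModel S, IsHomeomorph m.map := by
  have hle : orderComplex (∅ : Set X) ≤ orderComplex S := orderComplex_mono (empty_subset S)
  have hempty : IsEmpty (realization (orderComplex (∅ : Set X))) := by
    refine ⟨fun p => ?_⟩
    obtain ⟨-, s, ⟨⟨v, hv⟩, hs, -⟩, -⟩ := p.2
    exact hs hv
  let h : C(realization (orderComplex (∅ : Set X)), PEmpty.{u + 1}) :=
    ⟨fun p => hempty.elim p, continuous_of_discreteTopology⟩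
  have hcell : ∀ n, IsEmpty (RelCWComplex.cell (univ : Set PEmpty.{u + 1}) n) := fun n =>
    ⟨fun e => (RelCWComplex.map n e 0).elim⟩
  have : RelCWComplex.Finite (univ : Set PEmpty.{u + 1}) :=
    { eventually_isEmpty_cell := .of_forall hcell
      finite_cell := fun n => inferInstance }
  have hι := isEmbedding_realizationIncl hle
  have G := Adjunction.isGluing h hι.injective
  have : CompactSpace (Adjunction h (realizationIncl hle)) := G.compactSpace
  have : T2Space (Adjunction h (realizationIncl hle)) :=
    G.t2Space (hι.continuous.isClosedEmbedding hι.injective)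
  obtain ⟨hcw, hfin, hcel⟩ := G.exists_CWComplex (fun p => hempty.elim p)
  have hhomeo : IsHomeomorph (Adjunction.inr h (realizationIncl hle)) := by
    rw [isHomeomorph_iff_continuous_bijective]
    refine ⟨ContinuousMap.continuous _, fun d d' hd => ?_, fun y => ?_⟩
    · refine G.eq_of_notMem d d' ?_ hd
      rintro ⟨b, -⟩
      exact hempty.elim b
    · exact (G.exists_eq y).resolve_left fun ⟨y, _⟩ => y.elim
  exact ⟨⟨_, _, hcel, hhomeo.homeomorph.toHomotopyEquiv, rfl⟩, hhomeo⟩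

/-- If `S ∪ C` is a strong deformation retract of `T`, then the pushout of a cellular model of `S`
is homotopy equivalent to `T`, and the homotopy equivalence can be made cellular. -/
lemma CellularModel.exists_next {S C T : Set X} (hC : ∀ x ∈ C, Iio x ⊆ S)
    (hmax : ∀ x ∈ C, ∀ z ∈ S ∪ C, ¬ x < z) (hdisj : ∀ x ∈ C, x ∉ S) (hST : S ⊆ T)
    (hT : S ∪ C ⊆ T) (hr : IsStrongDeformationRetract (realization (orderComplex (S ∪ C)))
      (realization (orderComplex T))) (m : CellularModel S) :
    ∃ (m' : CellularModel T) (j : C(m.space, m'.space)) (k : C(LinkCones C, m'.space)),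
      IsAdjunctionSpace (m.map.comp (linksTo C S hC)) (linksToCones C) j k ∧
      (m'.map.comp (realizationIncl (orderComplex_mono hST))).Homotopic (j.comp m.map) := by
  have hle : orderComplex S ≤ orderComplex (S ∪ C) := orderComplex_mono subset_union_left
  have hι := isEmbedding_realizationIncl hle
  have G := Adjunction.isGluing m.map hι.injective
  have : CompactSpace (Adjunction m.map (realizationIncl hle)) := G.compactSpace
  have : T2Space (Adjunction m.map (realizationIncl hle)) :=
    G.t2Space (hι.continuous.isClosedEmbedding hι.injective)
  obtain ⟨hcw, hfin, hcel⟩ := G.exists_CWComplex m.isCellular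
  obtain ⟨N⟩ := nonempty_neighborhoodDeformation hle
  set j := Adjunction.inl m.map (realizationIncl hle) with hj
  set k := Adjunction.inr m.map (realizationIncl hle) with hk
  have hcomm : k.comp (realizationIncl hle) = j.comp m.map := ContinuousMap.ext G.comm
  have hke : IsHomotopyEquivalence k := by
    refine N.isHomotopyEquivalence_pushout hι m.isHomotopyEquivalence hcomm
      (fun T _ a b hab => ?_) G.exists_eq
    obtain ⟨c, h1, h2⟩ := G.exists_desc a b fun x => congrArg (fun g => g x) hab
    exact ⟨c, ContinuousMap.ext h1, ContinuousMap.ext h2⟩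
  set i := realizationIncl (orderComplex_mono hT) with hi
  obtain ⟨r, hri, hir⟩ := hr.exists_retraction i fun _ => rfl
  have hri' : r.comp i = .id _ := ContinuousMap.ext hri
  have hre : IsHomotopyEquivalence r :=
    ⟨⟨r, i, hir, hri' ▸ ContinuousMap.Homotopic.refl _⟩, rfl⟩
  obtain ⟨g, hg, hgcel⟩ := exists_cellular_approximation (k.comp r)
  have hcone : ∀ x ∈ C, simplicialCone x (orderComplex (Iio x)) ≤ orderComplex (S ∪ C) := by
    intro x hx
    rw [simplicialCone_Iio, ← Iio_insert]
    exact orderComplex_mono (insert_subset (Or.inr hx) ((hC x hx).trans subset_union_left))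
  refine ⟨⟨_, g, hgcel, (hke.comp hre).of_homotopic hg⟩, j, k.comp (conesTo C (S ∪ C) hcone),
    ?_, ?_⟩
  · exact IsPushout.paste_horiz (isGluing_links hC hmax hdisj hcone).isAdjunctionSpace
      G.isAdjunctionSpace
  · refine (hg.symm.comp (ContinuousMap.Homotopic.refl _)).trans ?_
    have : (k.comp r).comp (realizationIncl (orderComplex_mono hST)) = j.comp m.map := by
      rw [← hcomm]
      exact ContinuousMap.ext fun p => congrArg k (hri (realizationIncl hle p))
    rw [this]

end CellularModel

/-- Dependent choice for finite sequences. -/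
lemma exists_fin_sequence {n : ℕ} {α : Fin (n + 1) → Type*}
    {R : ∀ i : Fin n, α i.castSucc → α i.succ → Prop} (hR : ∀ i a, ∃ b, R i a b) (a₀ : α 0) :
    ∃ s : ∀ i, α i, s 0 = a₀ ∧ ∀ i : Fin n, R i (s i.castSucc) (s i.succ) := by
  choose g hg using hR
  exact ⟨fun i => Fin.induction (motive := α) a₀ g i, rfl, fun i => hg i _⟩

/-! ### The filtration by the values of the Morse function -/

section Stages

variable {X : Type u} {A : Set X} {f : (Aᶜ : Set X) → ℝ} {M : Set ((Aᶜ : Set X) × (Aᶜ : Set X))}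

lemma entryValue_mem_range (z : (Aᶜ : Set X)) : entryValue f M z ∈ range f := by
  unfold entryValue
  split_ifs
  exacts [⟨_, rfl⟩, ⟨_, rfl⟩]

/-- The filtration by entry values, if `t 0 < ⋯ < t (n - 1)` are the values of `f`: the points of
`A`, and the points which enter at one of the first `i` values. -/
def stage (f : (Aᶜ : Set X) → ℝ) (M : Set ((Aᶜ : Set X) × (Aᶜ : Set X))) {n : ℕ} (t : Fin n → ℝ)
    (i : Fin (n + 1)) : Set X :=
  {z | ∀ hz : z ∈ Aᶜ, ∃ j : Fin n, j.castSucc < i ∧ entryValue f M ⟨z, hz⟩ = t j}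

variable {n : ℕ} {t : Fin n → ℝ}

lemma stage_zero : stage f M t 0 = A := by
  ext z
  constructor
  · intro hz
    by_contra hzA
    obtain ⟨j, hj, -⟩ := hz hzA
    exact not_lt.2 (Fin.zero_le _) hj
  · exact fun hz hzA => absurd hz hzA

lemma stage_last (htf : range t = range f) : stage f M t (Fin.last n) = univ := by
  refine eq_univ_of_forall fun z hz => ?_
  obtain ⟨j, hj⟩ := htf ▸ entryValue_mem_range (f := f) (M := M) ⟨z, hz⟩
  exact ⟨j, j.castSucc_lt_last, hj.symm⟩

lemma stage_castSucc (ht : StrictMono t) (htf : range t = range f) (i : Fin n) :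
    stage f M t i.castSucc = stageLT f M (t i) := by
  ext z
  refine forall_congr' fun hz => ⟨?_, fun h => ?_⟩
  · rintro ⟨j, hj, h⟩
    exact h.trans_lt (ht hj)
  · obtain ⟨j, hj⟩ := htf ▸ entryValue_mem_range (f := f) (M := M) ⟨z, hz⟩
    exact ⟨j, ht.lt_iff_lt.1 (hj.trans_lt h), hj.symm⟩

lemma stage_succ (ht : StrictMono t) (htf : range t = range f) (i : Fin n) :
    stage f M t i.succ = stageLE f M (t i) := by
  ext z
  refine forall_congr' fun hz => ⟨?_, fun h => ?_⟩
  · rintro ⟨j, hj, h⟩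
    exact h.trans_le (ht.monotone (Fin.castSucc_lt_succ_iff.1 hj))
  · obtain ⟨j, hj⟩ := htf ▸ entryValue_mem_range (f := f) (M := M) ⟨z, hz⟩
    exact ⟨j, Fin.castSucc_lt_succ_iff.2 (ht.le_iff_le.1 (hj.trans_le h)), hj.symm⟩

/-- The points which enter at the largest value are critical: the second point of an edge of the
matching has a larger value than the first one. -/
lemma stageLT_union_criticalSet_of_max [PartialOrder X] [Fintype X] (hf : IsMorseFunction f)
    (hM : IsHasseMatching M) {a : ℝ} (ha : ∀ z, f z ≤ a) :
    stageLT f M a ∪ criticalSet A f M a = univ := by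
  have hfst : ∀ x y, (x, y) ∈ M → f x < a := fun x y h => (hf _ _ (hM.1 _ h)).trans_le (ha y)
  refine eq_univ_of_forall fun z => or_iff_not_imp_left.2 fun hz => ?_
  simp only [stageLT, mem_ofPred_eq, not_forall, not_lt] at hz
  obtain ⟨hzA, hz⟩ := hz
  have hfz : f ⟨z, hzA⟩ = a := (ha _).antisymm (hz.trans (entryValue_le hf hM _))
  refine mem_criticalSet.2 ⟨hzA, fun e he => ⟨fun h => ?_, fun h => ?_⟩, hfz⟩
  · exact (h ▸ hfst e.1 e.2 he).ne hfz
  · rw [← h, entryValue_of_mem hM (show (e.1, e.2) ∈ M from he)] at hz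
    exact not_lt.2 hz (hfst _ _ he)

end Stages

end PosetMorse

open PosetMorse
-- The values of `f` are `t 0 < ⋯ < t (n - 1)`, so `n = r + 1`; `Xs i` is `X_i`, while
-- `Xt i.castSucc` is `X̃_{i-1}` and `Xt i.succ` is `X̃_i`.
theorem theorem4p1 {X : Type u} [Fintype X] [PartialOrder X]
    (A : Set X) (hA : IsLowerSet A)
    (f : (Aᶜ : Set X) → ℝ) (hf : IsMorseFunction f)
    (M : Set ((Aᶜ : Set X) × (Aᶜ : Set X))) (hM : IsAdmissibleMorseMatching A f M)
    (n : ℕ) (t : Fin n → ℝ) (ht : StrictMono t) (htf : Set.range t = Set.range f) :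
    ∃ (Xs : Fin n → Set X) (Xt : Fin (n + 1) → Set X),
      -- the filtration
      Xt 0 = A ∧
      (∀ i : Fin n, Xt i.castSucc ⊆ Xs i ∧ Xs i ⊆ Xt i.succ) ∧
      (∀ i : Fin n, (i : ℕ) + 1 = n → Xs i = univ) ∧
      Xt (Fin.last n) = univ ∧
      -- passing from `X̃_{i-1}` to `X_i` glues the cones over the descending links along their bases
      (∀ i : Fin n, orderComplex (Xs i) = orderComplex (Xt i.castSucc) ⊔
        ⨆ x ∈ criticalSet A f M (t i), simplicialCone x (orderComplex (Iio x))) ∧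
      (∀ i : Fin n, ∀ x ∈ criticalSet A f M (t i),
        orderComplex (Xt i.castSucc) ⊓ simplicialCone x (orderComplex (Iio x)) =
          orderComplex (Iio x)) ∧
      -- `K(X_i)` is a strong deformation retract of `K(X̃_i)`
      (∀ i : Fin n, IsStrongDeformationRetract
        (realization (orderComplex (Xs i))) (realization (orderComplex (Xt i.succ)))) ∧
      -- `K(X)` is homotopy equivalent to a CW complex built from `K(A)` by gluing the cones
      (∃ (hlink : ∀ i : Fin n, ∀ x ∈ criticalSet A f M (t i), Iio x ⊆ Xt i.castSucc)
          (Y : Fin (n + 1) → TopCat.{u})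
          (h : ∀ i : Fin (n + 1), C(realization (orderComplex (Xt i)), Y i)),
        (∀ i, IsCWComplex (Y i)) ∧
        (∀ i, IsHomotopyEquivalence (h i)) ∧
        IsHomeomorph (h 0) ∧
        (∀ i : Fin n, ∃ (hsub : Xt i.castSucc ⊆ Xt i.succ)
            (j : C(Y i.castSucc, Y i.succ))
            (k : C(LinkCones (criticalSet A f M (t i)), Y i.succ)),
          IsAdjunctionSpace ((h i.castSucc).comp (linksTo _ (Xt i.castSucc) (hlink i)))
            (linksToCones _) j k ∧
          ((h i.succ).comp (realizationIncl (orderComplex_mono hsub))).Homotopic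
            (j.comp (h i.castSucc))) ∧
        Nonempty (ContinuousMap.HomotopyEquiv
          (realization (orderComplex (univ : Set X))) (Y (Fin.last n)))) ∧
      -- the case without critical points
      ((∀ c : (Aᶜ : Set X), ¬ IsCritical M c) →
        IsHomotopyEquivalence (realizationIncl (orderComplex_mono (subset_univ A)))) := by
  have hHM := hM.1.1
  have hlt : ∀ i, stage f M t i.castSucc = stageLT f M (t i) := stage_castSucc ht htf
  have hle : ∀ i, stage f M t i.succ = stageLE f M (t i) := stage_succ ht htf
  have hlink : ∀ i, ∀ x ∈ criticalSet A f M (t i), Iio x ⊆ stage f M t i.castSucc := by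
    intro i x hx
    rw [hlt]
    exact Iio_subset_of_mem_criticalSet hf hHM hx
  have hmax : ∀ i, ∀ x ∈ criticalSet A f M (t i),
      ∀ z ∈ stage f M t i.castSucc ∪ criticalSet A f M (t i), ¬ x < z := by
    intro i x hx
    rw [hlt]
    exact not_lt_of_mem_criticalSet hA hf hM hx
  have hdisj : ∀ i, ∀ x ∈ criticalSet A f M (t i), x ∉ stage f M t i.castSucc := by
    intro i x hx
    rw [hlt]
    exact notMem_of_mem_criticalSet hx
  have hsub : ∀ i : Fin n,
      stage f M t i.castSucc ∪ criticalSet A f M (t i) ⊆ stage f M t i.succ := by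
    intro i
    rw [hlt, hle]
    exact stage_subset_stageLE _
  have hret : ∀ i : Fin n, IsStrongDeformationRetract
      (realization (orderComplex (stage f M t i.castSucc ∪ criticalSet A f M (t i))))
      (realization (orderComplex (stage f M t i.succ))) := by
    intro i
    rw [hlt, hle]
    exact isStrongDeformationRetract_stage hA hf hM _
  refine ⟨fun i => stage f M t i.castSucc ∪ criticalSet A f M (t i), stage f M t, stage_zero,
    fun i => ⟨subset_union_left, hsub i⟩, fun i hi => ?_, stage_last htf,
    fun i => orderComplex_union_eq (hlink i) (hmax i),
    fun i x hx => orderComplex_inf_cone (hdisj i x hx) (hlink i x hx), hret, ⟨hlink, ?_⟩, ?_⟩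
  · simp only [hlt]
    refine stageLT_union_criticalSet_of_max hf hHM fun z => ?_
    obtain ⟨j, hj⟩ := htf.symm ▸ mem_range_self (f := f) z
    rw [← hj]
    exact ht.monotone (by rw [Fin.le_def]; omega)
  · obtain ⟨m₀, hm₀⟩ := exists_cellularModel_isHomeomorph (stage f M t 0)
    obtain ⟨m, rfl, hm⟩ := exists_fin_sequence (α := fun i => CellularModel (stage f M t i))
      (fun i m => m.exists_next (hlink i) (hmax i) (hdisj i)
        (subset_union_left.trans (hsub i)) (hsub i) (hret i)) m₀
    refine ⟨fun i => TopCat.of (m i).space, fun i => (m i).map,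
      fun i => ⟨(m i).t2Space, ⟨(m i).cwComplex⟩⟩, fun i => (m i).isHomotopyEquivalence, hm₀,
      fun i => ⟨subset_union_left.trans (hsub i), hm i⟩, ?_⟩
    obtain ⟨e, -⟩ := (m (Fin.last n)).isHomotopyEquivalence
    exact ⟨(Homeomorph.setCongr (by rw [stage_last htf])).toHomotopyEquiv.trans e⟩
  · intro hc
    have hchain : ∀ i, IsStrongDeformationRetract (realization (orderComplex A))
        (realization (orderComplex (stage f M t i))) := by
      intro i
      induction i using Fin.induction with
      | zero =>
        rw [stage_zero]
        exact .refl _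
      | succ i ih =>
        have hempty : criticalSet A f M (t i) = ∅ := by
          refine eq_empty_of_forall_notMem fun x hx => ?_
          obtain ⟨hxA, h, -⟩ := mem_criticalSet.1 hx
          exact hc _ h
        have := hret i
        rw [hempty, union_empty] at this
        exact ih.trans this
    have hA' := hchain (Fin.last n)
    rw [stage_last htf] at hA'
    obtain ⟨r, hri, hir⟩ := hA'.exists_retraction
      (realizationIncl (orderComplex_mono (subset_univ A))) fun _ => rfl
    have hri' : r.comp (realizationIncl (orderComplex_mono (subset_univ A))) = .id _ :=
      ContinuousMap.ext hri
    exact ⟨⟨_, r, hri' ▸ ContinuousMap.Homotopic.refl _, hir⟩, rfl⟩
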